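/- **Conventions.** A *bumpless pipe dream* (BPD) is a tiling of the quadrant $\{1,2,\dots\}^2$ (matrix coordinates) by the tiles: empty, $\ulcorner$-turn (joining south and east), $\lrcorner$-turn (joining west and north), horizontal, vertical, crossing, whose strands match along common edges, with no strand on the outer north or west boundary, which agrees outside some $n\times n$ square with the identity BPD (the tiling with $\ulcorner$ at $(i,i)$, horizontal tiles at $(i,j)$ for $i<j$, vertical tiles for $i>j$), and in which any two pipes cross at most once. Pipe $p$ is the pipe coming up from the bottom in column $p$; pipes travel north and east and exit along rows. In intermediate steps a *bump* tile (a $\lrcorner$-turn and a $\ulcorner$-turn touching) may occur. A *plactic biword* is a word of biletters $\binom{b_1\cdots b_\ell}{k_1\cdots k_\ell}$ of positive integers with $b_i\le k_i$ for all $i$ and $k_1\ge\cdots\ge k_\ell$. *Right insertion* of $\binom bk$ into a BPD $D$: let $(i,j)$ be the rightmost $\ulcorner$ in row $b$. (1) Min-droop the $\ulcorner$-turn at $(i,j)$ into $(i_1,j_1)$, where $i_1>i$ and $j_1>j$ are minimal such that $(i_1,j)$ and $(i,j_1)$ are not crossings (the pipe is rerouted from the west and north sides of this rectangle to its south and east sides).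 (2) If $(i_1,j_1)$ is now a $\lrcorner$, let $(i,j)$ be the nearest $\ulcorner$ to its left in row $i_1$, and return to (1). (3) If $(i_1,j_1)$ is now a bump whose two pipes cross elsewhere, replace the bump by a crossing and that crossing by a bump, let $(i,j)$ be the position of the new bump, and return to (1). If the two pipes do not cross and the pipe of the $\ulcorner$-turn exits from a row $\le k$, put $(i,j)=(i_1,j_1)$ and return to (1). Otherwise replace the bump by a crossing and stop. The BPD $\varphi(w)$ of a plactic biword $w$ is obtained from the identity BPD by successively right-inserting the biletters of $w$ from left to right. *Jeu de taquin* $\nabla$ on a BPD with an empty tile: mark the rightmost empty tile in the first row that has an empty tile. (1) Move the mark to the right end $(x,y)$ of its contiguous block of empty tiles; let $p$ be the pipe through $(x,y+1)$. (2) If $p\ne y+1$, let $(x',y+1)$, $x'>x$, be the $\lrcorner$ of $p$ in column $y+1$. For each pipe $q$ crossing $p$ at some $(z,y+1)$, $x<z<x'$, such that $(z,y)$ is a $\ulcorner$ of $q$, let $(z',y)$ be the $\lrcorner$ of $q$ in column $y$, and move these two turns of $q$ to $(z,y+1)$ and $(z',y+1)$; undroop $p$ from $(x',y+1)$ into $(x,y)$,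 so that it runs up column $y$ instead of column $y+1$ between rows $x'$ and $x$. Mark $(x',y+1)$, which is now empty, and return to (1). (3) If $p=y+1$, the pipes $y$ and $y+1$ cross at some $(x',y+1)$, $x'>x$; replace this crossing by a bump, undroop the $\lrcorner$-turn of the bump into $(x,y)$, adjusting the other pipes as in (2), and stop. For a BPD $D$ having an empty tile, let $\operatorname{rect}(D)$ be the result of successively applying jeu de taquin starting from all the empty tiles of the first row of $D$ that has an empty tile, from right to left. **Theorem.** Let $w=\binom{b_1\cdots b_\ell}{k_1\cdots k_\ell}$ be a nonempty plactic biword, let $b=\min\{b_1,\dots,b_\ell\}$, and let $w'$ be obtained from $w$ by removing all biletters with top entry $b$. Then the insertions of $w$ and $w'$ terminate and produce well-defined BPDs $D=\varphi(w)$ and $D'=\varphi(w')$; moreover $\operatorname{rect}(D)$ is well defined, and $$D'=\operatorname{rect}(D).$$ -/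

import Mathlib

/-- The tiles: empty tile, the two elbows, the horizontal and vertical straight tiles, the crossing,
and the bump (two elbows touching). Pipes travel from south to east: they enter a tile from the
south or from the west, and leave it to the north or to the east. The tile `rturn` holds a pipe
turning from south to east, the tile `jturn` a pipe turning from west to north, and `bump` holds
one pipe of either kind. -/
inductive Tile where
  | blank
  | rturn
  | jturn
  | horiz
  | vert
  | cross
  | bump
  deriving DecidableEq

namespace Tile

/-- The tile has a pipe on its north edge. -/
def hasN : Tile → Prop
  | jturn | vert | cross | bump => True
  | _ => False

/-- The tile has a pipe on its south edge. -/
def hasS : Tile → Prop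
  | rturn | vert | cross | bump => True
  | _ => False

/-- The tile has a pipe on its west edge. -/
def hasW : Tile → Prop
  | jturn | horiz | cross | bump => True
  | _ => False

/-- The tile has a pipe on its east edge. -/
def hasE : Tile → Prop
  | rturn | horiz | cross | bump => True
  | _ => False

end Tile

/-- A tiling of the quadrant. Rows go downwards and columns to the right, in matrix coordinates,
and both are indexed from `0`: row number `m` of the usual positive numbering is the index `m - 1`.
(Bumpless pipe dreams of permutations in `S_n` are extended by the identity, so that
`S_1 ⊆ S_2 ⊆ ⋯` all live on the same quadrant.) -/
abbrev Tiling := ℕ → ℕ → Tile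

/-- The bumpless pipe dream of the identity permutation. -/
def idTiling : Tiling := fun i j =>
  if i = j then Tile.rturn else if i < j then Tile.horiz else Tile.vert

/-- Replace the tile at position `(i, j)` by `t`. -/
def setTile (T : Tiling) (i j : ℕ) (t : Tile) : Tiling :=
  fun s u => if s = i ∧ u = j then t else T s u

/-- The two sides from which a pipe may enter a tile. -/
inductive Side where
  | south
  | west

/-- The pipe that enters a tile from the given side leaves it to the north. -/
def ExitsNorth : Side → Tile → Prop
  | Side.south, t => t = Tile.vert ∨ t = Tile.cross
  | Side.west, t => t = Tile.jturn ∨ t = Tile.bump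

/-- The pipe that enters a tile from the given side leaves it to the east. -/
def ExitsEast : Side → Tile → Prop
  | Side.south, t => t = Tile.rturn ∨ t = Tile.bump
  | Side.west, t => t = Tile.horiz ∨ t = Tile.cross

/-- `Enters T p s i j`: pipe `p` enters the tile at `(i, j)` from the side `s`. Pipes are named by
the column in which they come up from the bottom. -/
inductive Enters (T : Tiling) (p : ℕ) : Side → ℕ → ℕ → Prop
  | base (i : ℕ) (h : ∀ i', i < i' → T i' p = Tile.vert) : Enters T p Side.south i p
  | up (s : Side) (i j : ℕ) (h : Enters T p s (i + 1) j) (hx : ExitsNorth s (T (i + 1) j)) :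
      Enters T p Side.south i j
  | right (s : Side) (i j : ℕ) (h : Enters T p s i j) (hx : ExitsEast s (T i j)) :
      Enters T p Side.west i (j + 1)

/-- Pipe `p` eventually runs to the right along row `r`. -/
def ExitsRow (T : Tiling) (p r : ℕ) : Prop :=
  ∃ J, ∀ j, J ≤ j → Enters T p Side.west r j

/-- Pipes `p` and `q` cross each other at position `(i, j)`. -/
def CrossAt (T : Tiling) (p q i j : ℕ) : Prop :=
  T i j = Tile.cross ∧
    ((Enters T p Side.south i j ∧ Enters T q Side.west i j) ∨
      (Enters T q Side.south i j ∧ Enters T p Side.west i j))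

/-- (Reduced) bumpless pipe dreams, i.e. the union of all `BPD(π)`. -/
structure IsBPD (D : Tiling) : Prop where
  no_bump : ∀ i j, D i j ≠ Tile.bump
  horizontal_match : ∀ i j, (D i j).hasE ↔ (D i (j + 1)).hasW
  vertical_match : ∀ i j, (D i j).hasS ↔ (D (i + 1) j).hasN
  top_boundary : ∀ j, ¬ (D 0 j).hasN
  left_boundary : ∀ i, ¬ (D i 0).hasW
  finite_support : ∃ n, ∀ i j, (n ≤ i ∨ n ≤ j) → D i j = idTiling i j
  reduced : ∀ p q i j i' j', CrossAt D p q i j → CrossAt D p q i' j' → i = i' ∧ j = j'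

/-! ### Right insertion -/

/-- Remove the horizontal strand of a crossing. -/
def Tile.dropHoriz : Tile → Tile
  | Tile.cross => Tile.vert
  | t => t

/-- Remove the vertical strand of a crossing. -/
def Tile.dropVert : Tile → Tile
  | Tile.cross => Tile.horiz
  | t => t

/-- Add a horizontal strand to a vertical tile. -/
def Tile.addHoriz : Tile → Tile
  | Tile.vert => Tile.cross
  | t => t

/-- Add a vertical strand to a horizontal tile. -/
def Tile.addVert : Tile → Tile
  | Tile.horiz => Tile.cross
  | t => t

/-- North-west corner of a droop: the south-to-east turn is removed. -/
def Tile.droopNW : Tile → Tile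
  | Tile.rturn => Tile.blank
  | Tile.bump => Tile.jturn
  | t => t

/-- North-east corner of a droop: the pipe, which entered from the west, now enters from the
south. -/
def Tile.droopNE : Tile → Tile
  | Tile.horiz => Tile.rturn
  | Tile.jturn => Tile.vert
  | t => t

/-- South-west corner of a droop: the pipe, which left to the north, now leaves to the east. -/
def Tile.droopSW : Tile → Tile
  | Tile.vert => Tile.rturn
  | Tile.jturn => Tile.horiz
  | t => t

/-- South-east corner of a droop: a west-to-north turn is added. -/
def Tile.droopSE : Tile → Tile
  | Tile.blank => Tile.jturn
  | Tile.rturn => Tile.bump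
  | t => t

/-- Droop the south-to-east turn at `(i, j)` into `(a, b)`, where `i < a` and `j < b`: the pipe,
which ran up the west side and along the north side of the rectangle with these corners, now runs
along its south side and up its east side. -/
def droop (T : Tiling) (i j a b : ℕ) : Tiling := fun s t =>
  if s = i ∧ t = j then (T s t).droopNW
  else if s = i ∧ t = b then (T s t).droopNE
  else if s = a ∧ t = j then (T s t).droopSW
  else if s = a ∧ t = b then (T s t).droopSE
  else if s = i ∧ j < t ∧ t < b then (T s t).dropHoriz
  else if t = j ∧ i < s ∧ s < a then (T s t).dropVert
  else if s = a ∧ j < t ∧ t < b then (T s t).addHoriz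
  else if t = b ∧ i < s ∧ s < a then (T s t).addVert
  else T s t

/-- `MinDroop T i j T₁ a b`: performing a min-droop at `(i, j)` turns `T` into `T₁`, and
`min-droop(i, j) = (a, b)`. Here `a > i` and `b > j` are minimal such that the tiles at `(a, j)` and
at `(i, b)` are not crossings. -/
def MinDroop (T : Tiling) (i j : ℕ) (T₁ : Tiling) (a b : ℕ) : Prop :=
  (T i j = Tile.rturn ∨ T i j = Tile.bump) ∧
    IsLeast {a | i < a ∧ T a j ≠ Tile.cross} a ∧
    IsLeast {b | j < b ∧ T i b ≠ Tile.cross} b ∧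
    T₁ = droop T i j a b

/-- `InsertFrom k T i j T'`: the insertion algorithm with bottom letter `k`, about to perform a
min-droop at position `(i, j)` of `T`, terminates with result `T'`. -/
inductive InsertFrom (k : ℕ) : Tiling → ℕ → ℕ → Tiling → Prop
  /-- The min-droop ends in a west-to-north turn. -/
  | jturn (T T₁ T' : Tiling) (i j i₁ j₁ j₂ : ℕ)
      (hd : MinDroop T i j T₁ i₁ j₁) (ht : T₁ i₁ j₁ = Tile.jturn)
      (hj : IsGreatest {c | c < j₁ ∧ T₁ i₁ c = Tile.rturn} j₂)
      (h : InsertFrom k T₁ i₁ j₂ T') : InsertFrom k T i j T'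
  /-- The min-droop ends in a bump of two pipes that cross at `(c, d)`: perform a
  cross-bump-swap. -/
  | swap (T T₁ T' : Tiling) (i j i₁ j₁ p q c d : ℕ)
      (hd : MinDroop T i j T₁ i₁ j₁) (ht : T₁ i₁ j₁ = Tile.bump)
      (hp : Enters T₁ p Side.south i₁ j₁) (hq : Enters T₁ q Side.west i₁ j₁)
      (hc : CrossAt T₁ p q c d)
      (h : InsertFrom k (setTile (setTile T₁ i₁ j₁ Tile.cross) c d Tile.bump) c d T') :
      InsertFrom k T i j T'
  /-- The min-droop ends in a bump of two pipes that do not cross, and the pipe `p` of the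
  south-to-east turn exits from one of the first `k` rows. -/
  | pass (T T₁ T' : Tiling) (i j i₁ j₁ p q r : ℕ)
      (hd : MinDroop T i j T₁ i₁ j₁) (ht : T₁ i₁ j₁ = Tile.bump)
      (hp : Enters T₁ p Side.south i₁ j₁) (hq : Enters T₁ q Side.west i₁ j₁)
      (hc : ∀ c d, ¬ CrossAt T₁ p q c d)
      (hr : ExitsRow T₁ p r) (hk : r + 1 ≤ k)
      (h : InsertFrom k T₁ i₁ j₁ T') : InsertFrom k T i j T'
  /-- The min-droop ends in a bump of two pipes that do not cross, and the pipe `p` of the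
  south-to-east turn exits below row number `k`: replace the bump by a crossing and terminate. -/
  | terminate (T T₁ : Tiling) (i j i₁ j₁ p q r : ℕ)
      (hd : MinDroop T i j T₁ i₁ j₁) (ht : T₁ i₁ j₁ = Tile.bump)
      (hp : Enters T₁ p Side.south i₁ j₁) (hq : Enters T₁ q Side.west i₁ j₁)
      (hc : ∀ c d, ¬ CrossAt T₁ p q c d)
      (hr : ExitsRow T₁ p r) (hk : k < r + 1) :
      InsertFrom k T i j (setTile T₁ i₁ j₁ Tile.cross)

/-- `RightInsert D b k D'`: right insertion of the biletter with top entry `b` and bottom entry `k` into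
`D` produces `D'`. It starts at the rightmost south-to-east turn in row number `b`, whose index is
`b - 1`. -/
def RightInsert (D : Tiling) (b k : ℕ) (D' : Tiling) : Prop :=
  ∃ j, IsGreatest {j | D (b - 1) j = Tile.rturn} j ∧ InsertFrom k D (b - 1) j D'

/-- A biword: a list of biletters, each given as the pair (top entry, bottom entry). -/
abbrev Biword := List (ℕ × ℕ)

/-- Plactic biwords: all biletters satisfy `1 ≤ a ≤ k`, and the bottom entries weakly decrease. -/
def IsPlactic (w : Biword) : Prop :=
  (∀ x ∈ w, 1 ≤ x.1 ∧ x.1 ≤ x.2) ∧ w.Pairwise (fun x y => y.2 ≤ x.2)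

/-- `InsertWord D w D'`: successive right insertion of the biletters of `w`, read from left to
right, into `D` produces `D'`. -/
inductive InsertWord : Tiling → Biword → Tiling → Prop
  | nil (D : Tiling) : InsertWord D [] D
  | cons (D D₁ D' : Tiling) (b k : ℕ) (w : Biword)
      (h₁ : RightInsert D b k D₁) (h : InsertWord D₁ w D') : InsertWord D ((b, k) :: w) D'

/-- `D` is the bumpless pipe dream corresponding to the biword `w`. -/
def IsInsertionBPD (w : Biword) (D : Tiling) : Prop :=
  InsertWord idTiling w D

/-! ### Jeu de taquin and rectification -/

/-- The effect of an undroop on two horizontally adjacent tiles strictly between the top row and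
the bottom row of the rectangle. Before the move the undrooping pipe `p` runs vertically through the
right tile, after the move through the left tile. In the first two cases the tiles are the
south-to-east turn of a pipe `q` (which crosses `p` in the right tile) and the west-to-north turn of
such a `q`: both turns of `q` move from the left column to the right column. -/
def slidePair : Tile → Tile → Tile × Tile
  | Tile.rturn, Tile.cross => (Tile.vert, Tile.rturn)
  | Tile.jturn, Tile.vert => (Tile.cross, Tile.jturn)
  | Tile.blank, Tile.vert => (Tile.vert, Tile.blank)
  | Tile.horiz, Tile.cross => (Tile.cross, Tile.horiz)
  | s, t => (s, t)

/-- The effect of an undroop on the two tiles in the top row: the empty tile receives the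
south-to-east turn of the undrooping pipe. -/
def topPair : Tile → Tile → Tile × Tile
  | Tile.blank, Tile.rturn => (Tile.rturn, Tile.horiz)
  | Tile.blank, Tile.vert => (Tile.rturn, Tile.jturn)
  | s, t => (s, t)

/-- North-turning of the undrooping pipe at the bottom left tile, which it used to leave to the
east. -/
def undroopSW : Tile → Tile
  | Tile.horiz => Tile.jturn
  | Tile.rturn => Tile.vert
  | t => t

/-- Removal of the west-to-north turn at the bottom right tile. -/
def undroopSE : Tile → Tile
  | Tile.jturn => Tile.blank
  | Tile.bump => Tile.rturn
  | t => t

/-- Undroop the west-to-north turn at `(x', y + 1)` into the empty tile `(x, y)`, where `x < x'`,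
adjusting the other pipes in the rectangle with these corners. -/
def undroop (T : Tiling) (x x' y : ℕ) : Tiling := fun s t =>
  if s = x ∧ t = y then (topPair (T x y) (T x (y + 1))).1
  else if s = x ∧ t = y + 1 then (topPair (T x y) (T x (y + 1))).2
  else if s = x' ∧ t = y then undroopSW (T s t)
  else if s = x' ∧ t = y + 1 then undroopSE (T s t)
  else if x < s ∧ s < x' ∧ t = y then (slidePair (T s y) (T s (y + 1))).1
  else if x < s ∧ s < x' ∧ t = y + 1 then (slidePair (T s y) (T s (y + 1))).2
  else T s t

/-- `JdtFrom T x y T'`: the jeu de taquin process with the mark at the empty tile `(x, y)` of `T`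
terminates with result `T'`. -/
inductive JdtFrom : Tiling → ℕ → ℕ → Tiling → Prop
  /-- The mark moves to the right within a contiguous block of empty tiles. -/
  | move (T T' : Tiling) (x y : ℕ)
      (h₀ : T x y = Tile.blank) (h₁ : T x (y + 1) = Tile.blank)
      (h : JdtFrom T x (y + 1) T') : JdtFrom T x y T'
  /-- The pipe `p` through `(x, y + 1)` is not pipe `y + 1`: undroop its west-to-north turn in
  column `y + 1` into the marked tile, and mark the tile vacated by it. -/
  | undroop (T T' : Tiling) (x y p x' : ℕ)
      (h₀ : T x y = Tile.blank) (h₁ : T x (y + 1) ≠ Tile.blank)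
      (hp : Enters T p Side.south x (y + 1)) (hne : p ≠ y + 1)
      (hx : x < x') (hj : T x' (y + 1) = Tile.jturn) (hpj : Enters T p Side.west x' (y + 1))
      (h : JdtFrom (_root_.undroop T x x' y) x' (y + 1) T') : JdtFrom T x y T'
  /-- The pipe through `(x, y + 1)` is pipe `y + 1`: replace its crossing with pipe `y` by a bump,
  undroop the west-to-north turn of this bump into the marked tile, and stop. -/
  | uncross (T : Tiling) (x y x' : ℕ)
      (h₀ : T x y = Tile.blank) (h₁ : T x (y + 1) ≠ Tile.blank)
      (hp : Enters T (y + 1) Side.south x (y + 1))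
      (hx : x < x') (hc : CrossAt T y (y + 1) x' (y + 1)) :
      JdtFrom T x y (_root_.undroop (setTile T x' (y + 1) Tile.bump) x x' y)

/-- `b` is (the index of) the first row that contains an empty tile. -/
def IsFirstBlankRow (D : Tiling) (b : ℕ) : Prop :=
  IsLeast {i | ∃ j, D i j = Tile.blank} b

/-- `Jdt D b r D'`: `D' = ∇ D`, where the process starts from position `(b, r)`, i.e. `(b, r)` is
the rightmost empty tile in the first row with empty tiles. -/
def Jdt (D : Tiling) (b r : ℕ) (D' : Tiling) : Prop :=
  IsFirstBlankRow D b ∧ IsGreatest {j | D b j = Tile.blank} r ∧ JdtFrom D b r D'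

/-- Perform jeu de taquin successively from the positions `(b, r)`, for `r` in the given list. -/
inductive JdtSeq (b : ℕ) : List ℕ → Tiling → Tiling → Prop
  | nil (D : Tiling) : JdtSeq b [] D D
  | cons (r : ℕ) (rs : List ℕ) (D D₁ D' : Tiling)
      (h₁ : Jdt D b r D₁) (h : JdtSeq b rs D₁ D') : JdtSeq b (r :: rs) D D'

/-- `Rect D D'`: `D' = rect(D)`, i.e. `D'` results from `D` by jeu de taquin on all empty tiles in
the first row of `D` with an empty tile, from right to left. -/
def Rect (D D' : Tiling) : Prop :=
  ∃ (b : ℕ) (cols : List ℕ), IsFirstBlankRow D b ∧ cols.Pairwise (fun c c' => c' < c) ∧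
    (∀ c, c ∈ cols ↔ D b c = Tile.blank) ∧ JdtSeq b cols D D'

/-! A bumpless pipe dream is encoded by the columns `A h l` of the pipe exiting along row `l` at the
horizontal line above row `h`, for `l < h`. In row `s`, with `u = A s` and `v = A (s + 1)`, the pipe
exiting along row `l < s` runs from column `v l` to column `u l`, and a new pipe starts at `v s`.
Right insertion and jeu de taquin become row by row transducers on such sequences, which are shown
to commute. Then both algorithms on tilings are identified with these transducers.
-/

/-! A bumpless pipe dream is cut along its horizontal lines. The columns of the pipes on each line
determine the tiles, since between two lines a pipe enters from below, runs east and leaves at the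
top. At every crossing the pipe with the smaller exit row is required to be the vertical one. Read
downwards, a crossing then creates an inversion of labels, and inversions persist, so "two pipes
cross at most once" becomes a local condition on consecutive lines (`RowOK`).

In this encoding both algorithms disturb each line very little. Below its starting row, insertion
with bottom letter `k` either moves one label `e < k` one column to the right, or exchanges `e < k`
with some `f ≥ k`. Drooping is the first kind of change. A bump with a label `f < k` passes the
motion on to `f`. A bump with `f ≥ k` is turned into a crossing, so below it `e` and `f` are
exchanged: until the row in which they crossed originally (the cross-bump-swap), or forever
(termination). Jeu de taquin moves one label `p` one column to the left, exchanging it with the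
label it finds there, if any. When `p` turns, the motion passes to the next pipe on the right. Since
bottom letters weakly decrease, labels below `k` never cross each other (`KInc`). This makes every
droop one column wide and keeps the changed lines legal (`insStep_inv`, `insStep_row`,
`jdtStep_inv`, `jdtStep_row`).

Both algorithms are thus transducers reading rows from top to bottom, and their commutation is a
question about single rows. `CommRel` lists how the states can interact: not at all, through the
transposition of an exchanged pair, or along a solid block of columns where the two operations
cancel. `commRel_step` shows that the list is closed under passing a row, and `commRel_eq` that both
orders give the same columns. This yields `jdt_ins_comm`. If all lines down to the one below the
starting row are those of the identity, jeu de taquin simply undoes the insertion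
(`jdt_ins_cancel`).

Every biletter with minimal top entry lengthens the block of empty tiles in the first row by one, so
rectification applies jeu de taquin as often as there are such biletters. These applications commute
past all insertions, and each insertion of a minimal letter is cancelled by one of them
(`iterate_jdtSeq_insWord`).

It remains to recognise the transducers in the tilings. Midway, with row `i` reached, the tiling has
the new columns down to the line above row `i` and the old ones below (`splice`), possibly with a
bump in row `i`. A droop or undroop advances `i` (`droop_splice`, `undroop_splice`). The results
`insertFrom_splice` and `jdtFrom_splice` are equivalences, so they give termination and uniqueness
of the outcome together. -/

section transducers

/-! ### Legal rows and the two transducers. -/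

variable {ι : Type*} [LinearOrder ι]

/-- The columns `u` and `v` at the top and at the bottom of row `s` belong to a row without bumps: the
horizontal runs of two pipes are disjoint, or the first pipe crosses the second one vertically. -/
def RowOK (s : ι) (u v : ι → ℕ) : Prop :=
  (∀ l, l < s → v l ≤ u l) ∧ ∀ l m, l < m → m ≤ s →
    (u l < v m ∨ (m < s ∧ u m < v l) ∨ (v l = u l ∧ v m < v l ∧ (m = s ∨ v l < u m)))

/-- The labels less than `k` occur in increasing order. -/
def KInc (k : ι) (P : ι → Prop) (x : ι → ℕ) : Prop := ∀ l m, l < m → m < k → P m → x l < x m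

/-- The invariant of right insertion. In state `(e, none)` the label `e` moves one column to the right,
in state `(e, some f)` the labels `e` and `f` are swapped. -/
def InsInv (k : ι) (P : ι → Prop) (x : ι → ℕ) : ι × Option ι → Prop
  | (e, none) => P e ∧ e < k ∧ ∀ l, P l → x l ≠ x e + 1
  | (e, some f) => P e ∧ e < k ∧ k ≤ f ∧ P f ∧ x e < x f ∧
      ∀ l, l < f → l ≠ e → ¬ (x e < x l ∧ x l < x f)

/-- The effect of an insertion state on the columns at a horizontal line. -/
def insApp (x : ι → ℕ) : ι × Option ι → ι → ℕ
  | (e, none), l => if l = e then x e + 1 else x l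
  | (e, some f), l => if l = e then x f else if l = f then x e else x l

/-- The change of the insertion state along a row. -/
inductive InsStep (k s : ι) (u v : ι → ℕ) : ι × Option ι → ι × Option ι → Prop
  | pass (e f : ι) (hf : f ≤ s) (hv : v f = u e + 1) (hk : f < k) : InsStep k s u v (e, none) (f, none)
  | hit (e f : ι) (hf : f ≤ s) (hv : v f = u e + 1) (hk : k ≤ f) :
      InsStep k s u v (e, none) (e, some f)
  | stay (e : ι) (hv : ∀ f, f ≤ s → v f ≠ u e + 1) : InsStep k s u v (e, none) (e, none)
  | back (e f : ι) (hv : v f < v e) : InsStep k s u v (e, some f) (e, none)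
  | keep (e f : ι) (hv : v e < v f) : InsStep k s u v (e, some f) (e, some f)

theorem RowOK.pair {s : ι} {u v : ι → ℕ} (h : RowOK s u v) (l m : ι) (hl : l ≤ s) (hm : m ≤ s) :
    l = m ∨
    (l < m ∧ (u l < v m ∨ (m < s ∧ u m < v l) ∨ (v l = u l ∧ v m < v l ∧ (m = s ∨ v l < u m)))) ∨
    (m < l ∧ (u m < v l ∨ (l < s ∧ u l < v m) ∨ (v m = u m ∧ v l < v m ∧ (l = s ∨ v m < u l)))) := by
  rcases lt_trichotomy l m with h1 | h1 | h1
  · exact Or.inr (Or.inl ⟨h1, h.2 l m h1 hm⟩)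
  · exact Or.inl h1
  · exact Or.inr (Or.inr ⟨h1, h.2 m l h1 hl⟩)

theorem KInc.pair {k : ι} {P : ι → Prop} {x : ι → ℕ} (h : KInc k P x) (l m : ι) (hl : P l) (hm : P m)
    (hlk : l < k) (hmk : m < k) : l = m ∨ (l < m ∧ x l < x m) ∨ (m < l ∧ x m < x l) := by
  rcases lt_trichotomy l m with h1 | h1 | h1
  · exact Or.inr (Or.inl ⟨h1, h l m h1 hmk hm⟩)
  · exact Or.inl h1
  · exact Or.inr (Or.inr ⟨h1, h m l h1 hlk hl⟩)

/-- The column to the right of a moved label is either checked by `stay` itself or covered by a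
horizontal run of this row. A pipe coming up under that run has a smaller label than the runner. If
the runner is below `k`, this contradicts `KInc`; after `back` the runner is `f`, and the pipe would
be a label below `f` between `e` and `f`. -/
theorem insStep_inv {k s : ι} {u v σ σ'} (hr : RowOK s u v) (hu : KInc k (· < s) u) (hv : KInc k (· ≤ s) v)
    (hi : InsInv k (· < s) u σ) (hs : InsStep k s u v σ σ') : InsInv k (· ≤ s) v σ' := by
  have h1 := hr.1
  have h2 := hr.pair
  have hu := hu.pair
  have hv := hv.pair
  clear hr
  cases hs <;> simp only [InsInv] at hi ⊢
  · grind
  · grind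
  · grind
  · grind (splits := 25)
  · grind

/-- After `hit`, `e` runs straight up column `u e + 1` and is crossed there by `f`. After `back`,
the old crossing is opened: `f` ends in the column of `e`, and `e` starts one column further right.
The invariant takes care of the third pipes. -/
theorem insStep_row {k s : ι} {u v σ σ'} (hr : RowOK s u v) (hu : KInc k (· < s) u) (hv : KInc k (· ≤ s) v)
    (hi : InsInv k (· < s) u σ) (hs : InsStep k s u v σ σ') : RowOK s (insApp u σ) (insApp v σ') := by
  have h1 := hr.1
  have h2 := hr.pair
  have hu := hu.pair
  have hv := hv.pair
  clear hr
  cases hs <;> simp only [InsInv] at hi <;>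
   refine ⟨fun l hl => ?_, fun l m hl hm => ?_⟩ <;> simp only [insApp]
  · grind
  · grind
  · grind
  · grind
  · grind
  · grind
  · grind
  · grind (splits := 25)
  · grind
  · grind

/-- The invariant of jeu de taquin: the label `p` moves one column to the left. -/
def JdtInv (P : ι → Prop) (x : ι → ℕ) (p : ι) : Prop :=
  P p ∧ 1 ≤ x p ∧ ∀ l, P l → l < p → x l + 1 ≠ x p

/-- The effect of a jeu de taquin state on the columns at a horizontal line. -/
def jdtApp (x : ι → ℕ) (p l : ι) : ℕ :=
  if l = p then x p - 1 else if x l + 1 = x p then x p else x l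

/-- The change of the jeu de taquin state along a row. -/
inductive JdtStep (s : ι) (u v : ι → ℕ) : ι → ι → Prop
  | stay (p : ι) (h : v p = u p) : JdtStep s u v p p
  | turn (p p' : ι) (h : v p ≠ u p) (hp : p' ≤ s) (hv : u p < v p')
      (hmin : ∀ l, l ≤ s → u p < v l → v p' ≤ v l) : JdtStep s u v p p'

/-- If `p` is vertical, a smaller label just to its left at the bottom cannot run past `p`, so it is
vertical too and was there at the top. After a turn, minimality of `v p'` leaves only column `u p`
for such a label, and there the turn of `p` admits no pipe from below. -/
theorem jdtStep_inv {s : ι} {u v p p'} (hr : RowOK s u v)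
    (hi : JdtInv (· < s) u p) (hs : JdtStep s u v p p') : JdtInv (· ≤ s) v p' := by
  have h1 := hr.1
  have h2 := hr.pair
  clear hr
  cases hs <;> simp only [JdtInv] at hi ⊢
  · grind
  · grind

theorem jdtStep_row {s : ι} {u v p p'} (hr : RowOK s u v)
    (hi : JdtInv (· < s) u p) (hs : JdtStep s u v p p') :
    RowOK s (jdtApp u p) (jdtApp v p') := by
  have h1 := hr.1
  have h2 := hr.pair
  clear hr
  cases hs <;> simp only [JdtInv] at hi <;>
   refine ⟨fun l hl => ?_, fun l m hl hm => ?_⟩ <;> simp only [jdtApp]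
  · grind
  · grind
  · grind
  · grind (splits := 20)

/-- A label displaced by `p` is larger than `p` and stands to its left, so it is at least `k`. -/
theorem jdt_kinc {k : ι} {P : ι → Prop} {x p} (hx : KInc k P x) (hi : JdtInv P x p)
    (hinj : ∀ l m, P l → P m → x l = x m → l = m) (hP : ∀ l m, l < m → P m → P l) :
    KInc k P (jdtApp x p) := by
  intro l m hl hm hmP
  have := hx l m hl hm hmP
  have := hP l m hl hmP
  simp only [jdtApp, JdtInv] at hi ⊢
  grind

theorem ins_kinc {k : ι} {P : ι → Prop} {x σ} (hx : KInc k P x) (hi : InsInv k P x σ)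
    (hinj : ∀ l m, P l → P m → x l = x m → l = m)  (hP : ∀ l m, l < m → P m → P l) :
    KInc k P (insApp x σ) := by
  have hx := hx.pair
  obtain ⟨e, f⟩ := σ
  cases f <;> intro l m hl hm hmP <;> have := hP l m hl hmP <;> simp only [InsInv] at hi <;> simp only [insApp]
  · grind
  · grind

/-! ### Commutation of the two transducers in one row. -/

/-- The relation between the insertion and jeu de taquin states `σ`, `p` of a sequence, the insertion
state `σ'` after jeu de taquin, and the jeu de taquin state `p'` after insertion. -/
inductive CommRel (k : ι) (P : ι → Prop) (x : ι → ℕ) : ι × Option ι → ι → ι × Option ι → ι → Prop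
  | move (e p : ι) (h₀ : x e ≠ x p) (h₁ : x e + 1 ≠ x p) (h₂ : x e + 2 ≠ x p) :
      CommRel k P x (e, none) p (e, none) p
  -- The label displaced by `p` is neither `e` nor `f`, so exchanging names does not interfere with
  -- the move.
  | swap (e f p p' : ι) (h₁ : x e + 1 ≠ x p) (h₂ : x f + 1 ≠ x p)
      (hp : p' = if p = e then f else if p = f then e else p) : CommRel k P x (e, some f) p (e, some f) p'
  -- A block of labels below `k` fills all columns from `p` to `e`. Insertion pushes its right end
  -- to the right and jeu de taquin its left end to the left; the second operation, in either order,
  -- takes the first one back.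
  | cross (e p : ι) (f q : Option ι) (hp : p < k) (hpe : x p ≤ x e)
      (hc : ∀ c, x p ≤ c → c ≤ x e → ∃ l, P l ∧ l < k ∧ x l = c)
      (hf : ∀ f', f = some f' → x f' = x e + 1)
      (hq : ∀ q', q = some q' → x q' + 1 = x p ∧ k ≤ q' ∧ P q')
      (hq' : q = none → ∀ l, P l → x l + 1 ≠ x p) : CommRel k P x (e, f) p (p, q) e

/-- For `swap` this is conjugation by a transposition. For `cross` both composites are the identity
on this line. -/
theorem commRel_eq {k : ι} {P : ι → Prop} {x σ p σ' p'} (h : CommRel k P x σ p σ' p')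
    (hi : InsInv k P x σ) (hj : JdtInv P x p) (hx : KInc k P x)
    (hinj : ∀ l m, P l → P m → x l = x m → l = m) (l : ι) (hl : P l) :
    jdtApp (insApp x σ) p' l = insApp (jdtApp x p) σ' l := by
  have hx := hx.pair
  cases h with
  | move e p => simp only [jdtApp, insApp, InsInv, JdtInv] at *; grind
  | swap e f p p' => simp only [jdtApp, insApp, InsInv, JdtInv] at *; grind
  | cross e p f q hp hpe hc =>
    clear hc
    cases f <;> cases q <;> simp only [jdtApp, insApp, InsInv, JdtInv] at * <;> grind

section
variable {k s : ι} {u v : ι → ℕ}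

/-- The motions begin to interact when both arrive at the same label, which is then a `cross` block
of one column. -/
theorem comm_move_move {e p p₁ e₁ : ι} (hr : RowOK s u v) (hu : KInc k (· < s) u) (hv : KInc k (· ≤ s) v)
    (hi : InsInv k (· < s) u (e, none)) (hj : JdtInv (· < s) u p)
    (his : InsStep k s u v (e, none) (e₁, none)) (hjs : JdtStep s u v p p₁)
    (h₀ : u e ≠ u p) (h₁ : u e + 1 ≠ u p) (h₂ : u e + 2 ≠ u p) :
    CommRel k (· ≤ s) v (e₁, none) p₁ (e₁, none) p₁ ∧
    InsStep k s (jdtApp u p) (jdtApp v p₁) (e, none) (e₁, none) ∧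
    JdtStep s (insApp u (e, none)) (insApp v (e₁, none)) p p₁ := by
  have hI := insStep_inv hr hu hv hi his
  have hJ := jdtStep_inv hr hj hjs
  have h1 := hr.1
  have h2 := hr.pair
  have hu := hu.pair
  have hv := hv.pair
  clear hr
  refine ⟨?_, ?_, ?_⟩
  · by_cases h : e₁ = p₁
    · subst h
      apply CommRel.cross
      · cases his <;> cases hjs <;> simp only [InsInv, JdtInv] at hi hj hI hJ <;> grind
      · exact le_rfl
      · intro c hc hc'
        refine ⟨e₁, ?_, ?_, by omega⟩
        · exact hI.1
        · exact hI.2.1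
      · simp
      · simp
      · cases his <;> cases hjs <;> simp only [InsInv, JdtInv] at hi hj hI hJ <;> grind
    · apply CommRel.move
      · cases his <;> cases hjs <;> simp only [InsInv, JdtInv] at hi hj hI hJ <;> grind
      · cases his <;> cases hjs <;> simp only [InsInv, JdtInv] at hi hj hI hJ <;> grind
      · cases his <;> cases hjs <;> simp only [InsInv, JdtInv] at hi hj hI hJ <;> grind
  · cases his
    · apply InsStep.pass
      · assumption
      · cases hjs <;> simp only [InsInv, JdtInv, jdtApp] at hi hj hI hJ ⊢ <;> grind
      · assumption
    · apply InsStep.stay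
      cases hjs <;> simp only [InsInv, JdtInv, jdtApp] at hi hj hI hJ ⊢ <;> grind
  · cases hjs
    · apply JdtStep.stay
      cases his <;> simp only [InsInv, JdtInv, insApp] at hi hj hI hJ ⊢ <;> grind
    · apply JdtStep.turn
      · cases his <;> simp only [InsInv, JdtInv, insApp] at hi hj hI hJ ⊢ <;> grind
      · assumption
      · cases his <;> simp only [InsInv, JdtInv, insApp] at hi hj hI hJ ⊢ <;> grind
      · cases his <;> simp only [InsInv, JdtInv, insApp] at hi hj hI hJ ⊢ <;> grind

/-- The transposition of `e` and `f`. -/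
def swapLabel (e f p : ι) : ι := if p = e then f else if p = f then e else p

theorem comm_move_swap {e f p p₁ : ι} (hr : RowOK s u v) (hu : KInc k (· < s) u) (hv : KInc k (· ≤ s) v)
    (hi : InsInv k (· < s) u (e, none)) (hj : JdtInv (· < s) u p)
    (his : InsStep k s u v (e, none) (e, some f)) (hjs : JdtStep s u v p p₁)
    (h₀ : u e ≠ u p) (h₁ : u e + 1 ≠ u p) (h₂ : u e + 2 ≠ u p) :
    CommRel k (· ≤ s) v (e, some f) p₁ (e, some f) (swapLabel e f p₁) ∧
    InsStep k s (jdtApp u p) (jdtApp v p₁) (e, none) (e, some f) ∧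
    JdtStep s (insApp u (e, none)) (insApp v (e, some f)) p (swapLabel e f p₁) := by
  have hI := insStep_inv hr hu hv hi his
  have hJ := jdtStep_inv hr hj hjs
  have h1 := hr.1
  have h2 := hr.pair
  have hu := hu.pair
  have hv := hv.pair
  clear hr
  cases his
  refine ⟨CommRel.swap _ _ _ _ ?_ ?_ rfl, InsStep.hit _ _ ?_ ?_ ?_, ?_⟩
  · cases hjs <;> simp only [InsInv, JdtInv] at hi hj hI hJ <;> grind
  · cases hjs <;> simp only [InsInv, JdtInv] at hi hj hI hJ <;> grind
  · assumption
  · cases hjs <;> simp only [InsInv, JdtInv, jdtApp] at hi hj hI hJ ⊢ <;> grind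
  · assumption
  · cases hjs
    · have : swapLabel e f p = p := by simp only [swapLabel, InsInv, JdtInv] at *; grind
      rw [this]
      apply JdtStep.stay
      simp only [InsInv, JdtInv, insApp] at hi hj hI hJ ⊢
      grind
    · apply JdtStep.turn <;> simp only [InsInv, JdtInv, insApp, swapLabel] at hi hj hI hJ ⊢
      · grind
      · grind
      · grind
      · grind

theorem comm_swap_swap {e f p p₁ : ι} (hr : RowOK s u v) (hu : KInc k (· < s) u) (hv : KInc k (· ≤ s) v)
    (hi : InsInv k (· < s) u (e, some f)) (hj : JdtInv (· < s) u p)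
    (his : InsStep k s u v (e, some f) (e, some f)) (hjs : JdtStep s u v p p₁)
    (h₁ : u e + 1 ≠ u p) (h₂ : u f + 1 ≠ u p) :
    CommRel k (· ≤ s) v (e, some f) p₁ (e, some f) (swapLabel e f p₁) ∧
    InsStep k s (jdtApp u p) (jdtApp v p₁) (e, some f) (e, some f) ∧
    JdtStep s (insApp u (e, some f)) (insApp v (e, some f)) (swapLabel e f p) (swapLabel e f p₁) := by
  have hI := insStep_inv hr hu hv hi his
  have hJ := jdtStep_inv hr hj hjs
  have h1 := hr.1
  have h2 := hr.pair
  have hu := hu.pair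
  have hv := hv.pair
  clear hr
  cases his
  refine ⟨CommRel.swap _ _ _ _ ?_ ?_ rfl, InsStep.keep _ _ ?_, ?_⟩
  · cases hjs <;> simp only [InsInv, JdtInv] at hi hj hI hJ <;> grind
  · cases hjs <;> simp only [InsInv, JdtInv] at hi hj hI hJ <;> grind (splits := 20)
  · cases hjs <;> simp only [InsInv, JdtInv, jdtApp] at hi hj hI hJ ⊢ <;> grind
  · cases hjs
    · apply JdtStep.stay
      simp only [InsInv, JdtInv, insApp, swapLabel] at hi hj hI hJ ⊢
      split <;> [skip; split] <;> grind (splits := 15)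
    · apply JdtStep.turn <;> simp only [InsInv, JdtInv, insApp, swapLabel] at hi hj hI hJ ⊢
      · grind
      · grind
      · grind
      · grind

theorem comm_swap_move {e f p p₁ : ι} (hr : RowOK s u v) (hu : KInc k (· < s) u) (hv : KInc k (· ≤ s) v)
    (hi : InsInv k (· < s) u (e, some f)) (hj : JdtInv (· < s) u p)
    (his : InsStep k s u v (e, some f) (e, none)) (hjs : JdtStep s u v p p₁)
    (h₁ : u e + 1 ≠ u p) (h₂ : u f + 1 ≠ u p)
    (hC : InsInv k (· < s) (jdtApp u p) (e, some f)) :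
    ∃ σ', CommRel k (· ≤ s) v (e, none) p₁ σ' p₁ ∧
    InsStep k s (jdtApp u p) (jdtApp v p₁) (e, some f) σ' ∧
    JdtStep s (insApp u (e, some f)) (insApp v (e, none)) (swapLabel e f p) p₁ := by
  have hI := insStep_inv hr hu hv hi his
  have hJ := jdtStep_inv hr hj hjs
  have h1 := hr.1
  have h2 := hr.pair
  have hu := hu.pair
  have hv := hv.pair
  clear hr
  cases his
  have key : ∃ σ', CommRel k (· ≤ s) v (e, none) p₁ σ' p₁ ∧
      InsStep k s (jdtApp u p) (jdtApp v p₁) (e, some f) σ' := by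
    by_cases h : e = p₁
    · subst h
      have hc : ∀ c, v e ≤ c → c ≤ v e → ∃ l, l ≤ s ∧ l < k ∧ v l = c := fun c hc hc' =>
        ⟨e, hI.1, hI.2.1, by omega⟩
      -- If `f` arrives directly to the left of `e`, jeu de taquin removes their crossing from this
      -- row. Insertion performed afterwards therefore keeps them exchanged.
      by_cases hq : v f + 1 = v e
      · refine ⟨(e, some f), CommRel.cross _ _ _ _ hI.2.1 le_rfl hc (by simp) ?_ (by simp), InsStep.keep _ _ ?_⟩
        · simp only [InsInv] at hi
          grind
        · simp only [jdtApp]; grind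
      · refine ⟨(e, none), CommRel.cross _ _ _ _ hI.2.1 le_rfl hc (by simp) (by simp) ?_, InsStep.back _ _ ?_⟩
        · simp only [InsInv, JdtInv] at hi hj hI hJ hC
          intro _ l hl hl'
          have hfl := h2 f l (by grind) hl
          cases hjs
          · have hlf : l < f := by grind
            have hlu : v l = u l := by grind
            have := hC.2.2.2.2.2 l hlf (by grind)
            simp only [jdtApp] at this
            grind
          · next _ _ _ hmin =>
            have := hmin l hl
            have := h2 l p hl (by grind)
            have := h1 p (by grind)
            clear hC hu hv h2 hfl hmin hc
            grind
        · simp only [jdtApp]; grind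
    · refine ⟨(e, none), CommRel.move _ _ ?_ ?_ ?_, InsStep.back _ _ ?_⟩
      · cases hjs <;> simp only [InsInv, JdtInv] at hi hj hI hJ <;> grind
      · cases hjs <;> simp only [InsInv, JdtInv] at hi hj hI hJ <;> grind
      · cases hjs <;> simp only [InsInv, JdtInv] at hi hj hI hJ <;> grind (splits := 20)
      · cases hjs <;> simp only [InsInv, JdtInv, jdtApp] at hi hj hI hJ ⊢ <;> grind
  obtain ⟨σ', ha, hb⟩ := key
  refine ⟨σ', ha, hb, ?_⟩
  · cases hjs
    · by_cases hpe : p = e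
      · subst hpe
        apply JdtStep.turn <;> simp only [InsInv, JdtInv, insApp, swapLabel] at hi hj hI hJ ⊢
        · grind
        · grind
        · grind
        · grind
      · have : swapLabel e f p = p := by simp only [swapLabel, InsInv, JdtInv] at *; grind
        rw [this]
        apply JdtStep.stay
        simp only [InsInv, JdtInv, insApp] at hi hj hI hJ ⊢
        grind
    · apply JdtStep.turn <;> simp only [InsInv, JdtInv, insApp, swapLabel] at hi hj hI hJ ⊢
      · grind
      · grind
      · grind
      · grind
end

section
variable {k s : ι} {u v : ι → ℕ}

/-- A pipe of the block that ran in from the west would pass the column to its left, where a label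
below `k` stands at the top. Two labels below `k` would be inverted at the bottom. -/
theorem vertical_of_block {a b : ℕ} (hr : RowOK s u v)
    (hv : KInc k (· ≤ s) v)
    (hc : ∀ c, a ≤ c → c ≤ b → ∃ l, l < s ∧ l < k ∧ u l = c) (l : ι) (hl : l < s)
    (ha : a < u l) (hb : u l ≤ b) : v l = u l := by
  obtain ⟨l', hl', hk, he⟩ := hc (u l - 1) (by omega) (by omega)
  obtain ⟨m, hm, hmk, hme⟩ := hc (u l) (by omega) (by omega)
  have h1 := hr.1
  have h2 := hr.pair
  have := hv.pair l' l hl'.le hl.le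
  obtain rfl : m = l := by
    have := h2 m l hm.le hl.le
    have := h1 m hm
    have := h1 l hl
    clear h2
    grind
  have := h1 l' hl'
  have := h1 m hl
  clear hc hv hr
  have h4 := h2 l' m hl'.le hl.le
  clear h2
  grind

/-- All block pipes except perhaps the leftmost are vertical. If the leftmost one turns, the next
pipe for jeu de taquin is therefore its right neighbour in the block. -/
theorem comm_cross_aux {e p p₁ : ι} {f : Option ι} (hr : RowOK s u v)
    (hv : KInc k (· ≤ s) v)
    (hi : InsInv k (· < s) u (e, f)) (hj : JdtInv (· < s) u p) (hjs : JdtStep s u v p p₁)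
    (hp : p < k) (hpe : u p ≤ u e)
    (hc : ∀ c, u p ≤ c → c ≤ u e → ∃ l, l < s ∧ l < k ∧ u l = c)
    (hne : p = e → v p = u p) :
    v e = u e ∧ p₁ < s ∧ v p₁ = u p₁ ∧ p₁ < k ∧ u p₁ ≤ u e ∧
    (p₁ = p ∧ v p = u p ∨ u p₁ = u p + 1 ∧ v p < u p) := by
  have hes : e < s := by cases f <;> exact hi.1
  have hps := hj.1
  have hve : v e = u e := by
    by_cases h : p = e
    · grind
    · refine vertical_of_block hr hv hc e hes ?_ le_rfl
      have := hr.pair p e hps.le hes.le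
      have := hr.1 p hps
      have := hr.1 e hes
      clear hi hj hjs hr hc hv
      grind
  have h1 := hr.1
  have h2 := hr.pair
  cases hjs
  · grind
  · next h3 h4 h5 h6 =>
    have hne' : p ≠ e := by grind
    have hlt : u p < u e := by
      have := h2 p e hps.le hes.le
      grind
    obtain ⟨l, hl, hlk, hle⟩ := hc (u p + 1) (by omega) (by omega)
    have := vertical_of_block hr hv hc l hl (by omega) (by omega)
    have := h6 l hl.le (by omega)
    have := h2 l p₁ hl.le h4
    have := h1 l hl
    grind

/-- Passing the insertion on to the next label extends the block on the right; passing jeu de taquin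
on shortens it on the left. -/
theorem comm_cross_block {e p p₁ e₁ : ι} {f f₁ : Option ι} (hr : RowOK s u v) (hu : KInc k (· < s) u)
    (hv : KInc k (· ≤ s) v)
    (hi : InsInv k (· < s) u (e, f)) (hj : JdtInv (· < s) u p) (hjs : JdtStep s u v p p₁)
    (his : InsStep k s u v (e, f) (e₁, f₁))
    (hp : p < k) (hpe : u p ≤ u e)
    (hc : ∀ c, u p ≤ c → c ≤ u e → ∃ l, l < s ∧ l < k ∧ u l = c)
    (hf : ∀ f', f = some f' → u f' = u e + 1)
    (hne : p = e → v p = u p) :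
    v p₁ ≤ v e₁ ∧ (∀ c, v p₁ ≤ c → c ≤ v e₁ → ∃ l, l ≤ s ∧ l < k ∧ v l = c) ∧
      (∀ f', f₁ = some f' → v f' = v e₁ + 1) := by
  obtain ⟨h1, h2, h3, h4, h5, h6⟩ := comm_cross_aux hr hv hi hj hjs hp hpe hc hne
  have key : ∀ c, v p₁ ≤ c → c ≤ v e → ∃ l, l ≤ s ∧ l < k ∧ v l = c := by
    intro c hc1 hc2
    rcases Nat.lt_or_ge (u p) c with h | h
    · obtain ⟨l, hl, hlk, hle⟩ := hc c (by omega) (by omega)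
      exact ⟨l, hl.le, hlk, (vertical_of_block hr hv hc l hl (by omega) (by omega)).trans hle⟩
    · exact ⟨p₁, h2.le, h4, by rcases h6 with ⟨rfl, _⟩ | _ <;> omega⟩
  refine ⟨?_, ?_, ?_⟩
  · cases his <;> omega
  · cases his
    · intro c hc1 hc2
      rcases Nat.lt_or_ge (v e) c with h | h
      · exact ⟨e₁, by assumption, by assumption, by clear key hc; omega⟩
      · exact key c hc1 h
    all_goals exact key
  · rintro f' rfl
    have g1 := hr.1
    have hr := hr.pair
    have hu := hu.pair
    have hv := hv.pair
    cases his
    · grind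
    · next f hvf =>
      have := hf _ rfl
      have := hr e f'
      simp only [InsInv] at hi
      have := g1 f'
      by_contra hcon
      rcases Nat.lt_or_ge (v f') (v p₁) with h | h
      · grind
      · obtain ⟨l, hl, hlk, hle⟩ := key (v f') h (by grind)
        grind

/-- Insertion, and jeu de taquin after it, act at the right end of the block; jeu de taquin, and
insertion after it, act at the left end. The two ends can be treated separately unless the block is
a single pipe that turns. -/
theorem comm_cross {e p p₁ e₁ : ι} {f q f₁ : Option ι} (hr : RowOK s u v) (hu : KInc k (· < s) u)
    (hv : KInc k (· ≤ s) v)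
    (hi : InsInv k (· < s) u (e, f)) (hj : JdtInv (· < s) u p) (hjs : JdtStep s u v p p₁)
    (his : InsStep k s u v (e, f) (e₁, f₁))
    (hp : p < k) (hpe : u p ≤ u e)
    (hc : ∀ c, u p ≤ c → c ≤ u e → ∃ l, l < s ∧ l < k ∧ u l = c)
    (hf : ∀ f', f = some f' → u f' = u e + 1)
    (hq : ∀ q', q = some q' → u q' + 1 = u p ∧ k ≤ q' ∧ q' < s)
    (hq' : q = none → ∀ l, l < s → u l + 1 ≠ u p)
    (hne : p = e → v p = u p) :
    ∃ q₁, CommRel k (· ≤ s) v (e₁, f₁) p₁ (p₁, q₁) e₁ ∧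
      InsStep k s (jdtApp u p) (jdtApp v p₁) (p, q) (p₁, q₁) ∧
      JdtStep s (insApp u (e, f)) (insApp v (e₁, f₁)) e e₁ := by
  obtain ⟨h1, h2, h3, h4, h5, h6⟩ := comm_cross_aux hr hv hi hj hjs hp hpe hc hne
  obtain ⟨g1, g2, g3⟩ := comm_cross_block hr hu hv hi hj hjs his hp hpe hc hf hne
  have hI := insStep_inv hr hu hv hi his
  have hJ := jdtStep_inv hr hj hjs
  have hes : e < s := by cases f <;> exact hi.1
  have hr1 := hr.1
  have hr2 := hr.pair
  have hu := hu.pair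
  have hv := hv.pair
  clear hr hc
  have hB : JdtStep s (insApp u (e, f)) (insApp v (e₁, f₁)) e e₁ := by
    clear hjs hq hq' g2
    cases his
    · apply JdtStep.turn <;> simp only [InsInv, JdtInv, insApp] at hi hj hI hJ ⊢
      · grind
      · grind
      · grind
      · grind
    all_goals
      apply JdtStep.stay
      simp only [InsInv, JdtInv, insApp] at hi hj hI hJ ⊢
      grind
  -- A label just to the left of `p₁` exceeds `p₁` by the jeu de taquin invariant, so by `KInc` it
  -- cannot be below `k`.
  have hC : (∃ q₁, q₁ ≤ s ∧ v q₁ + 1 = v p₁) → ∃ q₁, q₁ ≤ s ∧ k ≤ q₁ ∧ v q₁ + 1 = v p₁ := by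
    rintro ⟨q₁, hs, hq₁⟩
    refine ⟨q₁, hs, ?_, hq₁⟩
    by_contra! hlt
    simp only [InsInv, JdtInv] at hi hj hI hJ
    grind
  by_cases hex : ∃ q₁, q₁ ≤ s ∧ v q₁ + 1 = v p₁
  · obtain ⟨q₁, hq1, hq2, hq3⟩ := hC hex
    refine ⟨some q₁, CommRel.cross _ _ _ _ h4 g1 g2 g3 ?_ (by simp), ?_, hB⟩
    · rintro q' ⟨rfl⟩
      exact ⟨hq3, hq2, hq1⟩
    · simp only [JdtInv] at hj hJ
      cases q with
      | none =>
        have hpp : p₁ = p := by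
          rcases h6 with h6 | h6
          · exact h6.1
          · exfalso
            have := hq' rfl
            grind
        subst hpp
        apply InsStep.hit _ _ hq1 _ hq2
        simp only [jdtApp]
        grind
      | some q =>
        have := hq q rfl
        have hpp : p₁ = p := by grind
        subst hpp
        have hqq : q₁ = q := by
          have := hr2 q q₁
          grind
        subst hqq
        apply InsStep.keep
        simp only [jdtApp]
        grind
  · refine ⟨none, CommRel.cross _ _ _ _ h4 g1 g2 g3 (by simp) ?_, ?_, hB⟩
    · intro _ l hl hl'
      exact hex ⟨l, hl, hl'⟩
    · simp only [JdtInv] at hj hJ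
      cases q with
      | none =>
        by_cases hpp : p₁ = p
        · subst hpp
          apply InsStep.stay
          intro f hf
          simp only [jdtApp]
          grind
        · apply InsStep.pass _ _ h2.le _ h4
          simp only [jdtApp]
          grind
      | some q =>
        have := hq q rfl
        have hpp : p₁ = p := by
          have := hr2 q p this.2.2.le hj.1.le
          have := hr1 q (hq q rfl).2.2
          have := hr1 p hj.1
          clear hr2 hu hv hex hC hj hJ hq
          grind
        subst hpp
        apply InsStep.back
        simp only [jdtApp]
        grind

/-- The block shrinks to one turning pipe. Jeu de taquin then moves on to the right, and the two
states either separate or meet again at a label to the right. -/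
theorem comm_cross_turn {e e₁ p₁ : ι} {f q f₁ : Option ι} (hr : RowOK s u v) (hu : KInc k (· < s) u)
    (hv : KInc k (· ≤ s) v)
    (hi : InsInv k (· < s) u (e, f)) (hj : JdtInv (· < s) u e) (hjs : JdtStep s u v e p₁)
    (his : InsStep k s u v (e, f) (e₁, f₁))
    (hf : ∀ f', f = some f' → u f' = u e + 1)
    (hq : ∀ q', q = some q' → u q' + 1 = u e ∧ k ≤ q' ∧ q' < s)
    (hq' : q = none → ∀ l, l < s → u l + 1 ≠ u e)
    (hne : v e ≠ u e) :
    ∃ p', CommRel k (· ≤ s) v (e₁, f₁) p₁ (e₁, f₁) p' ∧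
      InsStep k s (jdtApp u e) (jdtApp v p₁) (e, q) (e₁, f₁) ∧
      JdtStep s (insApp u (e, f)) (insApp v (e₁, f₁)) e p' := by
  have hI := insStep_inv hr hu hv hi his
  have hJ := jdtStep_inv hr hj hjs
  have hr1 := hr.1
  have hr2 := hr.pair
  have hu := hu.pair
  have hv := hv.pair
  clear hr
  cases hjs with
  | stay h => exact absurd h hne
  | turn _ h h1 _ h3 =>
    -- A larger label just to the left would have to cross the run of `e` vertically, which only a
    -- smaller label may do.
    obtain rfl : q = none := by
      cases q with
      | none => rfl
      | some q =>
        have h4 := hq q rfl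
        have := hr2 q e h4.2.2.le hj.1.le
        have := hr1 q h4.2.2
        have := hr1 e hj.1
        have : e < k := by cases f <;> simp only [InsInv] at hi <;> tauto
        clear hr2 hu hv hq h3
        grind
    replace hq' := hq' rfl
    cases f with
    | none =>
      cases his with
      | pass _ _ hf1 hf2 hf3 =>
        obtain rfl : e₁ = p₁ := by
          have := h3 e₁ hf1 (by omega)
          have := hr2 e₁ p₁ hf1 h1
          grind
        refine ⟨e₁, CommRel.cross _ _ _ _ hf3 le_rfl ?_ (by simp) (by simp) ?_, InsStep.pass _ _ hf1 ?_ hf3,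
          JdtStep.turn _ _ ?_ hf1 ?_ ?_⟩
        · exact fun c hc hc' => ⟨e₁, hf1, hf3, by omega⟩
        · intro _ l hl hl'
          simp only [InsInv, JdtInv] at hi hj hI hJ
          have := hr2 l e hl hj.1.le
          grind
        · simp only [InsInv, JdtInv, jdtApp] at hi hj hI hJ ⊢
          grind
        · simp only [InsInv, JdtInv, insApp] at hi hj hI hJ ⊢
          grind
        · simp only [InsInv, JdtInv, insApp] at hi hj hI hJ ⊢
          grind
        · simp only [InsInv, JdtInv, insApp] at hi hj hI hJ ⊢
          grind
      | hit _ f hf1 hf2 hf3 =>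
        obtain rfl : f = p₁ := by
          have := h3 f hf1 (by omega)
          have := hr2 f p₁ hf1 h1
          grind
        refine ⟨e, CommRel.swap _ _ _ _ ?_ ?_ ?_, InsStep.hit _ _ hf1 ?_ hf3, JdtStep.stay _ ?_⟩
        · have := hr1 e hj.1
          grind
        · omega
        · simp only [InsInv, JdtInv] at hi hj hI hJ
          grind
        · simp only [InsInv, JdtInv, jdtApp] at hi hj hI hJ ⊢
          grind
        · simp only [InsInv, JdtInv, insApp] at hi hj hI hJ ⊢
          grind
      | stay _ hf1 =>
        have := h3 e hj.1.le
        have := hr1 e hj.1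
        refine ⟨p₁, CommRel.move _ _ ?_ ?_ ?_, InsStep.stay _ ?_, JdtStep.turn _ _ ?_ h1 ?_ ?_⟩
        · omega
        · omega
        · have := hf1 p₁
          grind
        · intro f hf
          have := hr2 f e hf hj.1.le
          have := hf1 f hf
          simp only [InsInv, JdtInv, jdtApp] at hi hj hI hJ ⊢
          grind
        · simp only [InsInv, JdtInv, insApp] at hi hj hI hJ ⊢
          grind
        · simp only [InsInv, JdtInv, insApp] at hi hj hI hJ ⊢
          grind
        · simp only [InsInv, JdtInv, insApp] at hi hj hI hJ ⊢
          grind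
    | some f =>
      have := hf _ rfl
      cases his with
      | back _ _ h5 =>
        exfalso
        simp only [InsInv] at hi
        have := hr2 f e hi.2.2.2.1.le hi.1.le
        have := hr1 f hi.2.2.2.1
        have := hr1 e hi.1
        clear hr2 hu hv hq h3
        grind
      | keep _ _ h5 =>
        have hfs := hi.2.2.2.1
        have hef := hr2 f e hfs.le hi.1.le
        have := hr1 e hj.1
        have := hr1 f hfs
        have hvf : v f = u f := by
          simp only [InsInv, JdtInv] at hi hj hI hJ
          clear hr2 hu hv hq h3
          grind
        obtain rfl : f = p₁ := by
          have := h3 f hfs.le (by omega)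
          have := hr2 f p₁ hfs.le h1
          grind
        refine ⟨e, CommRel.swap _ _ _ _ ?_ ?_ ?_, InsStep.hit _ _ hfs.le ?_ hi.2.2.1, JdtStep.stay _ ?_⟩
        · omega
        · omega
        · simp only [InsInv, JdtInv] at hi hj hI hJ
          grind
        · simp only [InsInv, JdtInv, jdtApp] at hi hj hI hJ ⊢
          grind
        · simp only [InsInv, JdtInv, insApp] at hi hj hI hJ ⊢
          grind
end

/-! ### The commutation step as a whole, its initial cases, and cancellation. -/

section
variable {k s : ι} {u v : ι → ℕ}

theorem commRel_step {p p₁ p' : ι} {σ σ₁ σ' : ι × Option ι} (hr : RowOK s u v)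
    (hu : KInc k (· < s) u) (hv : KInc k (· ≤ s) v) (hi : InsInv k (· < s) u σ)
    (hj : JdtInv (· < s) u p) (his : InsStep k s u v σ σ₁) (hjs : JdtStep s u v p p₁)
    (hC : InsInv k (· < s) (jdtApp u p) σ') (hR : CommRel k (· < s) u σ p σ' p') :
    ∃ σ₁' p₁', CommRel k (· ≤ s) v σ₁ p₁ σ₁' p₁' ∧
      InsStep k s (jdtApp u p) (jdtApp v p₁) σ' σ₁' ∧
      JdtStep s (insApp u σ) (insApp v σ₁) p' p₁' := by
  obtain ⟨e₁, f₁⟩ := σ₁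
  cases hR with
  | move e p h₀ h₁ h₂ =>
    cases f₁ with
    | none => exact ⟨_, _, comm_move_move hr hu hv hi hj his hjs h₀ h₁ h₂⟩
    | some f =>
      obtain rfl : e = e₁ := by cases his; rfl
      exact ⟨_, _, comm_move_swap hr hu hv hi hj his hjs h₀ h₁ h₂⟩
  | swap e f p p' h₁ h₂ hp =>
    subst hp
    change ∃ σ₁' p₁', _ ∧ _ ∧ JdtStep _ _ _ (swapLabel e f p) _
    cases his with
    | back _ _ h =>
      obtain ⟨σ', h⟩ := comm_swap_move hr hu hv hi hj (InsStep.back _ _ h) hjs h₁ h₂ hC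
      exact ⟨_, _, h⟩
    | keep _ _ h => exact ⟨_, _, comm_swap_swap hr hu hv hi hj (InsStep.keep _ _ h) hjs h₁ h₂⟩
  | cross _ _ f q hp hpe hc hf hq hq' =>
    by_cases hne : p = p' → v p = u p
    · obtain ⟨q₁, h⟩ := comm_cross hr hu hv hi hj hjs his hp hpe hc hf hq hq' hne
      exact ⟨_, _, h⟩
    · push Not at hne
      obtain ⟨rfl, hne⟩ := hne
      obtain ⟨q₁, h⟩ := comm_cross_turn hr hu hv hi hj hjs his hf hq hq' hne
      exact ⟨_, _, h⟩

theorem insInv_start (hr : RowOK s u v) (hv : KInc k (· ≤ s) v) (hsk : s < k) :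
    InsInv k (· ≤ s) v (s, none) := by
  have h1 := hr.1
  have h2 := hr.pair
  have hv := hv.pair
  simp only [InsInv]
  grind

theorem insApp_start_row (hr : RowOK s u v) (hv : KInc k (· ≤ s) v) (hsk : s < k) :
    RowOK s u (insApp v (s, none)) := by
  have h1 := hr.1
  have h2 := hr.pair
  have hv := hv.pair
  refine ⟨fun l hl => ?_, fun l m hl hm => ?_⟩ <;> simp only [insApp] <;> grind

theorem jdtInv_start (hv : 1 ≤ v s) (hu : ∀ l, l < s → v l + 1 ≠ v s) :
    JdtInv (· ≤ s) v s := ⟨le_rfl, hv, fun l _ hl' => hu l hl'⟩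

theorem jdtApp_start_row (hr : RowOK s u v) (hv : 1 ≤ v s) (hu : ∀ l, l < s → u l + 1 < v s) :
    RowOK s u (jdtApp v s) := by
  have h1 := hr.1
  have h2 := hr.pair
  refine ⟨fun l hl => ?_, fun l m hl hm => ?_⟩ <;> simp only [jdtApp] <;> grind

/-- Insertion starts in a row through which jeu de taquin is already passing. The states are apart
unless jeu de taquin selects the new label `s` itself. -/
theorem commRel_start {p p₁ : ι} (hr : RowOK s u v)
    (hv : KInc k (· ≤ s) v) (hsk : s < k)
    (hj : JdtInv (· < s) u p) (hjs : JdtStep s u v p p₁) :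
    CommRel k (· ≤ s) v (s, none) p₁ (s, none) p₁ ∧
      JdtStep s u (insApp v (s, none)) p p₁ := by
  have hI := insInv_start hr hv hsk
  have hJ := jdtStep_inv hr hj hjs
  have h1 := hr.1
  have h2 := hr.pair
  have hv := hv.pair
  constructor
  · by_cases h : s = p₁
    · subst h
      refine CommRel.cross _ _ _ _ hsk le_rfl (fun c hc hc' => ⟨s, le_rfl, hsk, by omega⟩)
        (by simp) (by simp) ?_
      simp only [InsInv, JdtInv] at *
      grind
    · refine CommRel.move _ _ ?_ ?_ ?_ <;> simp only [InsInv, JdtInv] at hI hJ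
      · grind
      · cases hjs <;> grind
      · cases hjs <;> grind
  · cases hjs
    · apply JdtStep.stay
      simp only [insApp, JdtInv] at hj ⊢
      grind
    · apply JdtStep.turn <;> simp only [InsInv, JdtInv, insApp] at hI hj ⊢
      · grind
      · grind
      · grind
      · grind

theorem commRel_self (hI : InsInv k (· ≤ s) v (s, none)) (hu : ∀ l, l < s → v l + 1 ≠ v s) :
    CommRel k (· ≤ s) v (s, none) s (s, none) s := by
  refine CommRel.cross _ _ _ _ hI.2.1 le_rfl (fun c hc hc' => ⟨s, le_rfl, hI.2.1, by omega⟩)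
        (by simp) (by simp) ?_
  simp only [InsInv] at *
  grind

theorem jdtApp_insApp_self {P : ι → Prop} {x : ι → ℕ} {e : ι} {f : Option ι} (hi : InsInv k P x (e, f))
    (hinj : ∀ l m, P l → P m → x l = x m → l = m)
    (hf : ∀ f', f = some f' → x f' = x e + 1) (l : ι) (hl : P l) :
    jdtApp (insApp x (e, f)) e l = x l := by
  cases f <;> simp only [jdtApp, insApp, InsInv] at * <;> grind

/-- All columns up to that of `e` are filled by labels below `k`, which are vertical in this row.
Hence jeu de taquin after insertion can only follow the inserted label, and an exchanged `f` stays
adjacent to `e`. -/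
theorem jdtStep_insApp {e e₁ : ι} {f f₁ : Option ι} (hr : RowOK s u v)
    (hu : KInc k (· < s) u) (hv : KInc k (· ≤ s) v) (hi : InsInv k (· < s) u (e, f))
    (his : InsStep k s u v (e, f) (e₁, f₁))
    (hc : ∀ c, c ≤ u e → ∃ l, l < s ∧ l < k ∧ u l = c)
    (hf : ∀ f', f = some f' → u f' = u e + 1) :
    (∀ c, c ≤ v e₁ → ∃ l, l ≤ s ∧ l < k ∧ v l = c) ∧ (∀ f', f₁ = some f' → v f' = v e₁ + 1) ∧
      JdtStep s (insApp u (e, f)) (insApp v (e₁, f₁)) e e₁ := by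
  have hI := insStep_inv hr hu hv hi his
  have hvert : ∀ l, l < s → u l ≤ u e → v l = u l := by
    intro l hl hle
    have := hr.1 l hl
    rcases Nat.eq_zero_or_pos (u l) with h | h
    · omega
    · exact vertical_of_block hr hv (a := 0) (b := u e) (fun c _ h => hc c h) l hl h hle
  have hes : e < s := by cases f <;> exact hi.1
  have hve := hvert e hes le_rfl
  have key : ∀ c, c ≤ v e → ∃ l, l ≤ s ∧ l < k ∧ v l = c := by
    intro c hc2
    obtain ⟨l, hl, hlk, hle⟩ := hc c (by omega)
    exact ⟨l, hl.le, hlk, (hvert l hl (by omega)).trans hle⟩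
  refine ⟨?_, ?_, ?_⟩
  · cases his
    · intro c hc1
      rcases Nat.lt_or_ge (v e) c with h | h
      · exact ⟨e₁, by assumption, by assumption, by clear key hc; omega⟩
      · exact key c h
    all_goals exact key
  · rintro f' rfl
    have g1 := hr.1
    have hr := hr.pair
    have hu := hu.pair
    have hv := hv.pair
    cases his
    · grind
    · next f hvf =>
      have := hf _ rfl
      have := hr e f'
      simp only [InsInv] at hi
      have := g1 f'
      by_contra hcon
      obtain ⟨l, hl, hlk, hle⟩ := key (v f') (by grind)
      grind
  · have hr1 := hr.1
    have hr2 := hr.pair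
    have hu := hu.pair
    have hv := hv.pair
    clear hr hc key
    cases his
    · apply JdtStep.turn <;> simp only [InsInv, insApp] at hi hI ⊢
      · grind
      · grind
      · grind
      · grind
    all_goals
      apply JdtStep.stay
      simp only [InsInv, insApp] at hi hI ⊢
      grind

end

end transducers

/-! ### Irrelevance of unused entries, and determinism of the transducers. -/

theorem RowOK.congr {s : ℕ} {u v u' v' : ℕ → ℕ} (h : RowOK s u v) (hu : ∀ l, l < s → u l = u' l)
    (hv : ∀ l, l ≤ s → v l = v' l) : RowOK s u' v' := by
  refine ⟨fun l hl => ?_, fun l m hl hm => ?_⟩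
  · rw [← hu l hl, ← hv l hl.le]; exact h.1 l hl
  · have := h.2 l m hl hm
    rw [← hu l (by omega), ← hv l (by omega), ← hv m hm]
    rcases hm.lt_or_eq with h1 | h1
    · rwa [← hu m h1]
    · omega

theorem InsInv.congr {k : ℕ} {P : ℕ → Prop} {x x' : ℕ → ℕ} {σ} (h : InsInv k P x σ)
    (hP : ∀ l m, l < m → P m → P l) (hx : ∀ l, P l → x l = x' l) : InsInv k P x' σ := by
  obtain ⟨e, f⟩ := σ
  cases f with
  | none =>
    refine ⟨h.1, h.2.1, fun l hl => ?_⟩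
    rw [← hx l hl, ← hx e h.1]; exact h.2.2 l hl
  | some f =>
    obtain ⟨h1, h2, h3, h4, h5, h6⟩ := h
    refine ⟨h1, h2, h3, h4, ?_, fun l hl hle => ?_⟩
    · rwa [← hx e h1, ← hx f h4]
    · rw [← hx e h1, ← hx f h4, ← hx l (hP l f hl h4)]; exact h6 l hl hle

theorem KInc.congr {k : ℕ} {P : ℕ → Prop} {x x' : ℕ → ℕ} (h : KInc k P x)
    (hP : ∀ l m, l < m → P m → P l) (hx : ∀ l, P l → x l = x' l) : KInc k P x' := by
  intro l m hl hm hmP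
  rw [← hx l (hP l m hl hmP), ← hx m hmP]; exact h l m hl hm hmP

theorem InsStep.congr {k s : ℕ} {u v u' v' x : ℕ → ℕ} {σ σ'} (h : InsStep k s u v σ σ')
    (hi : InsInv k (· < s) x σ) (hu : ∀ l, l < s → u l = u' l)
    (hv : ∀ l, l ≤ s → v l = v' l) : InsStep k s u' v' σ σ' := by
  cases h with
  | pass e f hf h hk => exact .pass e f hf (by rw [← hv f hf, ← hu e hi.1, h]) hk
  | hit e f hf h hk => exact .hit e f hf (by rw [← hv f hf, ← hu e hi.1, h]) hk
  | stay e h => exact .stay e fun f hf => by rw [← hv f hf, ← hu e hi.1]; exact h f hf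
  | back e f h => exact .back e f (by rwa [← hv e hi.1.le, ← hv f hi.2.2.2.1.le])
  | keep e f h => exact .keep e f (by rwa [← hv e hi.1.le, ← hv f hi.2.2.2.1.le])

theorem JdtStep.congr {s : ℕ} {u v u' v' : ℕ → ℕ} {p p'} (h : JdtStep s u v p p') (hp : p < s)
    (hu : ∀ l, l < s → u l = u' l) (hv : ∀ l, l ≤ s → v l = v' l) : JdtStep s u' v' p p' := by
  cases h with
  | stay h => exact .stay p (by rw [← hv p hp.le, ← hu p hp, h])
  | turn p' h hp' h1 hmin =>
    refine .turn p p' (by rwa [← hv p hp.le, ← hu p hp]) hp' (by rwa [← hv p' hp', ← hu p hp]) ?_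
    intro l hl
    rw [← hv p' hp', ← hu p hp, ← hv l hl]; exact hmin l hl

theorem RowOK.inj {s : ℕ} {u v : ℕ → ℕ} (h : RowOK s u v) {l m : ℕ} (hl : l ≤ s) (hm : m ≤ s)
    (he : v l = v m) : l = m := by
  have h1 := h.1 l
  have h2 := h.1 m
  have := h.pair l m hl hm
  omega

theorem InsStep.unique {k s : ℕ} {u v : ℕ → ℕ} {σ σ₁ σ₂} (hr : RowOK s u v)
    (h₁ : InsStep k s u v σ σ₁) (h₂ : InsStep k s u v σ σ₂) : σ₁ = σ₂ := by
  cases h₁ with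
  | pass e f hf h hk =>
    cases h₂ with
    | pass _ f' hf' h' hk' => rw [hr.inj hf hf' (h.trans h'.symm)]
    | hit _ f' hf' h' hk' => have := hr.inj hf hf' (h.trans h'.symm); omega
    | stay _ h' => exact absurd h (h' f hf)
  | hit e f hf h hk =>
    cases h₂ with
    | pass _ f' hf' h' hk' => have := hr.inj hf hf' (h.trans h'.symm); omega
    | hit _ f' hf' h' hk' => rw [hr.inj hf hf' (h.trans h'.symm)]
    | stay _ h' => exact absurd h (h' f hf)
  | stay e h =>
    cases h₂ with
    | pass _ f' hf' h' hk' => exact absurd h' (h _ hf')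
    | hit _ f' hf' h' hk' => exact absurd h' (h _ hf')
    | stay _ h' => rfl
  | back e f h => cases h₂ <;> first | rfl | omega
  | keep e f h => cases h₂ <;> first | rfl | omega

theorem InsStep.exists {k s : ℕ} {u v : ℕ → ℕ} {σ} (hr : RowOK s u v)
    (hi : InsInv k (· < s) u σ) : ∃ σ', InsStep k s u v σ σ' := by
  obtain ⟨e, f⟩ := σ
  cases f with
  | none =>
    by_cases h : ∃ f, f ≤ s ∧ v f = u e + 1
    · obtain ⟨f, hf, h⟩ := h
      rcases Nat.lt_or_ge f k with hk | hk
      · exact ⟨_, .pass e f hf h hk⟩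
      · exact ⟨_, .hit e f hf h hk⟩
    · exact ⟨_, .stay e fun f hf hv => h ⟨f, hf, hv⟩⟩
  | some f =>
    rcases lt_trichotomy (v f) (v e) with h | h | h
    · exact ⟨_, .back e f h⟩
    · obtain ⟨h1, h2, h3, h4, -⟩ := hi
      have := hr.inj h4.le h1.le h
      omega
    · exact ⟨_, .keep e f h⟩

theorem JdtStep.unique {s : ℕ} {u v : ℕ → ℕ} {p p₁ p₂} (hr : RowOK s u v)
    (h₁ : JdtStep s u v p p₁) (h₂ : JdtStep s u v p p₂) : p₁ = p₂ := by
  cases h₁ with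
  | stay h =>
    cases h₂ with
    | stay h' => rfl
    | turn _ h' => exact absurd h h'
  | turn _ h hp hv hmin =>
    cases h₂ with
    | stay h' => exact absurd h' h
    | turn _ h' hp' hv' hmin' =>
      exact hr.inj hp hp' (le_antisymm (hmin _ hp' hv') (hmin' _ hp hv))

theorem JdtStep.exists {s : ℕ} {u v : ℕ → ℕ} {p} (hr : RowOK s u v) (hp : p < s) :
    ∃ p', JdtStep s u v p p' := by
  by_cases h : v p = u p
  · exact ⟨p, .stay p h⟩
  · have hs : u p < v s := by
      have := hr.2 p s hp le_rfl
      have := hr.1 p hp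
      omega
    obtain ⟨p', hp', hmin⟩ := Finset.exists_min_image
      ((Finset.range (s + 1)).filter fun l => u p < v l) v ⟨s, by simp [hs]⟩
    simp only [Finset.mem_filter, Finset.mem_range, Nat.lt_succ_iff] at hp' hmin
    exact ⟨p', .turn p p' h hp'.1 hp'.2 fun l hl hl' => hmin l ⟨hl, hl'⟩⟩

/-! ### Insertion and jeu de taquin on sequences of columns. -/

/-- The sequence agrees with the identity outside the `n × n` square. -/
def Bdd (n : ℕ) (A : ℕ → ℕ → ℕ) : Prop :=
  ∀ h l, l < h → (l < n → A h l < n) ∧ (n ≤ l → A h l = l) ∧ (n ≤ h → l < n → A h l = A n l)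

/-- Sequences of columns that encode bumpless pipe dreams. -/
structure Valid (A : ℕ → ℕ → ℕ) : Prop where
  row : ∀ s, RowOK s (A s) (A (s + 1))
  zero : ∀ h l, h ≤ l → A h l = 0
  bdd : ∃ n, Bdd n A

/-- The labels less than `k` are increasing at all horizontal lines. -/
def KIncAll (k : ℕ) (A : ℕ → ℕ → ℕ) : Prop := ∀ h, KInc k (· < h) (A h)

theorem lt_succ_eq_le (s : ℕ) : (fun x => x < s + 1) = (fun x => x ≤ s) :=
  funext fun _ => propext Nat.lt_succ_iff

theorem KIncAll.le {k : ℕ} {A : ℕ → ℕ → ℕ} (h : KIncAll k A) (s : ℕ) : KInc k (· ≤ s) (A (s + 1)) := by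
  have := h (s + 1)
  rwa [lt_succ_eq_le] at this

theorem Valid.inj {A : ℕ → ℕ → ℕ} (hA : Valid A) {h l m : ℕ} (hl : l < h) (hm : m < h)
    (he : A h l = A h m) : l = m := by
  cases h with
  | zero => omega
  | succ s => exact (hA.row s).inj (by omega) (by omega) he

theorem KIncAll.mono {k k' : ℕ} {A : ℕ → ℕ → ℕ} (h : KIncAll k A) (hk : k' ≤ k) : KIncAll k' A :=
  fun s l m hl hm hP => h s l m hl (lt_of_lt_of_le hm hk) hP

open Classical in
/-- The insertion state below a row. -/
noncomputable def insNext (k s : ℕ) (u v : ℕ → ℕ) (σ : ℕ × Option ℕ) : ℕ × Option ℕ :=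
  if h : ∃ σ', InsStep k s u v σ σ' then h.choose else σ

open Classical in
/-- The jeu de taquin state below a row. -/
noncomputable def jdtNext (s : ℕ) (u v : ℕ → ℕ) (p : ℕ) : ℕ :=
  if h : ∃ p', JdtStep s u v p p' then h.choose else p

/-- The insertion state at the horizontal line `h`. -/
noncomputable def insState (k a : ℕ) (A : ℕ → ℕ → ℕ) : ℕ → ℕ × Option ℕ
  | 0 => (a, none)
  | h + 1 => if h ≤ a then (a, none) else insNext k h (A h) (A (h + 1)) (insState k a A h)

/-- Right insertion on sequences of columns. -/
noncomputable def insSeq (k a : ℕ) (A : ℕ → ℕ → ℕ) (h l : ℕ) : ℕ :=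
  if l < h then if h ≤ a then A h l else insApp (A h) (insState k a A h) l else 0

/-- The jeu de taquin state at the horizontal line `h`. -/
noncomputable def jdtState (b : ℕ) (A : ℕ → ℕ → ℕ) : ℕ → ℕ
  | 0 => b
  | h + 1 => if h ≤ b then b else jdtNext h (A h) (A (h + 1)) (jdtState b A h)

/-- Jeu de taquin on sequences of columns. -/
noncomputable def jdtSeq (b : ℕ) (A : ℕ → ℕ → ℕ) (h l : ℕ) : ℕ :=
  if l < h then if h ≤ b then A h l else jdtApp (A h) (jdtState b A h) l else 0

theorem insState_start (k a : ℕ) (A : ℕ → ℕ → ℕ) : insState k a A (a + 1) = (a, none) := by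
  simp [insState]

theorem jdtState_start (b : ℕ) (A : ℕ → ℕ → ℕ) : jdtState b A (b + 1) = b := by
  simp [jdtState]

section ins
variable {k a : ℕ} {A : ℕ → ℕ → ℕ} (hA : Valid A) (hk : KIncAll k A) (ha : a < k)
include hA hk ha

theorem ins_inv_step (h : ℕ) (hh : a < h) : InsInv k (· < h) (A h) (insState k a A h) ∧
    InsStep k h (A h) (A (h + 1)) (insState k a A h) (insState k a A (h + 1)) := by
  have key : InsInv k (· < h) (A h) (insState k a A h) →
      InsStep k h (A h) (A (h + 1)) (insState k a A h) (insState k a A (h + 1)) := by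
    intro hi
    have hex := InsStep.exists (hA.row h) hi
    rw [insState, if_neg (by omega), insNext, dif_pos hex]
    exact hex.choose_spec
  suffices InsInv k (· < h) (A h) (insState k a A h) from ⟨this, key this⟩
  clear key
  induction h, hh using Nat.le_induction with
  | base =>
    rw [insState_start, lt_succ_eq_le]
    exact insInv_start (hA.row a) (hk.le a) ha
  | succ h hh ih =>
    have hex := InsStep.exists (hA.row h) ih
    rw [insState, if_neg (by omega), insNext, dif_pos hex, lt_succ_eq_le]
    exact insStep_inv (hA.row h) (hk h) (hk.le h) ih hex.choose_spec

theorem ins_inv {h : ℕ} (hh : a < h) : InsInv k (· < h) (A h) (insState k a A h) :=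
  (ins_inv_step hA hk ha h hh).1

theorem ins_step {h : ℕ} (hh : a < h) :
    InsStep k h (A h) (A (h + 1)) (insState k a A h) (insState k a A (h + 1)) :=
  (ins_inv_step hA hk ha h hh).2

end ins

theorem insSeq_of_le {k a : ℕ} {A : ℕ → ℕ → ℕ} (hA : Valid A) {h : ℕ} (hh : h ≤ a) :
    insSeq k a A h = A h := by
  funext l
  unfold insSeq
  split
  · simp
  · rw [hA.zero h l (by omega)]

theorem insSeq_apply {k a : ℕ} {A : ℕ → ℕ → ℕ} {h l : ℕ} (hh : a < h) (hl : l < h) :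
    insSeq k a A h l = insApp (A h) (insState k a A h) l := by
  simp [insSeq, hl, hh.not_ge]

theorem jdtSeq_of_le {b : ℕ} {A : ℕ → ℕ → ℕ} (hA : Valid A) {h : ℕ} (hh : h ≤ b) :
    jdtSeq b A h = A h := by
  funext l
  unfold jdtSeq
  split
  · simp
  · rw [hA.zero h l (by omega)]

theorem jdtSeq_apply {b : ℕ} {A : ℕ → ℕ → ℕ} {h l : ℕ} (hh : b < h) (hl : l < h) :
    jdtSeq b A h l = jdtApp (A h) (jdtState b A h) l := by
  simp [jdtSeq, hl, hh.not_ge]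

/-- Row `b` is the first one with an empty tile. -/
def FirstRow (b : ℕ) (A : ℕ → ℕ → ℕ) : Prop :=
  (∀ h l, h ≤ b → l < h → A h l = l) ∧ b < A (b + 1) b

/-- If pipe `l` started in a column to the left of `l`, the pipe occupying that column at the top
would collide with it at its turn. -/
theorem RowOK.id_top {s : ℕ} {u v : ℕ → ℕ} (hr : RowOK s u v) (hu : ∀ l, l < s → u l = l) :
    (∀ l, l < s → v l = l) ∧ s ≤ v s := by
  have key : ∀ l, l < s → v l = l := by
    intro l hl
    by_contra hne
    have h1 := hr.1 l hl
    have h2 := hr.1 (v l)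
    have := hr.pair l (v l) hl.le
    have := hu l hl
    have := hu (v l)
    omega
  refine ⟨key, ?_⟩
  by_contra! hlt
  have := hr.pair (v s) s hlt.le le_rfl
  have := key (v s) hlt
  have := hu (v s) hlt
  omega

section jdt
variable {b : ℕ} {A : ℕ → ℕ → ℕ} (hA : Valid A) (hb : FirstRow b A)
include hA hb

theorem FirstRow.succ {l : ℕ} (hl : l < b) : A (b + 1) l = l :=
  ((hA.row b).id_top fun l hl => hb.1 b l le_rfl hl).1 l hl

theorem jdt_inv_step (h : ℕ) (hh : b < h) : JdtInv (· < h) (A h) (jdtState b A h) ∧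
    JdtStep h (A h) (A (h + 1)) (jdtState b A h) (jdtState b A (h + 1)) := by
  have key : JdtInv (· < h) (A h) (jdtState b A h) →
      JdtStep h (A h) (A (h + 1)) (jdtState b A h) (jdtState b A (h + 1)) := by
    intro hi
    have hex := JdtStep.exists (hA.row h) hi.1
    rw [jdtState, if_neg (by omega), jdtNext, dif_pos hex]
    exact hex.choose_spec
  suffices JdtInv (· < h) (A h) (jdtState b A h) from ⟨this, key this⟩
  clear key
  induction h, hh using Nat.le_induction with
  | base =>
    rw [jdtState_start, lt_succ_eq_le]
    have h0 : b < A (b + 1) b := hb.2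
    refine jdtInv_start (Nat.one_le_of_lt h0) fun l hl => ?_
    change A (b + 1) l + 1 ≠ A (b + 1) b
    rw [FirstRow.succ hA hb hl]
    omega
  | succ h hh ih =>
    have hex := JdtStep.exists (hA.row h) ih.1
    rw [jdtState, if_neg (by omega), jdtNext, dif_pos hex, lt_succ_eq_le]
    exact jdtStep_inv (hA.row h) ih hex.choose_spec

theorem jdt_inv {h : ℕ} (hh : b < h) : JdtInv (· < h) (A h) (jdtState b A h) :=
  (jdt_inv_step hA hb h hh).1

theorem jdt_step {h : ℕ} (hh : b < h) :
    JdtStep h (A h) (A (h + 1)) (jdtState b A h) (jdtState b A (h + 1)) :=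
  (jdt_inv_step hA hb h hh).2

theorem jdtSeq_row (s : ℕ) : RowOK s (jdtSeq b A s) (jdtSeq b A (s + 1)) := by
  rcases lt_trichotomy s b with h | rfl | h
  · rw [jdtSeq_of_le hA h.le, jdtSeq_of_le hA (by omega)]; exact hA.row s
  · rw [jdtSeq_of_le hA le_rfl]
    refine (jdtApp_start_row (hA.row s) ?_ ?_).congr (fun _ _ => rfl) fun l hl => ?_
    · have := hb.2
      omega
    · intro l hl
      have := hb.2
      rw [hb.1 s l le_rfl hl]; omega
    · rw [jdtSeq_apply (by omega) (by omega), jdtState_start]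
  · exact (jdtStep_row (hA.row s) (jdt_inv hA hb h) (jdt_step hA hb h)).congr
      (fun l hl => (jdtSeq_apply h hl).symm) fun l hl => (jdtSeq_apply (by omega) (by omega)).symm

theorem jdtSeq_kinc {k : ℕ} (hk : KIncAll k A) : KIncAll k (jdtSeq b A) := by
  intro h
  rcases Nat.lt_or_ge b h with hh | hh
  · exact (jdt_kinc (hk h) (jdt_inv hA hb hh) (fun l m hl hm => hA.inj hl hm)
      (fun l m hl hm => lt_trans hl hm)).congr (fun l m hl hm => lt_trans hl hm)
      fun l hl => (jdtSeq_apply hh hl).symm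
  · rw [jdtSeq_of_le hA hh]; exact hk h

end jdt

theorem insSeq_row {k a : ℕ} {A : ℕ → ℕ → ℕ} (hA : Valid A) (hk : KIncAll k A) (ha : a < k) (s : ℕ) :
    RowOK s (insSeq k a A s) (insSeq k a A (s + 1)) := by
  rcases lt_trichotomy s a with h | rfl | h
  · rw [insSeq_of_le hA h.le, insSeq_of_le hA (by omega)]; exact hA.row s
  · rw [insSeq_of_le hA le_rfl]
    refine (insApp_start_row (hA.row s) (hk.le s) ha).congr (fun _ _ => rfl) fun l hl => ?_
    rw [insSeq_apply (by omega) (by omega), insState_start]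
  · exact (insStep_row (hA.row s) (hk s) (hk.le s) (ins_inv hA hk ha h) (ins_step hA hk ha h)).congr
      (fun l hl => (insSeq_apply h hl).symm) fun l hl => (insSeq_apply (by omega) (by omega)).symm

theorem insSeq_kinc {k a : ℕ} {A : ℕ → ℕ → ℕ} (hA : Valid A) (hk : KIncAll k A) (ha : a < k) :
    KIncAll k (insSeq k a A) := by
  intro h
  rcases Nat.lt_or_ge a h with hh | hh
  · exact (ins_kinc (hk h) (ins_inv hA hk ha hh) (fun l m hl hm => hA.inj hl hm)
      (fun l m hl hm => lt_trans hl hm)).congr (fun l m hl hm => lt_trans hl hm)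
      fun l hl => (insSeq_apply hh hl).symm
  · rw [insSeq_of_le hA hh]; exact hk h

theorem Bdd.lt {n N : ℕ} {A : ℕ → ℕ → ℕ} (hn : Bdd n A) (hN : n ≤ N) {h l : ℕ} (hl : l < h)
    (hlN : l < N) : A h l < N := by
  have := hn h l hl
  rcases Nat.lt_or_ge l n with h1 | h1 <;> omega

theorem Bdd.const {n : ℕ} {A : ℕ → ℕ → ℕ} (hn : Bdd n A) {h h' l : ℕ} (hh : n ≤ h) (hh' : n ≤ h')
    (hl : l < h) (hl' : l < h') : A h l = A h' l := by
  have h1 := hn h l hl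
  have h2 := hn h' l hl'
  rcases Nat.lt_or_ge l n with h3 | h3
  · rw [h1.2.2 hh h3, h2.2.2 hh' h3]
  · rw [h1.2.1 h3, h2.2.1 h3]

theorem Valid.surj {n : ℕ} {A : ℕ → ℕ → ℕ} (hA : Valid A) (hn : Bdd n A) {h c : ℕ} (hh : n ≤ h)
    (hc : c < h) : ∃ l, l < h ∧ A h l = c := by
  have := Finset.surj_on_of_inj_on_of_card_le (s := Finset.range h) (t := Finset.range h)
    (fun l _ => A h l) (fun l hl => by
      simp only [Finset.mem_range] at hl ⊢
      exact hn.lt hh hl hl)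
    (fun l m hl hm he => hA.inj (by simpa using hl) (by simpa using hm) he) le_rfl c (by simpa using hc)
  obtain ⟨l, hl, he⟩ := this
  exact ⟨l, by simpa using hl, he.symm⟩

/-- This is the reason for termination. Far down, all columns left of the diagonal are occupied, so
no label has a free column to its right and the state must be an exchange. Pipes are vertical there,
so it is never undone. The `k` in the bound provides for moved labels `e ≥ n`. -/
theorem ins_state_large {k a n : ℕ} {A : ℕ → ℕ → ℕ} (hA : Valid A) (hk : KIncAll k A) (ha : a < k)
    (hn : Bdd n A) (h : ℕ) (hh : max n k + 1 ≤ h) :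
    insState k a A h = insState k a A (max n k + 1) ∧
      ∃ e f, insState k a A h = (e, some f) ∧ f < max n k + 1 := by
  induction h, hh using Nat.le_induction with
  | base =>
    refine ⟨rfl, ?_⟩
    have hi := ins_inv hA hk ha (h := max n k + 1) (by omega)
    generalize insState k a A (max n k + 1) = σ at hi ⊢
    obtain ⟨e, f⟩ := σ
    cases f with
    | none =>
      exfalso
      have h1 := hn.lt (N := max n k + 1) (by omega) hi.1 hi.1
      by_cases h2 : A (max n k + 1) e + 1 < max n k + 1
      · obtain ⟨l, hl, he⟩ := hA.surj hn (h := max n k + 1) (by omega) h2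
        exact hi.2.2 l hl he
      · have h3 := hn _ _ hi.1
        have h4 := hi.2.1
        rcases Nat.lt_or_ge e n with h5 | h5 <;> omega
    | some f => exact ⟨e, f, rfl, hi.2.2.2.1⟩
  | succ h hh ih =>
    obtain ⟨h1, e, f, h2, h3⟩ := ih
    have hst := ins_step hA hk ha (h := h) (by omega)
    have hi := ins_inv hA hk ha (h := h) (by omega)
    rw [h2] at hst hi
    suffices insState k a A (h + 1) = (e, some f) from ⟨by rw [this, ← h1, h2], e, f, this, h3⟩
    refine hst.unique (hA.row h) (.keep e f ?_)
    rw [hn.const (h := h + 1) (h' := h) (by omega) (by omega) (lt_trans hi.1 (by omega)) hi.1,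
      hn.const (h := h + 1) (h' := h) (l := f) (by omega) (by omega) (by omega) (by omega)]
    exact hi.2.2.2.2.1

theorem insSeq_bdd {k a n : ℕ} {A : ℕ → ℕ → ℕ} (hA : Valid A) (hk : KIncAll k A) (ha : a < k)
    (hn : Bdd n A) : Bdd (max n k + 1) (insSeq k a A) := by
  intro h l hl
  have hA' := hn h l hl
  rcases Nat.lt_or_ge a h with hh | hh
  · have hi := ins_inv hA hk ha hh
    rw [insSeq_apply hh hl]
    refine ⟨fun hlN => ?_, fun hlN => ?_, fun hN hlN => ?_⟩
    · have hlt := hn.lt (N := max n k + 1) (by omega) hl hlN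
      have hlarge := ins_state_large hA hk ha hn h
      generalize insState k a A h = σ at hi hlarge ⊢
      obtain ⟨e, f⟩ := σ
      cases f with
      | none =>
        have h1 := hn h e hi.1
        have h2 := hi.2.1
        have hM1 := le_max_left n k
        have hM2 := le_max_right n k
        simp only [insApp]
        split
        · rcases Nat.lt_or_ge e n with h5 | h5
          · exact Nat.succ_lt_succ ((h1.1 h5).trans_le hM1)
          · rw [h1.2.1 h5]
            exact Nat.succ_lt_succ (h2.trans_le hM2)
        · exact hlt
      | some f =>
        have hf : f < max n k + 1 := by
          by_cases hc : max n k + 1 ≤ h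
          · obtain ⟨-, e', f', he, hf⟩ := hlarge hc
            simp only [Prod.mk.injEq, Option.some.injEq] at he
            omega
          · have := hi.2.2.2.1
            omega
        have h1 := hn.lt (N := max n k + 1) (by omega) hi.1 (by have := hi.2.1; omega)
        have h2 := hn.lt (N := max n k + 1) (by omega) hi.2.2.2.1 hf
        simp only [insApp]
        split
        · exact h2
        · split
          · exact h1
          · exact hlt
    · obtain ⟨-, e, f, hef, hf⟩ := ins_state_large hA hk ha hn h (by omega)
      rw [hef] at hi ⊢
      have := hi.2.1
      simp only [insApp]
      rw [if_neg (by omega), if_neg (by omega)]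
      exact hA'.2.1 (by omega)
    · obtain ⟨h0, e, f, hef, hf⟩ := ins_state_large hA hk ha hn h hN
      rw [insSeq_apply (by omega) hlN, ← h0, hef]
      rw [hef] at hi
      have := hi.2.1
      simp only [insApp]
      rw [hn.const (h := h) (h' := max n k + 1) (l := e) (by omega) (by omega) (by omega) (by omega),
        hn.const (h := h) (h' := max n k + 1) (l := f) (by omega) (by omega) (by omega) (by omega),
        hn.const (h := h) (h' := max n k + 1) (l := l) (by omega) (by omega) (by omega) (by omega)]
  · rw [insSeq_of_le hA hh]
    refine ⟨fun hlN => hn.lt (by omega) hl hlN, fun hlN => hA'.2.1 (by omega), fun hN hlN => ?_⟩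
    omega

theorem insSeq_valid {k a : ℕ} {A : ℕ → ℕ → ℕ} (hA : Valid A) (hk : KIncAll k A) (ha : a < k) :
    Valid (insSeq k a A) where
  row := insSeq_row hA hk ha
  zero h l hl := by simp [insSeq, hl.not_gt]
  bdd := by
    obtain ⟨n, hn⟩ := hA.bdd
    exact ⟨_, insSeq_bdd hA hk ha hn⟩

section jdt
variable {b : ℕ} {A : ℕ → ℕ → ℕ} (hA : Valid A) (hb : FirstRow b A)
include hA hb

/-- Pipes no longer turn below line `n`, so the state is frozen. -/
theorem jdt_state_large {n : ℕ} (hn : Bdd n A) (h : ℕ) (hh : n ≤ h) :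
    b < n ∧ jdtState b A h = jdtState b A n ∧ jdtState b A n < n := by
  have hbn : b < n := by
    by_contra! hle
    have := (hn (b + 1) b (by omega)).2.1 hle
    have := hb.2
    omega
  refine ⟨hbn, ?_, (jdt_inv hA hb hbn).1⟩
  induction h, hh using Nat.le_induction with
  | base => rfl
  | succ h hh ih =>
    rw [← ih]
    have hp := (jdt_inv hA hb (h := h) (by omega)).1
    refine (jdt_step hA hb (h := h) (by omega)).unique (hA.row h) (.stay _ ?_)
    exact hn.const (by omega) hh (lt_trans hp (by omega)) hp

theorem jdtSeq_bdd {n : ℕ} (hn : Bdd n A) : Bdd n (jdtSeq b A) := by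
  intro h l hl
  have hA' := hn h l hl
  rcases Nat.lt_or_ge b h with hh | hh
  · have hi := jdt_inv hA hb hh
    have hpn : jdtState b A h < n := by
      rcases Nat.lt_or_ge h n with hc | hc
      · exact lt_trans hi.1 hc
      · obtain ⟨_, h1, h2⟩ := jdt_state_large hA hb hn h hc
        rwa [h1]
    have hpv := (hn h _ hi.1).1 hpn
    rw [jdtSeq_apply hh hl]
    refine ⟨fun hlN => ?_, fun hlN => ?_, fun hN hlN => ?_⟩
    · simp only [jdtApp]
      split
      · omega
      · split <;> omega
    · simp only [jdtApp]
      rw [if_neg (by omega), if_neg (by omega)]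
      omega
    · obtain ⟨hbn, h1, h2⟩ := jdt_state_large hA hb hn h hN
      have h3 := hA'.2.2 hN hlN
      rw [h1] at hpv hpn ⊢
      rw [jdtSeq_apply hbn hlN]
      have h4 := hn.const (h := h) (h' := n) hN le_rfl (l := jdtState b A n) (by omega) h2
      simp only [jdtApp]
      rw [h3, h4]
  · rw [jdtSeq_of_le hA hh]
    exact ⟨hA'.1, hA'.2.1, fun hN => absurd (jdt_state_large hA hb hn h hN).1 (by omega)⟩

theorem jdtSeq_valid : Valid (jdtSeq b A) where
  row := jdtSeq_row hA hb
  zero h l hl := by simp [jdtSeq, hl.not_gt]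
  bdd := by
    obtain ⟨n, hn⟩ := hA.bdd
    exact ⟨n, jdtSeq_bdd hA hb hn⟩

end jdt

/-! ### Commutation and cancellation for whole sequences. -/

theorem jdt_ins_comm {k a b : ℕ} {A : ℕ → ℕ → ℕ} (hA : Valid A) (hk : KIncAll k A) (ha : a < k)
    (hb : FirstRow b A) (hba : b ≤ a) :
    jdtSeq b (insSeq k a A) = insSeq k a (jdtSeq b A) := by
  have hC := jdtSeq_valid hA hb
  have hkC := jdtSeq_kinc hA hb hk
  have hB := insSeq_valid hA hk ha
  have hbB : FirstRow b (insSeq k a A) := by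
    refine ⟨fun h l hh hl => by rw [insSeq_of_le hA (by omega), hb.1 h l hh hl], ?_⟩
    have := hb.2
    rcases hba.lt_or_eq with h | rfl
    · rw [insSeq_of_le hA (by omega)]; exact this
    · rw [insSeq_apply (by omega) (by omega), insState_start]
      simp only [insApp, if_true]
      omega
  -- Insertion has not yet changed these lines, so jeu de taquin sees the same rows.
  have hlow : ∀ h, b < h → h ≤ a → jdtState b (insSeq k a A) h = jdtState b A h := by
    intro h hh hha
    induction h, hh using Nat.le_induction with
    | base => rw [jdtState_start, jdtState_start]
    | succ h hh ih =>
      have h1 := jdt_step hB hbB (h := h) (by omega)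
      rw [ih (by omega), insSeq_of_le hA (by omega), insSeq_of_le hA hha] at h1
      exact h1.unique (hA.row h) (jdt_step hA hb (by omega))
  have hrel : ∀ h, a < h → CommRel k (· < h) (A h) (insState k a A h) (jdtState b A h)
      (insState k a (jdtSeq b A) h) (jdtState b (insSeq k a A) h) := by
    intro h hh
    induction h, hh using Nat.le_induction with
    | base =>
      rw [insState_start, insState_start]
      rcases hba.lt_or_eq with hlt | rfl
      · obtain ⟨h1, h2⟩ := commRel_start (hA.row a) (hk.le a) ha (jdt_inv hA hb hlt) (jdt_step hA hb hlt)
        have h3 := jdt_step hB hbB hlt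
        rw [hlow a hlt le_rfl, insSeq_of_le hA le_rfl] at h3
        have h4 := h2.congr (v' := insSeq k a A (a + 1)) (jdt_inv hA hb hlt).1 (fun _ _ => rfl) fun l hl => by
          rw [insSeq_apply (by omega) (by omega), insState_start]
        have h5 := hB.row a
        rw [insSeq_of_le hA le_rfl] at h5
        rw [h3.unique h5 h4, lt_succ_eq_le]
        exact h1
      · rw [jdtState_start, jdtState_start, lt_succ_eq_le]
        have := ins_inv hA hk ha (h := b + 1) (by omega)
        rw [insState_start, lt_succ_eq_le] at this
        refine commRel_self this fun l hl => ?_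
        have := hb.2
        change A (b + 1) l + 1 ≠ A (b + 1) b
        rw [FirstRow.succ hA hb hl]
        omega
    | succ h hh ih =>
      have hbh : b < h := by omega
      have hCi := (ins_inv hC hkC ha (h := h) hh).congr (x' := jdtApp (A h) (jdtState b A h))
        (fun l m hl hm => lt_trans hl hm) fun l hl => jdtSeq_apply hbh hl
      obtain ⟨σ, p, h1, h2, h3⟩ := commRel_step (hA.row h) (hk h) (hk.le h) (ins_inv hA hk ha hh)
        (jdt_inv hA hb hbh) (ins_step hA hk ha hh) (jdt_step hA hb hbh) hCi ih
      have h2' := h2.congr (u' := jdtSeq b A h) (v' := jdtSeq b A (h + 1)) hCi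
        (fun l hl => (jdtSeq_apply hbh hl).symm)
        fun l hl => (jdtSeq_apply (by omega) (by omega)).symm
      have h3' := h3.congr (u' := insSeq k a A h) (v' := insSeq k a A (h + 1)) (jdt_inv hB hbB hbh).1
        (fun l hl => (insSeq_apply hh hl).symm)
        fun l hl => (insSeq_apply (by omega) (by omega)).symm
      rw [(ins_step hC hkC ha hh).unique (hC.row h) h2', (jdt_step hB hbB hbh).unique (hB.row h) h3',
        lt_succ_eq_le]
      exact h1
  funext h l
  rcases Nat.lt_or_ge l h with hl | hl
  · rcases Nat.lt_or_ge a h with hh | hh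
    · have hbh : b < h := by omega
      rw [jdtSeq_apply hbh hl, insSeq_apply hh hl]
      have h1 := commRel_eq (hrel h hh) (ins_inv hA hk ha hh) (jdt_inv hA hb hbh) (hk h)
        (fun l m hl hm => hA.inj hl hm) l hl
      have hcong1 : ∀ l, l < h → insSeq k a A h l = insApp (A h) (insState k a A h) l :=
        fun l hl => insSeq_apply hh hl
      have hcong2 : ∀ l, l < h → jdtSeq b A h l = jdtApp (A h) (jdtState b A h) l :=
        fun l hl => jdtSeq_apply hbh hl
      have hp := (jdt_inv hB hbB hbh).1
      have hi := ins_inv hC hkC ha hh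
      generalize jdtState b (insSeq k a A) h = p at *
      generalize insState k a (jdtSeq b A) h = σ at *
      have e1 : jdtApp (insSeq k a A h) p l = jdtApp (insApp (A h) (insState k a A h)) p l := by
        simp only [jdtApp]
        rw [hcong1 p hp, hcong1 l hl]
      have e2 : insApp (jdtSeq b A h) σ l = insApp (jdtApp (A h) (jdtState b A h)) σ l := by
        obtain ⟨e, f⟩ := σ
        cases f with
        | none =>
          simp only [insApp]
          rw [hcong2 e hi.1, hcong2 l hl]
        | some f =>
          simp only [insApp]
          rw [hcong2 e hi.1, hcong2 l hl, hcong2 f hi.2.2.2.1]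
      rw [e1, e2, h1]
    · rw [insSeq_of_le hC hh]
      rcases Nat.lt_or_ge b h with hbh | hbh
      · rw [jdtSeq_apply hbh hl, jdtSeq_apply hbh hl, hlow h hbh hh, insSeq_of_le hA hh]
      · rw [jdtSeq_of_le hA hbh, jdtSeq_of_le hB hbh, insSeq_of_le hA hh]
  · rw [hC.zero |> fun _ => (insSeq_valid hC hkC ha).zero h l hl, (jdtSeq_valid hB hbB).zero h l hl]

theorem insSeq_firstRow {k a : ℕ} {A : ℕ → ℕ → ℕ} (hA : Valid A)
    (hid : ∀ h l, h ≤ a + 1 → l < h → A h l = l) : FirstRow a (insSeq k a A) := by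
  refine ⟨fun h l hh hl => by rw [insSeq_of_le hA hh, hid h l (by omega) hl], ?_⟩
  rw [insSeq_apply (by omega) (by omega), insState_start]
  simp [insApp, hid (a + 1) a le_rfl (by omega)]

/-- Starting from the identity, the columns to the left of the inserted label are always solidly
filled by labels below `k`. So jeu de taquin tracks exactly that label and moves it back on every
line. -/
theorem jdt_ins_cancel {k a : ℕ} {A : ℕ → ℕ → ℕ} (hA : Valid A) (hk : KIncAll k A) (ha : a < k)
    (hid : ∀ h l, h ≤ a + 1 → l < h → A h l = l) : jdtSeq a (insSeq k a A) = A := by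
  have hB := insSeq_valid hA hk ha
  have hbB := insSeq_firstRow (k := k) hA hid
  have key : ∀ h, a < h →
      (∀ c, c ≤ A h (insState k a A h).1 → ∃ l, l < h ∧ l < k ∧ A h l = c) ∧
      (∀ f', (insState k a A h).2 = some f' → A h f' = A h (insState k a A h).1 + 1) ∧
      jdtState a (insSeq k a A) h = (insState k a A h).1 := by
    intro h hh
    induction h, hh using Nat.le_induction with
    | base =>
      rw [insState_start, jdtState_start]
      refine ⟨fun c hc => ⟨c, ?_⟩, by simp, rfl⟩
      simp only [hid (a + 1) a le_rfl (by omega)] at hc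
      exact ⟨by omega, by omega, hid _ _ le_rfl (by omega)⟩
    | succ h hh ih =>
      obtain ⟨h1, h2, h3⟩ := ih
      obtain ⟨g1, g2, g3⟩ := jdtStep_insApp (hA.row h) (hk h) (hk.le h) (ins_inv hA hk ha hh)
        (ins_step hA hk ha hh) h1 h2
      have hst := jdt_step hB hbB hh
      have hp := (jdt_inv hB hbB hh).1
      rw [h3] at hst hp
      have g3' := g3.congr (u' := insSeq k a A h) (v' := insSeq k a A (h + 1)) hp
        (fun l hl => (insSeq_apply hh hl).symm)
        fun l hl => (insSeq_apply (by omega) (by omega)).symm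
      refine ⟨fun c hc => ?_, g2, hst.unique (hB.row h) g3'⟩
      obtain ⟨l, hl, hl'⟩ := g1 c hc
      exact ⟨l, by omega, hl'⟩
  funext h l
  rcases Nat.lt_or_ge l h with hl | hl
  · rcases Nat.lt_or_ge a h with hh | hh
    · obtain ⟨h1, h2, h3⟩ := key h hh
      have hp := (jdt_inv hB hbB hh).1
      have hi := ins_inv hA hk ha hh
      rw [jdtSeq_apply hh hl]
      have := jdtApp_insApp_self hi (fun l m hl hm => hA.inj hl hm) h2 l hl
      rw [h3] at hp ⊢
      rw [← this]
      simp only [jdtApp]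
      rw [insSeq_apply hh hp, insSeq_apply hh hl]
    · rw [jdtSeq_of_le hB hh, insSeq_of_le hA hh]
  · rw [hA.zero h l hl, (jdtSeq_valid hB hbB).zero h l hl]

/-! ### Tiles of a row in which bumps may occur. -/

/-- `RowOK`, but allowing bumps. -/
def WRow (s : ℕ) (u v : ℕ → ℕ) : Prop :=
  (∀ l, l < s → v l ≤ u l) ∧ ∀ l m, l < m → m ≤ s →
    (u l < v m ∨ (m < s ∧ u m < v l) ∨ (v l = u l ∧ v m < v l ∧ (m = s ∨ v l < u m)) ∨
      (m < s ∧ v l = u m ∧ v l < u l ∧ v m < u m) ∨ (v m = u l ∧ v l < u l ∧ (m = s ∨ v m < u m)))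

theorem RowOK.wrow {s : ℕ} {u v : ℕ → ℕ} (h : RowOK s u v) : WRow s u v :=
  ⟨h.1, fun l m hl hm => by have := h.2 l m hl hm; omega⟩

theorem WRow.pair {s : ℕ} {u v : ℕ → ℕ} (h : WRow s u v) (l m : ℕ) (hl : l ≤ s) (hm : m ≤ s) :
    (l = m ∧ v l = v m ∧ u l = u m) ∨
    (l < m ∧ (u l < v m ∨ (m < s ∧ u m < v l) ∨ (v l = u l ∧ v m < v l ∧ (m = s ∨ v l < u m)) ∨
      (m < s ∧ v l = u m ∧ v l < u l ∧ v m < u m) ∨ (v m = u l ∧ v l < u l ∧ (m = s ∨ v m < u m)))) ∨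
    (m < l ∧ (u m < v l ∨ (l < s ∧ u l < v m) ∨ (v m = u m ∧ v l < v m ∧ (l = s ∨ v m < u l)) ∨
      (l < s ∧ v m = u l ∧ v m < u m ∧ v l < u l) ∨ (v l = u m ∧ v m < u m ∧ (l = s ∨ v l < u l)))) := by
  rcases lt_trichotomy l m with h1 | h1 | h1
  · exact Or.inr (Or.inl ⟨h1, h.2 l m h1 hm⟩)
  · exact Or.inl ⟨h1, by rw [h1], by rw [h1]⟩
  · exact Or.inr (Or.inr ⟨h1, h.2 m l h1 hl⟩)

section
variable (s : ℕ) (u v : ℕ → ℕ) (c l : ℕ)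

/-- The pipe `l` runs horizontally through column `c`. -/
def Thru : Prop := l ≤ s ∧ v l < c ∧ (l = s ∨ c < u l)

/-- The pipe `l` turns from south to east in column `c`. -/
def Rt : Prop := l ≤ s ∧ v l = c ∧ (l = s ∨ c < u l)

/-- The pipe `l` turns from west to north in column `c`. -/
def Jt : Prop := l < s ∧ v l < c ∧ u l = c

/-- The pipe `l` runs vertically through column `c`. -/
def Vt : Prop := l < s ∧ v l = c ∧ u l = c

end

open Classical in
/-- The tile in column `c` of the row `s` with top columns `u` and bottom columns `v`. -/
noncomputable def rowTile (s : ℕ) (u v : ℕ → ℕ) (c : ℕ) : Tile :=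
  if ∃ l, Thru s u v c l then (if ∃ l, Vt s u v c l then Tile.cross else Tile.horiz)
  else if ∃ l, Rt s u v c l then (if ∃ l, Jt s u v c l then Tile.bump else Tile.rturn)
  else if ∃ l, Jt s u v c l then Tile.jturn
  else if ∃ l, Vt s u v c l then Tile.vert else Tile.blank

/-- The tiling encoded by a sequence of columns. -/
noncomputable def tilingOf (Z : ℕ → ℕ → ℕ) : Tiling := fun s c => rowTile s (Z s) (Z (s + 1)) c

/-- The tile in column `c` of a row, with the pipes running through it. -/
inductive IsTile (s : ℕ) (u v : ℕ → ℕ) (c : ℕ) : Tile → Prop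
  | cross (l m : ℕ) (hl : Thru s u v c l) (hm : Vt s u v c m) : IsTile s u v c Tile.cross
  | horiz (l : ℕ) (hl : Thru s u v c l) (hm : ∀ m, ¬ Vt s u v c m) : IsTile s u v c Tile.horiz
  | bump (l m : ℕ) (hl : Rt s u v c l) (hm : Jt s u v c m) : IsTile s u v c Tile.bump
  | rturn (l : ℕ) (hl : Rt s u v c l) (hm : ∀ m, ¬ Jt s u v c m) : IsTile s u v c Tile.rturn
  | jturn (l : ℕ) (hl : Jt s u v c l) (hm : ∀ m, ¬ Rt s u v c m) : IsTile s u v c Tile.jturn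
  | vert (l : ℕ) (hl : Vt s u v c l) (hm : ∀ m, ¬ Thru s u v c m) : IsTile s u v c Tile.vert
  | blank (h : ∀ l, l ≤ s → ¬ (v l ≤ c ∧ (l = s ∨ c ≤ u l))) : IsTile s u v c Tile.blank

section
variable {s : ℕ} {u v : ℕ → ℕ} {c : ℕ} (hw : WRow s u v)
include hw

theorem WRow.inj {l m : ℕ} (hl : l ≤ s) (hm : m ≤ s) (he : v l = v m) : l = m := by
  have h1 := hw.1 l
  have h2 := hw.1 m
  have := hw.pair l m hl hm
  omega

theorem WRow.inj_top {l m : ℕ} (hl : l < s) (hm : m < s) (he : u l = u m) : l = m := by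
  have h1 := hw.1 l
  have h2 := hw.1 m
  have := hw.pair l m hl.le hm.le
  omega

/-- A west edge belongs to at most one pipe. -/
theorem WRow.inj_west {l m : ℕ} (hl : l ≤ s) (hm : m ≤ s) (hvl : v l < c) (hvm : v m < c)
    (hul : l = s ∨ c ≤ u l) (hum : m = s ∨ c ≤ u m) : l = m := by
  have h1 := hw.1 l
  have h2 := hw.1 m
  have := hw.pair l m hl hm
  omega

theorem isTile_rowTile : IsTile s u v c (rowTile s u v c) := by
  unfold rowTile
  split_ifs with h1 h2 h3 h4 h5 h6
  · obtain ⟨l, hl⟩ := h1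
    obtain ⟨m, hm⟩ := h2
    exact .cross l m hl hm
  · obtain ⟨l, hl⟩ := h1
    exact .horiz l hl fun m hm => h2 ⟨m, hm⟩
  · obtain ⟨l, hl⟩ := h3
    obtain ⟨m, hm⟩ := h4
    exact .bump l m hl hm
  · obtain ⟨l, hl⟩ := h3
    exact .rturn l hl fun m hm => h4 ⟨m, hm⟩
  · obtain ⟨l, hl⟩ := h5
    exact .jturn l hl fun m hm => h3 ⟨m, hm⟩
  · obtain ⟨l, hl⟩ := h6
    exact .vert l hl fun m hm => h1 ⟨m, hm⟩
  · refine .blank fun l hl hc => ?_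
    have g1 : ¬ Thru s u v c l := fun h => h1 ⟨l, h⟩
    have g2 : ¬ Rt s u v c l := fun h => h3 ⟨l, h⟩
    have g3 : ¬ Jt s u v c l := fun h => h5 ⟨l, h⟩
    have g4 : ¬ Vt s u v c l := fun h => h6 ⟨l, h⟩
    have := hw.1 l
    unfold Thru at g1
    unfold Rt at g2
    unfold Jt at g3
    unfold Vt at g4
    omega

theorem IsTile.eq {t : Tile} (h : IsTile s u v c t) : rowTile s u v c = t := by
  have hp := hw.pair
  have h1 := hw.1
  unfold rowTile
  cases h with
  | cross l m hl hm => rw [if_pos ⟨l, hl⟩, if_pos ⟨m, hm⟩]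
  | horiz l hl hm => rw [if_pos ⟨l, hl⟩, if_neg (fun ⟨m, h⟩ => hm m h)]
  | bump l m hl hm =>
    rw [if_neg, if_pos ⟨l, hl⟩, if_pos ⟨m, hm⟩]
    rintro ⟨t, ht⟩
    have := hp l t hl.1 ht.1
    unfold Thru at ht
    unfold Rt at hl
    have := h1 t
    omega
  | rturn l hl hm =>
    rw [if_neg, if_pos ⟨l, hl⟩, if_neg (fun ⟨m, h⟩ => hm m h)]
    rintro ⟨t, ht⟩
    have := hp l t hl.1 ht.1
    unfold Thru at ht
    unfold Rt at hl
    have := h1 t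
    omega
  | jturn l hl hm =>
    rw [if_neg, if_neg (fun ⟨m, h⟩ => hm m h), if_pos ⟨l, hl⟩]
    rintro ⟨t, ht⟩
    have := hp l t hl.1.le ht.1
    unfold Thru at ht
    unfold Jt at hl
    have := h1 t
    omega
  | vert l hl hm =>
    rw [if_neg (fun ⟨m, h⟩ => hm m h), if_neg, if_neg, if_pos ⟨l, hl⟩]
    · rintro ⟨t, ht⟩
      have := hp l t hl.1.le ht.1.le
      unfold Jt at ht
      unfold Vt at hl
      omega
    · rintro ⟨t, ht⟩
      have := hp l t hl.1.le ht.1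
      unfold Rt at ht
      unfold Vt at hl
      omega
  | blank h =>
    rw [if_neg, if_neg, if_neg, if_neg]
    · rintro ⟨l, hl⟩
      unfold Vt at hl
      have := h l
      omega
    · rintro ⟨l, hl⟩
      unfold Jt at hl
      have := h l
      omega
    · rintro ⟨l, hl⟩
      unfold Rt at hl
      have := h l
      omega
    · rintro ⟨l, hl⟩
      unfold Thru at hl
      have := h l
      omega

theorem hasW_rowTile : (rowTile s u v c).hasW ↔ ∃ l, l ≤ s ∧ v l < c ∧ (l = s ∨ c ≤ u l) := by
  have h := isTile_rowTile (c := c) hw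
  have hp := hw.pair
  have h1 := hw.1
  generalize rowTile s u v c = t at h
  cases h with
  | cross l m hl hm => simp only [Tile.hasW, true_iff]; exact ⟨l, hl.1, hl.2.1, hl.2.2.imp_right le_of_lt⟩
  | horiz l hl hm => simp only [Tile.hasW, true_iff]; exact ⟨l, hl.1, hl.2.1, hl.2.2.imp_right le_of_lt⟩
  | bump l m hl hm => simp only [Tile.hasW, true_iff]; exact ⟨m, hm.1.le, hm.2.1, Or.inr hm.2.2.ge⟩
  | jturn m hm => simp only [Tile.hasW, true_iff]; exact ⟨m, hm.1.le, hm.2.1, Or.inr hm.2.2.ge⟩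
  | rturn l hl hm =>
    simp only [Tile.hasW, false_iff]
    rintro ⟨m, h⟩
    have := hm m
    have := hp l m hl.1 h.1
    have := h1 m
    unfold Rt Jt at *
    omega
  | vert l hl hm =>
    simp only [Tile.hasW, false_iff]
    rintro ⟨m, h⟩
    have := hm m
    have := hp l m hl.1.le h.1
    unfold Vt Thru at *
    omega
  | blank h =>
    simp only [Tile.hasW, false_iff]
    rintro ⟨m, h'⟩
    have := h m
    omega

theorem hasE_rowTile : (rowTile s u v c).hasE ↔ ∃ l, l ≤ s ∧ v l ≤ c ∧ (l = s ∨ c < u l) := by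
  have h := isTile_rowTile (c := c) hw
  have hp := hw.pair
  have h1 := hw.1
  generalize rowTile s u v c = t at h
  cases h with
  | cross l m hl hm => simp only [Tile.hasE, true_iff]; exact ⟨l, hl.1, hl.2.1.le, hl.2.2⟩
  | horiz l hl hm => simp only [Tile.hasE, true_iff]; exact ⟨l, hl.1, hl.2.1.le, hl.2.2⟩
  | bump l m hl hm => simp only [Tile.hasE, true_iff]; exact ⟨l, hl.1, hl.2.1.le, hl.2.2⟩
  | rturn l hl => simp only [Tile.hasE, true_iff]; exact ⟨l, hl.1, hl.2.1.le, hl.2.2⟩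
  | jturn l hl hm =>
    simp only [Tile.hasE, false_iff]
    rintro ⟨m, h⟩
    have := hm m
    have := hp l m hl.1.le h.1
    have := h1 m
    unfold Rt Jt at *
    omega
  | vert l hl hm =>
    simp only [Tile.hasE, false_iff]
    rintro ⟨m, h⟩
    have := hm m
    have := hp l m hl.1.le h.1
    unfold Vt Thru at *
    omega
  | blank h =>
    simp only [Tile.hasE, false_iff]
    rintro ⟨m, h'⟩
    have := h m
    omega

theorem hasN_rowTile : (rowTile s u v c).hasN ↔ ∃ l, l < s ∧ u l = c := by
  have h := isTile_rowTile (c := c) hw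
  have hp := hw.pair
  have h1 := hw.1
  generalize rowTile s u v c = t at h
  cases h with
  | cross l m hl hm => simp only [Tile.hasN, true_iff]; exact ⟨m, hm.1, hm.2.2⟩
  | bump l m hl hm => simp only [Tile.hasN, true_iff]; exact ⟨m, hm.1, hm.2.2⟩
  | jturn m hm => simp only [Tile.hasN, true_iff]; exact ⟨m, hm.1, hm.2.2⟩
  | vert m hm => simp only [Tile.hasN, true_iff]; exact ⟨m, hm.1, hm.2.2⟩
  | horiz l hl hm =>
    simp only [Tile.hasN, false_iff]
    rintro ⟨m, h⟩
    have := hm m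
    have := hp l m hl.1 h.1.le
    have := h1 m
    unfold Thru Vt at *
    omega
  | rturn l hl hm =>
    simp only [Tile.hasN, false_iff]
    rintro ⟨m, h⟩
    have := hm m
    have := hp l m hl.1 h.1.le
    have := h1 m
    unfold Rt Jt at *
    omega
  | blank h =>
    simp only [Tile.hasN, false_iff]
    rintro ⟨m, h'⟩
    have := h m
    have := h1 m
    omega

theorem hasS_rowTile : (rowTile s u v c).hasS ↔ ∃ l, l ≤ s ∧ v l = c := by
  have h := isTile_rowTile (c := c) hw
  have hp := hw.pair
  have h1 := hw.1
  generalize rowTile s u v c = t at h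
  cases h with
  | cross l m hl hm => simp only [Tile.hasS, true_iff]; exact ⟨m, hm.1.le, hm.2.1⟩
  | bump l m hl hm => simp only [Tile.hasS, true_iff]; exact ⟨l, hl.1, hl.2.1⟩
  | rturn l hl => simp only [Tile.hasS, true_iff]; exact ⟨l, hl.1, hl.2.1⟩
  | vert m hm => simp only [Tile.hasS, true_iff]; exact ⟨m, hm.1.le, hm.2.1⟩
  | horiz l hl hm =>
    simp only [Tile.hasS, false_iff]
    rintro ⟨m, h⟩
    have := hm m
    have := hp l m hl.1 h.1
    have := h1 m
    unfold Thru Vt at *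
    omega
  | jturn l hl hm =>
    simp only [Tile.hasS, false_iff]
    rintro ⟨m, h⟩
    have := hm m
    have := hp l m hl.1.le h.1
    have := h1 m
    unfold Rt Jt at *
    omega
  | blank h =>
    simp only [Tile.hasS, false_iff]
    rintro ⟨m, h'⟩
    have := h m
    have := h1 m
    omega

end

/-! ### Pipes of the tiling: exit rows versus bottom columns. -/

/-- Sequences of columns of tilings that may contain bumps and are eventually constant. -/
structure WSeq (N : ℕ) (Z : ℕ → ℕ → ℕ) : Prop where
  row : ∀ s, WRow s (Z s) (Z (s + 1))
  const : ∀ h l, N ≤ h → l < h → Z (h + 1) l = Z h l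
  lt : ∀ h l, N ≤ h → l < h → Z h l < h
  new : ∀ h, N ≤ h → Z (h + 1) h = h

/-- The column in which the pipe exiting along row `l` comes up from the bottom. -/
def bottomCol (N : ℕ) (Z : ℕ → ℕ → ℕ) (l : ℕ) : ℕ := Z (max N (l + 1)) l

section
variable {N : ℕ} {Z : ℕ → ℕ → ℕ} (hZ : WSeq N Z)
include hZ

theorem WSeq.inj {h l m : ℕ} (hl : l < h) (hm : m < h) (he : Z h l = Z h m) : l = m := by
  cases h with
  | zero => omega
  | succ s => exact (hZ.row s).inj (by omega) (by omega) he

theorem WSeq.eq_bottomCol {h l : ℕ} (hl : l < h) (hN : N ≤ h) : Z h l = bottomCol N Z l := by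
  induction h, (show max N (l + 1) ≤ h by omega) using Nat.le_induction with
  | base => rfl
  | succ h hh ih => rw [hZ.const h l (by omega) (by omega), ih (by omega) (by omega)]

theorem WSeq.bottomCol_inj {l m : ℕ} (h : bottomCol N Z l = bottomCol N Z m) : l = m := by
  have h1 := hZ.eq_bottomCol (h := N + l + m + 1) (l := l) (by omega) (by omega)
  have h2 := hZ.eq_bottomCol (h := N + l + m + 1) (l := m) (by omega) (by omega)
  exact hZ.inj (h := N + l + m + 1) (by omega) (by omega) (by rw [h1, h2, h])

/-- The pipe exiting along row `l` enters the tile at `(i, j)` from the given side. -/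
def EnterLabel (Z : ℕ → ℕ → ℕ) (l : ℕ) : Side → ℕ → ℕ → Prop
  | Side.south, i, j => l ≤ i ∧ Z (i + 1) l = j
  | Side.west, i, j => l ≤ i ∧ Z (i + 1) l < j ∧ (l = i ∨ j ≤ Z i l)

theorem enterLabel_of_enters {p : ℕ} {sd : Side} {i j : ℕ} (h : Enters (tilingOf Z) p sd i j) :
    ∃ l, bottomCol N Z l = p ∧ EnterLabel Z l sd i j := by
  induction h with
  | base i h =>
    have hv : ∀ i', i < i' → ∃ l, l < i' ∧ Z i' l = p ∧ Z (i' + 1) l = p := by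
      intro i' hi'
      have h1 := isTile_rowTile (c := p) (hZ.row i')
      have h2 := h i' hi'
      unfold tilingOf at h2
      rw [h2] at h1
      cases h1 with
      | vert l hl => exact ⟨l, hl.1, hl.2.2, hl.2.1⟩
    obtain ⟨l, hl, hlp, -⟩ := hv (i + 1) (by omega)
    -- Each vertical tile provides a label of its own; injectivity on the common line shows that
    -- they are all the same.
    have hall : ∀ h, i + 1 ≤ h → Z h l = p := by
      intro h hh
      induction h, hh using Nat.le_induction with
      | base => exact hlp
      | succ h hh ih =>
        obtain ⟨m, hm, hm1, hm2⟩ := hv h (by omega)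
        rwa [hZ.inj (h := h) (l := l) (m := m) (by omega) hm (by omega)]
    refine ⟨l, ?_, by omega, hlp⟩
    rw [← hall (N + i + 1) (by omega)]
    exact (hZ.eq_bottomCol (by omega) (by omega)).symm
  | up sd i j h hx ih =>
    obtain ⟨l, hl, hE⟩ := ih
    refine ⟨l, hl, ?_⟩
    have hw := hZ.row (i + 1)
    have h1 := isTile_rowTile (c := j) hw
    unfold tilingOf at hx
    cases sd with
    | south =>
      obtain ⟨hE1, hE2⟩ := hE
      rcases hx with hx | hx <;> rw [hx] at h1 <;> cases h1
      all_goals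
        rename_i m hm _
        first
        | obtain rfl := hw.inj hE1 hm.1.le (hE2.trans hm.2.1.symm)
          exact ⟨by have := hm.1; omega, hm.2.2⟩
        | rename_i hm
          obtain rfl := hw.inj hE1 hm.1.le (hE2.trans hm.2.1.symm)
          exact ⟨by have := hm.1; omega, hm.2.2⟩
    | west =>
      obtain ⟨hE1, hE2, hE3⟩ := hE
      rcases hx with hx | hx <;> rw [hx] at h1
      · cases h1 with
        | jturn m hm =>
          obtain rfl := hw.inj_west hE1 hm.1.le hE2 hm.2.1 hE3 (Or.inr hm.2.2.ge)
          exact ⟨by have := hm.1; omega, hm.2.2⟩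
      · cases h1 with
        | bump _ m _ hm =>
          obtain rfl := hw.inj_west hE1 hm.1.le hE2 hm.2.1 hE3 (Or.inr hm.2.2.ge)
          exact ⟨by have := hm.1; omega, hm.2.2⟩
  | right sd i j h hx ih =>
    obtain ⟨l, hl, hE⟩ := ih
    refine ⟨l, hl, ?_⟩
    have hw := hZ.row i
    have h1 := isTile_rowTile (c := j) hw
    unfold tilingOf at hx
    cases sd with
    | south =>
      obtain ⟨hE1, hE2⟩ := hE
      rcases hx with hx | hx <;> rw [hx] at h1
      · cases h1 with
        | rturn m hm =>
          obtain rfl := hw.inj hE1 hm.1 (hE2.trans hm.2.1.symm)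
          exact ⟨hE1, by omega, hm.2.2⟩
      · cases h1 with
        | bump m _ hm =>
          obtain rfl := hw.inj hE1 hm.1 (hE2.trans hm.2.1.symm)
          exact ⟨hE1, by omega, hm.2.2⟩
    | west =>
      obtain ⟨hE1, hE2, hE3⟩ := hE
      rcases hx with hx | hx <;> rw [hx] at h1
      · cases h1 with
        | horiz m hm =>
          obtain rfl := hw.inj_west hE1 hm.1 hE2 hm.2.1 hE3 (hm.2.2.imp_right le_of_lt)
          exact ⟨hE1, by omega, hm.2.2⟩
      · cases h1 with
        | cross m _ hm =>
          obtain rfl := hw.inj_west hE1 hm.1 hE2 hm.2.1 hE3 (hm.2.2.imp_right le_of_lt)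
          exact ⟨hE1, by omega, hm.2.2⟩

theorem exitsEast_south {i l : ℕ} (hl : l ≤ i) (hr : l = i ∨ Z (i + 1) l < Z i l) :
    ExitsEast Side.south (tilingOf Z i (Z (i + 1) l)) := by
  have hw := hZ.row i
  have h := isTile_rowTile (c := Z (i + 1) l) hw
  unfold tilingOf
  have hR : Rt i (Z i) (Z (i + 1)) (Z (i + 1) l) l := ⟨hl, rfl, hr⟩
  by_cases hJ : ∃ m, Jt i (Z i) (Z (i + 1)) (Z (i + 1) l) m
  · obtain ⟨m, hm⟩ := hJ
    exact Or.inr ((IsTile.bump l m hR hm).eq hw)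
  · exact Or.inl ((IsTile.rturn l hR fun m hm => hJ ⟨m, hm⟩).eq hw)

theorem exitsEast_west {i l c : ℕ} (hT : Thru i (Z i) (Z (i + 1)) c l) :
    ExitsEast Side.west (tilingOf Z i c) := by
  have hw := hZ.row i
  by_cases hJ : ∃ m, Vt i (Z i) (Z (i + 1)) c m
  · obtain ⟨m, hm⟩ := hJ
    exact Or.inr ((IsTile.cross l m hT hm).eq hw)
  · exact Or.inl ((IsTile.horiz l hT fun m hm => hJ ⟨m, hm⟩).eq hw)

theorem exitsNorth_west {i l c : ℕ} (hT : Jt i (Z i) (Z (i + 1)) c l) :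
    ExitsNorth Side.west (tilingOf Z i c) := by
  have hw := hZ.row i
  by_cases hJ : ∃ m, Rt i (Z i) (Z (i + 1)) c m
  · obtain ⟨m, hm⟩ := hJ
    exact Or.inr ((IsTile.bump m l hm hT).eq hw)
  · exact Or.inl ((IsTile.jturn l hT fun m hm => hJ ⟨m, hm⟩).eq hw)

theorem exitsNorth_south {i l c : ℕ} (hT : Vt i (Z i) (Z (i + 1)) c l) :
    ExitsNorth Side.south (tilingOf Z i c) := by
  have hw := hZ.row i
  by_cases hJ : ∃ m, Thru i (Z i) (Z (i + 1)) c m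
  · obtain ⟨m, hm⟩ := hJ
    exact Or.inr ((IsTile.cross m l hm hT).eq hw)
  · exact Or.inl ((IsTile.vert l hT fun m hm => hJ ⟨m, hm⟩).eq hw)

theorem enters_west_of_south {p i l : ℕ} (hl : l ≤ i)
    (h : Enters (tilingOf Z) p Side.south i (Z (i + 1) l)) {c : ℕ} (hc : Z (i + 1) l < c)
    (hr : l = i ∨ c ≤ Z i l) : Enters (tilingOf Z) p Side.west i c := by
  induction c, hc using Nat.le_induction with
  | base => exact .right _ _ _ h (exitsEast_south hZ hl (by omega))
  | succ c hc ih =>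
    exact .right _ _ _ (ih (by omega)) (exitsEast_west hZ (l := l) ⟨hl, by omega, by omega⟩)

/-- A pipe is followed upwards from the constant region, where it is vertical, so the recursion is
on the distance to line `N`. -/
theorem enters_south {i l : ℕ} (hl : l ≤ i) :
    Enters (tilingOf Z) (bottomCol N Z l) Side.south i (Z (i + 1) l) := by
  by_cases hN : N ≤ i + 1
  · rw [hZ.eq_bottomCol (by omega) hN]
    refine .base i fun i' hi' => ?_
    have h1 := hZ.eq_bottomCol (h := i') (l := l) (by omega) (by omega)
    have h2 := hZ.eq_bottomCol (h := i' + 1) (l := l) (by omega) (by omega)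
    refine (IsTile.vert l ⟨by omega, h2, h1⟩ ?_).eq (hZ.row i')
    rintro m ⟨hm1, hm2, hm3⟩
    have h3 := hZ.lt i' l (by omega) (by omega)
    rcases hm1.lt_or_eq with h | rfl
    · have := hZ.const i' m (by omega) h
      omega
    · have := hZ.new m (by omega)
      omega
  · have ih := enters_south (i := i + 1) (l := l) (by omega)
    rcases ((hZ.row (i + 1)).1 l (by omega)).lt_or_eq with h | h
    · exact .up _ _ _ (enters_west_of_south hZ (by omega) ih h (Or.inr le_rfl))
        (exitsNorth_west hZ (l := l) ⟨by omega, h, rfl⟩)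
    · rw [← h]
      exact .up _ _ _ ih (exitsNorth_south hZ (l := l) ⟨by omega, rfl, h.symm⟩)
termination_by N - i

theorem enters_iff {p : ℕ} {sd : Side} {i j : ℕ} : Enters (tilingOf Z) p sd i j ↔
    ∃ l, bottomCol N Z l = p ∧ EnterLabel Z l sd i j := by
  refine ⟨enterLabel_of_enters hZ, ?_⟩
  rintro ⟨l, rfl, h⟩
  cases sd with
  | south =>
    obtain ⟨h1, rfl⟩ := h
    exact enters_south hZ h1
  | west =>
    obtain ⟨h1, h2, h3⟩ := h
    exact enters_west_of_south hZ h1 (enters_south hZ h1) h2 h3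

theorem enters_label_iff {l : ℕ} {sd : Side} {i j : ℕ} :
    Enters (tilingOf Z) (bottomCol N Z l) sd i j ↔ EnterLabel Z l sd i j := by
  rw [enters_iff hZ]
  constructor
  · rintro ⟨m, hm, h⟩
    rwa [← hZ.bottomCol_inj hm]
  · exact fun h => ⟨l, rfl, h⟩

theorem exitsRow_iff {p r : ℕ} : ExitsRow (tilingOf Z) p r ↔ bottomCol N Z r = p := by
  constructor
  · rintro ⟨J, hJ⟩
    -- The chosen column is beyond `J` and beyond the top columns of all pipes that leave row `r` to
    -- the north. A pipe still running there must be the one exiting along row `r`.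
    obtain ⟨l, hl, h1, h2, h3⟩ := (enters_iff hZ).1 (hJ (J + ∑ l ∈ Finset.range r, Z r l + 1) (by omega))
    rcases h3 with rfl | h3
    · exact hl
    · rcases h1.lt_or_eq with h4 | rfl
      · have := Finset.single_le_sum (f := fun l => Z r l) (fun _ _ => Nat.zero_le _) (Finset.mem_range.2 h4)
        omega
      · exact hl
  · rintro rfl
    exact ⟨Z (r + 1) r + 1, fun j hj => (enters_label_iff hZ).2 ⟨le_rfl, by omega, Or.inl rfl⟩⟩

theorem crossAt_iff {p q i j : ℕ} : CrossAt (tilingOf Z) p q i j ↔ ∃ l m, bottomCol N Z l = p ∧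
    bottomCol N Z m = q ∧ ((Vt i (Z i) (Z (i + 1)) j l ∧ Thru i (Z i) (Z (i + 1)) j m) ∨
      (Vt i (Z i) (Z (i + 1)) j m ∧ Thru i (Z i) (Z (i + 1)) j l)) := by
  have hw := hZ.row i
  constructor
  · rintro ⟨h, h2⟩
    have h1 := isTile_rowTile (c := j) hw
    unfold tilingOf at h
    rw [h] at h1
    cases h1 with
    | cross x y hx hy =>
      rw [enters_iff hZ, enters_iff hZ, enters_iff hZ, enters_iff hZ] at h2
      rcases h2 with ⟨⟨l, hl, h3, h4⟩, ⟨m, hm, h5, h6, h7⟩⟩ | ⟨⟨m, hm, h3, h4⟩, ⟨l, hl, h5, h6, h7⟩⟩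
      · obtain rfl := hw.inj h3 hy.1.le (h4.trans hy.2.1.symm)
        obtain rfl := hw.inj_west h5 hx.1 h6 hx.2.1 h7 (hx.2.2.imp_right le_of_lt)
        exact ⟨l, m, hl, hm, Or.inl ⟨hy, hx⟩⟩
      · obtain rfl := hw.inj h3 hy.1.le (h4.trans hy.2.1.symm)
        obtain rfl := hw.inj_west h5 hx.1 h6 hx.2.1 h7 (hx.2.2.imp_right le_of_lt)
        exact ⟨l, m, hl, hm, Or.inr ⟨hy, hx⟩⟩
  · rintro ⟨l, m, rfl, rfl, ⟨h1, h2⟩ | ⟨h1, h2⟩⟩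
    · refine ⟨(IsTile.cross m l h2 h1).eq hw, Or.inl ⟨(enters_label_iff hZ).2 ⟨h1.1.le, h1.2.1⟩,
        (enters_label_iff hZ).2 ⟨h2.1, h2.2.1, h2.2.2.imp_right le_of_lt⟩⟩⟩
    · refine ⟨(IsTile.cross l m h2 h1).eq hw, Or.inr ⟨(enters_label_iff hZ).2 ⟨h1.1.le, h1.2.1⟩,
        (enters_label_iff hZ).2 ⟨h2.1, h2.2.1, h2.2.2.imp_right le_of_lt⟩⟩⟩

theorem crossAt_label_iff {l m i j : ℕ} : CrossAt (tilingOf Z) (bottomCol N Z l) (bottomCol N Z m) i j ↔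
    ((Vt i (Z i) (Z (i + 1)) j l ∧ Thru i (Z i) (Z (i + 1)) j m) ∨
      (Vt i (Z i) (Z (i + 1)) j m ∧ Thru i (Z i) (Z (i + 1)) j l)) := by
  rw [crossAt_iff hZ]
  constructor
  · rintro ⟨l', m', hl, hm, h⟩
    rwa [← hZ.bottomCol_inj hl, ← hZ.bottomCol_inj hm]
  · exact fun h => ⟨l, m, rfl, rfl, h⟩

end

section
variable {s : ℕ} {u v : ℕ → ℕ} {c : ℕ} (hw : WRow s u v)
include hw

theorem WRow.rowTile_cross : rowTile s u v c = Tile.cross ↔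
    ∃ l m, Thru s u v c l ∧ Vt s u v c m := by
  constructor
  · intro h
    have := isTile_rowTile (c := c) hw
    rw [h] at this
    cases this with
    | cross l m hl hm => exact ⟨l, m, hl, hm⟩
  · rintro ⟨l, m, hl, hm⟩
    exact (IsTile.cross l m hl hm).eq hw

theorem WRow.rowTile_rturn : rowTile s u v c = Tile.rturn ↔
    (∃ l, Rt s u v c l) ∧ ∀ m, ¬ Jt s u v c m := by
  constructor
  · intro h
    have := isTile_rowTile (c := c) hw
    rw [h] at this
    cases this with
    | rturn l hl hm => exact ⟨⟨l, hl⟩, hm⟩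
  · rintro ⟨⟨l, hl⟩, hm⟩
    exact (IsTile.rturn l hl hm).eq hw

theorem WRow.rowTile_jturn : rowTile s u v c = Tile.jturn ↔
    (∃ l, Jt s u v c l) ∧ ∀ m, ¬ Rt s u v c m := by
  constructor
  · intro h
    have := isTile_rowTile (c := c) hw
    rw [h] at this
    cases this with
    | jturn l hl hm => exact ⟨⟨l, hl⟩, hm⟩
  · rintro ⟨⟨l, hl⟩, hm⟩
    exact (IsTile.jturn l hl hm).eq hw

theorem WRow.rowTile_bump : rowTile s u v c = Tile.bump ↔
    ∃ l m, Rt s u v c l ∧ Jt s u v c m := by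
  constructor
  · intro h
    have := isTile_rowTile (c := c) hw
    rw [h] at this
    cases this with
    | bump l m hl hm => exact ⟨l, m, hl, hm⟩
  · rintro ⟨l, m, hl, hm⟩
    exact (IsTile.bump l m hl hm).eq hw

theorem WRow.rowTile_blank : rowTile s u v c = Tile.blank ↔
    ∀ l, l ≤ s → ¬ (v l ≤ c ∧ (l = s ∨ c ≤ u l)) := by
  constructor
  · intro h
    have := isTile_rowTile (c := c) hw
    rw [h] at this
    cases this with
    | blank hl => exact hl
  · intro h
    exact (IsTile.blank h).eq hw

end

/-! ### Valid sequences give reduced bumpless pipe dreams. -/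

/-- In a row without bumps the vertical pipe of a crossing exits above the horizontal one. -/
theorem RowOK.lt_of_cross {s : ℕ} {u v : ℕ → ℕ} {c l m : ℕ} (h : RowOK s u v) (hl : Vt s u v c l)
    (hm : Thru s u v c m) : l < m ∧ v m < v l := by
  unfold Vt at hl
  unfold Thru at hm
  rcases h.pair l m hl.1.le hm.1 with rfl | h1 <;> omega

/-- Inversions persist downwards. -/
theorem RowOK.inversion {s : ℕ} {u v : ℕ → ℕ} {l m : ℕ} (h : RowOK s u v) (hlm : l < m) (hm : m < s)
    (hi : u m < u l) : v m < v l := by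
  have := h.2 l m hlm hm.le
  have := h.1 m hm
  omega

theorem inversion_persists {A : ℕ → ℕ → ℕ} {l m h h' : ℕ} (hA : ∀ s, h ≤ s → s < h' → RowOK s (A s) (A (s + 1)))
    (hlm : l < m) (hm : m < h) (hh : h ≤ h') (hi : A h m < A h l) : A h' m < A h' l := by
  induction h', hh using Nat.le_induction with
  | base => exact hi
  | succ s hs ih =>
    exact (hA s hs (by omega)).inversion hlm (by omega) (ih fun t ht ht' => hA t ht (by omega))

theorem KInc.not_cross {k s : ℕ} {u v : ℕ → ℕ} {c l m : ℕ} (h : RowOK s u v) (hk : KInc k (· ≤ s) v)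
    (hmk : m < k) (hl : Vt s u v c l) (hm : Thru s u v c m) : False := by
  have h1 := h.lt_of_cross hl hm
  have := hk l m h1.1 hmk hm.1
  omega

theorem Valid.wseq {n : ℕ} {A : ℕ → ℕ → ℕ} (hA : Valid A) (hn : Bdd n A) : WSeq n A where
  row s := (hA.row s).wrow
  const h l hh hl := hn.const (by omega) hh (by omega) hl
  lt h l hh hl := hn.lt hh hl hl
  new h hh := (hn (h + 1) h (by omega)).2.1 hh

theorem Valid.tilingOf_eq_id {n : ℕ} {A : ℕ → ℕ → ℕ} (hA : Valid A) (hn : Bdd n A) (i j : ℕ)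
    (h : n ≤ i ∨ n ≤ j) : tilingOf A i j = idTiling i j := by
  have hw := (hA.row i).wrow
  unfold tilingOf idTiling
  rcases Nat.lt_or_ge i n with hi | hi
  · rw [if_neg (by omega), if_pos (by omega)]
    have h1 := (hn (i + 1) i (by omega)).1 hi
    refine (IsTile.horiz i ⟨le_rfl, by omega, Or.inl rfl⟩ ?_).eq hw
    rintro m ⟨hm, h2, h3⟩
    have := (hn i m hm).1 (by omega)
    omega
  · have h1 := (hn (i + 1) i (by omega)).2.1 hi
    have h2 : ∀ l, l < i → A (i + 1) l = A i l ∧ A i l < i := fun l hl =>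
      ⟨hn.const (by omega) hi (by omega) hl, hn.lt hi hl hl⟩
    split_ifs with h3 h4
    · refine (IsTile.rturn i ⟨le_rfl, by omega, Or.inl rfl⟩ ?_).eq hw
      rintro m ⟨hm, h5, h6⟩
      have := h2 m hm
      omega
    · refine (IsTile.horiz i ⟨le_rfl, by omega, Or.inl rfl⟩ ?_).eq hw
      rintro m ⟨hm, h5, h6⟩
      have := h2 m hm
      omega
    · obtain ⟨l, hl, he⟩ := hA.surj hn hi (c := j) (by omega)
      refine (IsTile.vert l ⟨hl, by rw [(h2 l hl).1, he], he⟩ ?_).eq hw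
      rintro m ⟨hm, h5, h6⟩
      rcases h6 with rfl | h6
      · omega
      · rcases hm.lt_or_eq with h7 | rfl
        · have := h2 m h7
          omega
        · omega

theorem Valid.isBPD {A : ℕ → ℕ → ℕ} (hA : Valid A) : IsBPD (tilingOf A) where
  no_bump i j h := by
    obtain ⟨l, m, hl, hm⟩ := (hA.row i).wrow.rowTile_bump.1 h
    unfold Rt at hl
    unfold Jt at hm
    rcases (hA.row i).pair l m hl.1 hm.1.le with rfl | h1 <;> omega
  horizontal_match i j := by
    unfold tilingOf
    rw [hasE_rowTile (hA.row i).wrow, hasW_rowTile (hA.row i).wrow]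
    simp only [Nat.lt_succ_iff, Nat.succ_le_iff]
  vertical_match i j := by
    unfold tilingOf
    rw [hasS_rowTile (hA.row i).wrow, hasN_rowTile (hA.row (i + 1)).wrow]
    simp only [Nat.lt_succ_iff]
  top_boundary j := by
    unfold tilingOf
    rw [hasN_rowTile (hA.row 0).wrow]
    rintro ⟨l, hl, -⟩
    omega
  left_boundary i := by
    unfold tilingOf
    rw [hasW_rowTile (hA.row i).wrow]
    rintro ⟨l, -, hl, -⟩
    omega
  finite_support := by
    obtain ⟨n, hn⟩ := hA.bdd
    exact ⟨n, hA.tilingOf_eq_id hn⟩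
  reduced p q i j i' j' h h' := by
    obtain ⟨n, hn⟩ := hA.bdd
    have hZ := hA.wseq hn
    -- A crossing leaves an inversion below it, which persists; a second crossing further down would
    -- need the pair uninverted above it.
    have key : ∀ l m i j i' j', Vt i (A i) (A (i + 1)) j l → Thru i (A i) (A (i + 1)) j m →
        Vt i' (A i') (A (i' + 1)) j' l → Thru i' (A i') (A (i' + 1)) j' m → i' ≤ i := by
      intro l m i j i' j' h1 h2 h3 h4
      by_contra! hlt
      have h5 := (hA.row i).lt_of_cross h1 h2
      have h6 := inversion_persists (A := A) (h := i + 1) (h' := i') (fun s _ _ => hA.row s) h5.1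
        (by have := h2.1; omega) (by omega) h5.2
      unfold Vt at h3
      unfold Thru at h2 h4
      omega
    have main : ∀ l m, Vt i (A i) (A (i + 1)) j l → Thru i (A i) (A (i + 1)) j m →
        Vt i' (A i') (A (i' + 1)) j' l → Thru i' (A i') (A (i' + 1)) j' m → i = i' ∧ j = j' := by
      intro l m h1 h2 h3 h4
      obtain rfl : i = i' := le_antisymm (key l m i' j' i j h3 h4 h1 h2) (key l m i j i' j' h1 h2 h3 h4)
      exact ⟨rfl, h1.2.1.symm.trans h3.2.1⟩
    obtain ⟨l, m, rfl, rfl, hc⟩ := (crossAt_iff hZ).1 h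
    rw [crossAt_label_iff hZ] at h'
    rcases hc with ⟨h1, h2⟩ | ⟨h1, h2⟩ <;> rcases h' with ⟨h3, h4⟩ | ⟨h3, h4⟩
    · exact main _ _ h1 h2 h3 h4
    · have := (hA.row i).lt_of_cross h1 h2
      have := (hA.row i').lt_of_cross h3 h4
      omega
    · have := (hA.row i).lt_of_cross h1 h2
      have := (hA.row i').lt_of_cross h3 h4
      omega
    · exact main _ _ h1 h2 h3 h4

/-- The sequence of columns of the identity. -/
def idSeq (h l : ℕ) : ℕ := if l < h then l else 0

theorem idSeq_bdd : Bdd 0 idSeq := by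
  intro h l hl
  simp [idSeq, hl]

theorem idSeq_valid : Valid idSeq where
  row s := by
    refine ⟨fun l hl => ?_, fun l m hl hm => ?_⟩
    · simp [idSeq, hl, hl.trans (Nat.lt_succ_self s)]
    · simp only [idSeq]
      split_ifs <;> omega
  zero h l hl := by simp [idSeq, hl.not_gt]
  bdd := ⟨0, idSeq_bdd⟩

theorem idSeq_kinc (k : ℕ) : KIncAll k idSeq := by
  intro h l m hl hm hP
  have hP : m < h := hP
  simp only [idSeq]
  split_ifs <;> omega

theorem tilingOf_idSeq : tilingOf idSeq = idTiling := by
  funext i j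
  exact idSeq_valid.tilingOf_eq_id idSeq_bdd i j (Or.inl (Nat.zero_le _))

/-- A tile forgets the names of its pipes. With `π` the identity this gives locality; with `π` a
transposition it shows that exchanging two labels throughout a row does not change its tiles. -/
theorem rowTile_eq_of_kinds {s : ℕ} {u v u' v' : ℕ → ℕ} {c : ℕ} (π : ℕ → ℕ) (hπ : ∀ l, π (π l) = l)
    (h : ∀ l, (Thru s u v c l ↔ Thru s u' v' c (π l)) ∧ (Rt s u v c l ↔ Rt s u' v' c (π l)) ∧
      (Jt s u v c l ↔ Jt s u' v' c (π l)) ∧ (Vt s u v c l ↔ Vt s u' v' c (π l))) :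
    rowTile s u v c = rowTile s u' v' c := by
  have key : ∀ P Q : ℕ → Prop, (∀ l, P l ↔ Q (π l)) → ((∃ l, P l) ↔ ∃ l, Q l) := by
    intro P Q hPQ
    refine ⟨fun ⟨l, hl⟩ => ⟨π l, (hPQ l).1 hl⟩, fun ⟨l, hl⟩ => ⟨π l, (hPQ _).2 ?_⟩⟩
    rwa [hπ]
  have h1 : (∃ l, Thru s u v c l) ↔ ∃ l, Thru s u' v' c l := key _ _ fun l => (h l).1
  have h2 : (∃ l, Rt s u v c l) ↔ ∃ l, Rt s u' v' c l := key _ _ fun l => (h l).2.1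
  have h3 : (∃ l, Jt s u v c l) ↔ ∃ l, Jt s u' v' c l := key _ _ fun l => (h l).2.2.1
  have h4 : (∃ l, Vt s u v c l) ↔ ∃ l, Vt s u' v' c l := key _ _ fun l => (h l).2.2.2
  unfold rowTile
  rw [propext h1, propext h2, propext h3, propext h4]

theorem WRow.congr_top {s : ℕ} {u v u' : ℕ → ℕ} (h : WRow s u v) (hu : ∀ l, l < s → u' l = u l) :
    WRow s u' v := by
  refine ⟨fun l hl => by rw [hu l hl]; exact h.1 l hl, fun l m hl hm => ?_⟩
  rw [hu l (by omega)]
  rcases hm.lt_or_eq with h3 | rfl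
  · rw [hu m h3]; exact h.2 l m hl hm
  · have := h.2 l m hl le_rfl
    omega

/-! ### A droop of width one, tile by tile. -/

section droop
variable {s : ℕ} {u v u' v' : ℕ → ℕ} {e : ℕ}

theorem rowTile_droopNW (hw : WRow s u v) (hw' : WRow s u v') (he : e ≤ s) (hr : e = s ∨ v e < u e)
    (hve : v' e = v e + 1) (hv : ∀ l, l ≤ s → l ≠ e → v' l = v l) :
    rowTile s u v' (v e) = (rowTile s u v (v e)).droopNW := by
  have hR : Rt s u v (v e) e := ⟨he, rfl, hr⟩
  have ht := isTile_rowTile (c := v e) hw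
  have hp := hw.pair
  have h1 := hw.1
  by_cases hJ : ∃ m, Jt s u v (v e) m
  · obtain ⟨m, hm⟩ := hJ
    rw [hw.rowTile_bump.2 ⟨e, m, hR, hm⟩]
    have hme : m ≠ e := by rintro rfl; exact absurd hm.2.1 (lt_irrefl _)
    refine (IsTile.jturn m ⟨hm.1, by rw [hv m hm.1.le hme]; exact hm.2.1, hm.2.2⟩ ?_).eq hw'
    rintro t ⟨ht1, ht2, ht3⟩
    by_cases hte : t = e
    · subst hte
      omega
    · rw [hv t ht1 hte] at ht2
      exact hte (hw.inj ht1 he ht2)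
  · rw [hw.rowTile_rturn.2 ⟨⟨e, hR⟩, fun m hm => hJ ⟨m, hm⟩⟩]
    refine (IsTile.blank ?_).eq hw'
    rintro t ht1 ⟨ht2, ht3⟩
    by_cases hte : t = e
    · subst hte
      omega
    · rw [hv t ht1 hte] at ht2
      have := hp t e ht1 he
      have : ¬ Jt s u v (v e) t := fun h => hJ ⟨t, h⟩
      unfold Jt at this
      omega

theorem rowTile_droopNE (hw : WRow s u v) (hw' : WRow s u v') (he : e ≤ s) (hr : e = s ∨ v e < u e)
    (hno : ∀ l, l ≤ s → v l ≠ v e + 1)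
    (hve : v' e = v e + 1) (hv : ∀ l, l ≤ s → l ≠ e → v' l = v l) :
    rowTile s u v' (v e + 1) = (rowTile s u v (v e + 1)).droopNE := by
  by_cases hJ : e < s ∧ u e = v e + 1
  · have hJ' : Jt s u v (v e + 1) e := ⟨hJ.1, by omega, hJ.2⟩
    rw [hw.rowTile_jturn.2 ⟨⟨e, hJ'⟩, fun m hm => hno m hm.1 hm.2.1⟩]
    refine (IsTile.vert e ⟨hJ.1, hve, hJ.2⟩ ?_).eq hw'
    rintro t ⟨ht1, ht2, ht3⟩
    by_cases hte : t = e
    · subst hte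
      omega
    · rw [hv t ht1 hte] at ht2
      have := hw.pair t e ht1 he
      omega
  · have hT : Thru s u v (v e + 1) e := ⟨he, by omega, by omega⟩
    rw [(IsTile.horiz e hT fun m hm => hno m hm.1.le hm.2.1).eq hw]
    refine (IsTile.rturn e ⟨he, hve, by omega⟩ ?_).eq hw'
    rintro t ⟨ht1, ht2, ht3⟩
    by_cases hte : t = e
    · subst hte
      omega
    · rw [hv t ht1.le hte] at ht2
      have := hw.pair t e ht1.le he
      omega

theorem rowTile_droop_top_of_ne {c : ℕ} (hc : c ≠ v e) (hc' : c ≠ v e + 1)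
    (hve : v' e = v e + 1) (hv : ∀ l, l ≤ s → l ≠ e → v' l = v l) :
    rowTile s u v' c = rowTile s u v c := by
  refine rowTile_eq_of_kinds id (fun _ => rfl) fun l => ?_
  unfold Thru Rt Jt Vt id
  by_cases hl : l = e
  · subst hl
    omega
  · have := hv l
    omega

theorem rowTile_dropVert {m : ℕ} (hw : WRow s u v) (hw' : WRow s u' v') (he : e < s) (hve : v e = u e)
    (hm : Thru s u v (u e) m) (hue' : u' e = u e + 1)
    (hve' : v' e = u e + 1) (hu : ∀ l, l < s → l ≠ e → u' l = u l)
    (hv : ∀ l, l ≤ s → l ≠ e → v' l = v l) :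
    rowTile s u' v' (u e) = (rowTile s u v (u e)).dropVert := by
  rw [hw.rowTile_cross.2 ⟨m, e, hm, he, hve, rfl⟩]
  obtain ⟨h1, h2, h3⟩ := hm
  have hme : m ≠ e := by rintro rfl; omega
  refine (IsTile.horiz m ⟨h1, by rw [hv m h1 hme]; omega, ?_⟩ ?_).eq hw'
  · rcases h3 with h3 | h3
    · exact Or.inl h3
    · rcases h1.lt_or_eq with h4 | h4
      · rw [hu m h4 hme]; omega
      · exact Or.inl h4
  · rintro t ⟨ht1, ht2, ht3⟩
    by_cases hte : t = e
    · subst hte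
      omega
    · rw [hv t ht1.le hte] at ht2
      exact hte (hw.inj ht1.le he.le (by omega))

theorem rowTile_addVert {m : ℕ} (hw : WRow s u v) (hw' : WRow s u' v') (he : e < s) (hve : v e = u e)
    (hm : Thru s u v (u e) m) (hno : ∀ l, l < s → u l ≠ u e + 1) (hue' : u' e = u e + 1)
    (hve' : v' e = u e + 1) (hu : ∀ l, l < s → l ≠ e → u' l = u l)
    (hv : ∀ l, l ≤ s → l ≠ e → v' l = v l) :
    rowTile s u' v' (u e + 1) = (rowTile s u v (u e + 1)).addVert := by
  obtain ⟨h1, h2, h3⟩ := hm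
  have hme : m ≠ e := by rintro rfl; omega
  have h4 := hno m
  rw [(IsTile.horiz m ⟨h1, by omega, by omega⟩ fun t ht => hno t ht.1 ht.2.2).eq hw]
  refine (IsTile.cross m e ⟨h1, by rw [hv m h1 hme]; omega, ?_⟩ ⟨he, hve', hue'⟩).eq hw'
  rcases h1.lt_or_eq with h5 | h5
  · rw [hu m h5 hme]; omega
  · exact Or.inl h5

theorem rowTile_droop_mid_of_ne {c : ℕ} (hc : c ≠ u e) (hc' : c ≠ u e + 1) (he : e < s)
    (hve : v e = u e) (hue' : u' e = u e + 1)
    (hve' : v' e = u e + 1) (hu : ∀ l, l < s → l ≠ e → u' l = u l)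
    (hv : ∀ l, l ≤ s → l ≠ e → v' l = v l) :
    rowTile s u' v' c = rowTile s u v c := by
  refine rowTile_eq_of_kinds id (fun _ => rfl) fun l => ?_
  unfold Thru Rt Jt Vt id
  by_cases hl : l = e
  · subst hl
    omega
  · have := hv l
    have := hu l
    omega

theorem rowTile_droopSW (hw : RowOK s u v) (hw' : WRow s u' v) (he : e < s)
    (hnc : ∀ m, Thru s u v (u e) m → v e ≠ u e) (hue' : u' e = u e + 1)
    (hu : ∀ l, l < s → l ≠ e → u' l = u l) :
    rowTile s u' v (u e) = (rowTile s u v (u e)).droopSW := by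
  rcases (hw.1 e he).lt_or_eq with hlt | heq
  · rw [hw.wrow.rowTile_jturn.2 ⟨⟨e, he, hlt, rfl⟩, ?_⟩]
    · refine (IsTile.horiz e ⟨he.le, hlt, by omega⟩ ?_).eq hw'
      rintro t ⟨ht1, ht2, ht3⟩
      have := hw.pair t e ht1.le he.le
      have := hu t ht1
      have : t = e := by omega
      subst this
      omega
    · rintro t ⟨ht1, ht2, ht3⟩
      have := hw.pair t e ht1 he.le
      have : t = e := by omega
      subst this
      omega
  · rw [(IsTile.vert e ⟨he, heq, rfl⟩ fun m hm => hnc m hm heq).eq hw.wrow]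
    refine (IsTile.rturn e ⟨he.le, heq, by omega⟩ ?_).eq hw'
    rintro t ⟨ht1, ht2, ht3⟩
    by_cases hte : t = e
    · subst hte
      omega
    · rw [hu t ht1 hte] at ht3
      exact hte (hw.wrow.inj_top ht1 he ht3)

theorem not_thru_succ (hw : RowOK s u v) (he : e < s)
    (hnc : ∀ m, Thru s u v (u e) m → v e ≠ u e) (hno : ∀ l, l < s → u l ≠ u e + 1) (m : ℕ) :
    ¬ Thru s u v (u e + 1) m := by
  rintro ⟨h1, h2, h3⟩
  have h4 := hw.1 e he
  have h5 := hw.pair m e h1 he.le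
  have h6 : ¬ (Thru s u v (u e) m ∧ v e = u e) := fun h => hnc m h.1 h.2
  unfold Thru at h6
  by_cases hme : m = e
  · subst hme
    omega
  · omega

theorem rowTile_droopSE (hw : RowOK s u v) (hw' : WRow s u' v) (he : e < s)
    (hnc : ∀ m, Thru s u v (u e) m → v e ≠ u e) (hno : ∀ l, l < s → u l ≠ u e + 1)
    (hue' : u' e = u e + 1) (hu : ∀ l, l < s → l ≠ e → u' l = u l) :
    rowTile s u' v (u e + 1) = (rowTile s u v (u e + 1)).droopSE := by
  have hT := not_thru_succ hw he hnc hno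
  have h1 := hw.1 e he
  have hJ : Jt s u' v (u e + 1) e := ⟨he, by omega, hue'⟩
  by_cases hR : ∃ f, f ≤ s ∧ v f = u e + 1
  · obtain ⟨f, hf, hvf⟩ := hR
    have hfu : f = s ∨ u e + 1 < u f := by
      have := hno f
      have := hw.1 f
      omega
    rw [hw.wrow.rowTile_rturn.2 ⟨⟨f, hf, hvf, hfu⟩, fun m hm => hno m hm.1 hm.2.2⟩]
    have hfe : f ≠ e := by rintro rfl; omega
    refine (IsTile.bump f e ⟨hf, hvf, ?_⟩ hJ).eq hw'
    rcases hf.lt_or_eq with h3 | h3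
    · rw [hu f h3 hfe]; omega
    · exact Or.inl h3
  · rw [hw.wrow.rowTile_blank.2]
    · exact (IsTile.jturn e hJ fun m hm => hR ⟨m, hm.1, hm.2.1⟩).eq hw'
    · rintro l hl ⟨h2, h3⟩
      have := hT l
      unfold Thru at this
      have := hno l
      exact hR ⟨l, hl, by omega⟩

theorem rowTile_droop_bot_of_ne {c : ℕ} (hc : c ≠ u e) (hc' : c ≠ u e + 1) (he : e < s)
    (hve : v e ≤ u e) (hue' : u' e = u e + 1) (hu : ∀ l, l < s → l ≠ e → u' l = u l) :
    rowTile s u' v c = rowTile s u v c := by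
  refine rowTile_eq_of_kinds id (fun _ => rfl) fun l => ?_
  unfold Thru Rt Jt Vt id
  by_cases hl : l = e
  · subst hl
    omega
  · have := hu l
    omega

end droop

/-! ### Intermediate tilings of the algorithms. -/

/-- The sequence that agrees with `B` down to the line above row `i` and with `A` below it. -/
def splice (i : ℕ) (B A : ℕ → ℕ → ℕ) (h : ℕ) : ℕ → ℕ := if h ≤ i then B h else A h

theorem splice_of_le {i h : ℕ} {B A : ℕ → ℕ → ℕ} (hh : h ≤ i) : splice i B A h = B h := if_pos hh

theorem splice_of_lt {i h : ℕ} {B A : ℕ → ℕ → ℕ} (hh : i < h) : splice i B A h = A h :=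
  if_neg hh.not_ge

theorem tilingOf_splice_of_lt {i s : ℕ} {B A : ℕ → ℕ → ℕ} (hs : s < i) (c : ℕ) :
    tilingOf (splice i B A) s c = rowTile s (B s) (B (s + 1)) c := by
  rw [tilingOf, splice_of_le hs.le, splice_of_le hs]

theorem tilingOf_splice_of_gt {i s : ℕ} {B A : ℕ → ℕ → ℕ} (hs : i < s) (c : ℕ) :
    tilingOf (splice i B A) s c = rowTile s (A s) (A (s + 1)) c := by
  rw [tilingOf, splice_of_lt hs, splice_of_lt (by omega)]

theorem tilingOf_splice_self {i : ℕ} {B A : ℕ → ℕ → ℕ} (c : ℕ) :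
    tilingOf (splice i B A) i c = rowTile i (B i) (A (i + 1)) c := by
  rw [tilingOf, splice_of_le le_rfl, splice_of_lt (by omega)]

theorem splice_wseq {n i : ℕ} {B A : ℕ → ℕ → ℕ} (hA : Valid A) (hn : Bdd n A)
    (hB : ∀ s, s < i → WRow s (B s) (B (s + 1))) (hi : WRow i (B i) (A (i + 1))) :
    WSeq (max n (i + 1)) (splice i B A) where
  row s := by
    rcases lt_trichotomy s i with h | rfl | h
    · rw [splice_of_le h.le, splice_of_le h]; exact hB s h
    · rw [splice_of_le le_rfl, splice_of_lt (by omega)]; exact hi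
    · rw [splice_of_lt h, splice_of_lt (by omega)]; exact (hA.row s).wrow
  const h l hh hl := by
    rw [splice_of_lt (by omega), splice_of_lt (by omega)]
    exact hn.const (by omega) (by omega) (by omega) hl
  lt h l hh hl := by
    rw [splice_of_lt (by omega)]
    exact hn.lt (by omega) hl hl
  new h hh := by
    rw [splice_of_lt (by omega)]
    exact (hn (h + 1) h (by omega)).2.1 (by omega)

/-- Between the corners, `e` runs up column `j` and every tile is a crossing, while column `j + 1`
is free. Shifting `e` by one column on these lines is then exactly what the droop does, and the new
sequence takes over down to row `i₁`. -/
theorem droop_splice {i i₁ e j : ℕ} {A B : ℕ → ℕ → ℕ} (hA : ∀ s, RowOK s (A s) (A (s + 1)))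
    (hB : ∀ s, s < i₁ → RowOK s (B s) (B (s + 1)))
    (hi : WRow i (B i) (A (i + 1))) (hi₁ : WRow i₁ (B i₁) (A (i₁ + 1))) (hii : i < i₁)
    (he : e ≤ i) (hr : e = i ∨ j < B i e) (hj : ∀ h, i < h → h ≤ i₁ → A h e = j)
    (hBe : ∀ h, i < h → h ≤ i₁ → B h e = j + 1)
    (hBl : ∀ h l, i < h → h ≤ i₁ → l < h → l ≠ e → B h l = A h l)
    (hno : ∀ h l, i < h → h ≤ i₁ → l < h → A h l ≠ j + 1)
    (hT : ∀ s, i < s → s < i₁ → ∃ m, Thru s (A s) (A (s + 1)) j m)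
    (hnc : ∀ m, Thru i₁ (A i₁) (A (i₁ + 1)) j m → A (i₁ + 1) e ≠ j) :
    droop (tilingOf (splice i B A)) i j i₁ (j + 1) = tilingOf (splice i₁ B A) := by
  funext s t
  rcases lt_trichotomy s i with hs | rfl | hs
  · rw [tilingOf_splice_of_lt (hs.trans hii)]
    unfold droop
    simp only [show ¬ s = i by omega, show ¬ s = i₁ by omega, show ¬ i < s by omega, false_and,
      and_false, if_false]
    rw [tilingOf_splice_of_lt hs]
  · obtain rfl := hj (s + 1) (by omega) (by omega)
    rw [tilingOf_splice_of_lt hii]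
    have hve := hBe (s + 1) (by omega) (by omega)
    have hv := fun l (hl : l ≤ s) => hBl (s + 1) l (by omega) (by omega) (by omega)
    unfold droop
    simp only [true_and, show ¬ s = i₁ by omega, lt_irrefl, false_and, and_false, if_false]
    split_ifs with h1 h2 h3
    · subst h1
      rw [tilingOf_splice_self]
      exact (rowTile_droopNW hi (hB s hii).wrow he hr hve hv).symm
    · subst h2
      rw [tilingOf_splice_self]
      exact (rowTile_droopNE hi (hB s hii).wrow he hr
        (fun l hl => hno (s + 1) l (by omega) (by omega) (by omega)) hve hv).symm
    · omega
    · rw [tilingOf_splice_self]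
      exact (rowTile_droop_top_of_ne h1 h2 hve hv).symm
  · rcases lt_trichotomy s i₁ with hs₁ | rfl | hs₁
    · obtain rfl := hj s hs hs₁.le
      have hve := hj (s + 1) (by omega) (by omega)
      have hue' := hBe s hs hs₁.le
      have hve' := hBe (s + 1) (by omega) (by omega)
      have hu := fun l (hl : l < s) => hBl s l hs hs₁.le hl
      have hv := fun l (hl : l ≤ s) => hBl (s + 1) l (by omega) (by omega) (by omega)
      obtain ⟨m, hm⟩ := hT s hs hs₁
      rw [tilingOf_splice_of_lt hs₁]
      unfold droop
      simp only [show ¬ s = i by omega, show ¬ s = i₁ by omega, hs, hs₁, and_true, false_and,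
        if_false]
      split_ifs with h1 h2
      · subst h1
        rw [tilingOf_splice_of_gt hs]
        exact (rowTile_dropVert (hA s).wrow (hB s hs₁).wrow (by omega) hve hm hue' hve' hu hv).symm
      · subst h2
        rw [tilingOf_splice_of_gt hs]
        exact (rowTile_addVert (hA s).wrow (hB s hs₁).wrow (by omega) hve hm
          (fun l hl => hno s l hs hs₁.le hl) hue' hve' hu hv).symm
      · rw [tilingOf_splice_of_gt hs]
        exact (rowTile_droop_mid_of_ne h1 h2 (by omega) hve hue' hve' hu hv).symm
    · obtain rfl := hj s hs le_rfl
      have hue' := hBe s hs le_rfl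
      have hu := fun l (hl : l < s) => hBl s l hs le_rfl hl
      have hno' := fun l (hl : l < s) => hno s l hs le_rfl hl
      rw [tilingOf_splice_self]
      unfold droop
      simp only [show ¬ s = i by omega, lt_irrefl, true_and, and_false, false_and, if_false]
      split_ifs with h1 h2 h3
      · subst h1
        rw [tilingOf_splice_of_gt hs]
        exact (rowTile_droopSW (hA s) hi₁ (by omega) hnc hue' hu).symm
      · subst h2
        rw [tilingOf_splice_of_gt hs]
        exact (rowTile_droopSE (hA s) hi₁ (by omega) hnc hno' hue' hu).symm
      · omega
      · rw [tilingOf_splice_of_gt hs]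
        exact (rowTile_droop_bot_of_ne h1 h2 (by omega) ((hA s).1 e (by omega)) hue' hu).symm
    · rw [tilingOf_splice_of_gt hs₁]
      unfold droop
      simp only [show ¬ s = i by omega, show ¬ s = i₁ by omega, show ¬ s < i₁ by omega, false_and,
        and_false, if_false]
      rw [tilingOf_splice_of_gt hs]

theorem Valid.cross_unique {A : ℕ → ℕ → ℕ} (hA : Valid A) {l m i j i' j' : ℕ}
    (h : Vt i (A i) (A (i + 1)) j l ∧ Thru i (A i) (A (i + 1)) j m)
    (h' : Vt i' (A i') (A (i' + 1)) j' l ∧ Thru i' (A i') (A (i' + 1)) j' m) : i = i' ∧ j = j' := by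
  obtain ⟨n, hn⟩ := hA.bdd
  have hZ := hA.wseq hn
  exact hA.isBPD.reduced _ _ i j i' j' ((crossAt_label_iff hZ (l := l) (m := m)).2 (Or.inl h))
    ((crossAt_label_iff hZ).2 (Or.inl h'))

theorem enters_unique {N : ℕ} {Z : ℕ → ℕ → ℕ} (hZ : WSeq N Z) {p q : ℕ} {sd : Side} {i j : ℕ}
    (hp : Enters (tilingOf Z) p sd i j) (hq : Enters (tilingOf Z) q sd i j) : p = q := by
  obtain ⟨l, rfl, hl⟩ := (enters_iff hZ).1 hp
  obtain ⟨m, rfl, hm⟩ := (enters_iff hZ).1 hq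
  suffices l = m by rw [this]
  cases sd with
  | south => exact (hZ.row i).inj hl.1 hm.1 (hl.2.trans hm.2.symm)
  | west => exact (hZ.row i).inj_west hl.1 hm.1 hl.2.1 hm.2.1 hl.2.2 hm.2.2

/-! ### Rows in which the insertion state changes. -/

section steps
variable {k s : ℕ} {u v : ℕ → ℕ}

/-- Shifting only the top end of `e` is legal if `e` is not crossed where it enters the row from
above. The row then has a west-to-north turn or a bump in the new column. -/
theorem insStep_wrow_none {e : ℕ} {σ : ℕ × Option ℕ} (hr : RowOK s u v)
    (hi : InsInv k (· < s) u (e, none)) (hs : InsStep k s u v (e, none) σ)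
    (hnc : ∀ m, Thru s u v (u e) m → v e ≠ u e) : WRow s (insApp u (e, none)) v := by
  obtain ⟨he, hek, hno⟩ := hi
  have he : e < s := he
  have h1 := hr.1
  have key : ∀ m, m ≤ s → m ≠ e → v m < u e → (m = s ∨ u e < u m) → v e ≠ u e :=
    fun m hm hme h2 h3 => hnc m ⟨hm, h2, h3⟩
  have hno' : ∀ m, m < s → u m ≠ u e + 1 := hno
  have hne : ∀ m, m < s → m ≠ e → u m ≠ u e := fun m hm hme h => hme (hr.wrow.inj_top hm he h)
  have happ : ∀ l, (l = e ∧ v l = v e ∧ u l = u e ∧ insApp u (e, none) l = u e + 1) ∨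
      (l ≠ e ∧ insApp u (e, none) l = u l) := by
    intro l
    by_cases hl : l = e
    · left
      subst hl
      simp [insApp]
    · right
      simp [insApp, hl]
  generalize insApp u (e, none) = u' at happ
  refine ⟨fun l hl => ?_, fun l m hl hm => ?_⟩
  · have := happ l
    have := h1 l hl
    omega
  · have h3 := hr.2 l m hl hm
    have h6 := h1 e he
    rcases happ l with ⟨rfl, -, -, h4⟩ | ⟨hle, h4⟩
    · have h5 := (happ m).resolve_left (by omega)
      have h8 := key m hm
      have h10 := hno' m
      have h12 := h1 m
      omega
    · rcases happ m with ⟨rfl, -, -, h5⟩ | ⟨hme, h5⟩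
      · have h9 := hno' l
        have h11 := h1 l
        omega
      · omega

/-- Exchanging only the top ends of two crossing pipes turns their crossing into a bump. -/
theorem insStep_wrow_back {e f : ℕ} (hr : RowOK s u v)
    (hi : InsInv k (· < s) u (e, some f)) (hv : v f < v e) :
    WRow s (insApp u (e, some f)) v := by
  obtain ⟨he, hek, hkf, hf, huf, hno⟩ := hi
  have he : e < s := he
  have hf : f < s := hf
  have h1 := hr.1
  have h2 := hr.2 e f (by omega) hf.le
  have hne : ∀ m, m < s → m ≠ e → u m ≠ u e := fun m hm hme h => hme (hr.wrow.inj_top hm he h)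
  have happ : ∀ l, (l = e ∧ v l = v e ∧ u l = u e ∧ insApp u (e, some f) l = u f) ∨
      (l = f ∧ v l = v f ∧ u l = u f ∧ insApp u (e, some f) l = u e) ∨
      (l ≠ e ∧ l ≠ f ∧ insApp u (e, some f) l = u l) := by
    intro l
    by_cases hl : l = e
    · left
      subst hl
      simp [insApp]
    · right
      by_cases hl' : l = f
      · left
        subst hl'
        simp [insApp, hl]
      · right
        simp [insApp, hl, hl']
  generalize insApp u (e, some f) = u' at happ
  have hve : v e = u e := by
    have := h1 e he
    omega
  clear h2
  refine ⟨fun l hl => ?_, fun l m hl hm => ?_⟩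
  · have := happ l
    have := h1 l hl
    omega
  · have key : ∀ m, m ≤ s → m ≠ e → m ≠ f →
        (m < s ∧ u m < v f) ∨ (u f < v m) ∨ (m < f ∧ v m = u m ∧ v f < v m ∧ v m < v e) := by
      intro m hm hme hmf
      have h3 := hr.pair m f hm hf.le
      have h4 := hno m
      have h5 := hne m
      omega
    have h3 := hr.2 l m hl hm
    rcases happ l with ⟨rfl, -, -, h4⟩ | ⟨rfl, -, -, h4⟩ | ⟨hle, hlf, h4⟩ <;>
      rcases happ m with ⟨rfl, -, -, h5⟩ | ⟨rfl, -, -, h5⟩ | ⟨hme, hmf, h5⟩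
    · omega
    · omega
    · have := key m hm hme hmf
      omega
    · omega
    · omega
    · have := key m hm hme hmf
      omega
    · have := key l (by omega) hle hlf
      omega
    · have := key l (by omega) hle hlf
      omega
    · omega

/-- The label that is moved enters the row in a south-to-east turn. -/
theorem insStep_turn {e : ℕ} {σ : ℕ × Option ℕ} (hr : RowOK s u v)
    (hi : InsInv k (· < s) u σ) (hs : InsStep k s u v σ (e, none)) :
    e ≤ s ∧ (e = s ∨ v e < insApp u σ e) := by
  have h1 := hr.1
  cases hs with
  | pass e₀ _ hf hv hk =>
    obtain ⟨he, -, hno⟩ := hi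
    have he : e₀ < s := he
    have hno : ∀ l, l < s → u l ≠ u e₀ + 1 := hno
    have := h1 e
    have := h1 e₀ he
    refine ⟨hf, ?_⟩
    have hne : e ≠ e₀ := by rintro rfl; omega
    have := hno e
    simp only [insApp, hne, if_false]
    omega
  | stay _ hv =>
    have he : e < s := hi.1
    have := h1 e he
    simp only [insApp, if_true]
    omega
  | back _ f hv =>
    obtain ⟨he, hek, hkf, hf, huf, hno⟩ := hi
    have he : e < s := he
    have := h1 e he
    simp only [insApp, if_true]
    omega

/-- Turning the bump into a crossing exchanges the parts of `e` and `f` below and to the west of it,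
so the labels are exchanged to its left and kept to its right. -/
theorem rowTile_hit {e f : ℕ} {u' v' : ℕ → ℕ} (c : ℕ) (hw' : WRow s u' v') (he : e < s) (hf : f ≤ s)
    (hve : v e ≤ u e) (hvf : v f = u e + 1) (huf : f = s ∨ u e + 1 < u f)
    (hu' : u' e = u e + 1) (hu : ∀ l, l < s → l ≠ e → u' l = u l) (hv'e : v' e = v f) (hv'f : v' f = v e)
    (hv' : ∀ l, l ≤ s → l ≠ e → l ≠ f → v' l = v l) :
    rowTile s u' v' c = if c = u e + 1 then Tile.cross else rowTile s u' v c := by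
  have hef : f ≠ e := by rintro rfl; omega
  have hu'f := hu f
  split_ifs with hc
  · subst hc
    refine (IsTile.cross f e ⟨hf, by omega, by omega⟩ ⟨he, by omega, hu'⟩).eq hw'
  · symm
    rcases Nat.lt_or_ge c (u e + 1) with hlt | hge
    · refine rowTile_eq_of_kinds (Equiv.swap e f) (Equiv.swap_apply_self e f) fun l => ?_
      unfold Thru Rt Jt Vt
      by_cases hl : l = e
      · subst hl
        rw [Equiv.swap_apply_left]
        omega
      · by_cases hl' : l = f
        · subst hl'
          rw [Equiv.swap_apply_right]
          omega
        · rw [Equiv.swap_apply_of_ne_of_ne hl hl']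
          have := hv' l
          have := hu l
          omega
    · refine rowTile_eq_of_kinds id (fun _ => rfl) fun l => ?_
      unfold Thru Rt Jt Vt id
      by_cases hl : l = e
      · subst hl
        omega
      · by_cases hl' : l = f
        · subst hl'
          omega
        · have := hv' l
          have := hu l
          omega

theorem rowTile_swap {e f : ℕ} {u' v' : ℕ → ℕ} (c : ℕ) (he : e < s) (hf : f < s)
    (hu'e : u' e = u f) (hu'f : u' f = u e) (hu' : ∀ l, l < s → l ≠ e → l ≠ f → u' l = u l)
    (hv'e : v' e = v f) (hv'f : v' f = v e) (hv' : ∀ l, l ≤ s → l ≠ e → l ≠ f → v' l = v l) :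
    rowTile s u' v' c = rowTile s u v c := by
  symm
  refine rowTile_eq_of_kinds (Equiv.swap e f) (Equiv.swap_apply_self e f) fun l => ?_
  unfold Thru Rt Jt Vt
  by_cases hl : l = e
  · subst hl
    rw [Equiv.swap_apply_left]
    omega
  · by_cases hl' : l = f
    · subst hl'
      rw [Equiv.swap_apply_right]
      omega
    · rw [Equiv.swap_apply_of_ne_of_ne hl hl']
      have := hv' l
      have := hu' l
      omega

/-- Here the exchange ends: to the right of the old crossing the row still carries exchanged labels,
to its left the original ones. -/
theorem rowTile_back {e f : ℕ} {u' : ℕ → ℕ} (c : ℕ) (hw' : WRow s u' v) (he : e < s) (hf : f < s)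
    (hve : v e = u e) (huf : u e < u f) (hvf : v f < v e)
    (hu'e : u' e = u f) (hu'f : u' f = u e) (hu' : ∀ l, l < s → l ≠ e → l ≠ f → u' l = u l) :
    rowTile s u' v c = if c = v e then Tile.bump else rowTile s u v c := by
  split_ifs with hc
  · subst hc
    exact (IsTile.bump e f ⟨he.le, rfl, by omega⟩ ⟨hf, by omega, by omega⟩).eq hw'
  · symm
    rcases Nat.lt_or_ge c (v e) with hlt | hge
    · refine rowTile_eq_of_kinds id (fun _ => rfl) fun l => ?_
      unfold Thru Rt Jt Vt id
      by_cases hl : l = e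
      · subst hl
        omega
      · by_cases hl' : l = f
        · subst hl'
          omega
        · have := hu' l
          omega
    · refine rowTile_eq_of_kinds (Equiv.swap e f) (Equiv.swap_apply_self e f) fun l => ?_
      unfold Thru Rt Jt Vt
      by_cases hl : l = e
      · subst hl
        rw [Equiv.swap_apply_left]
        omega
      · by_cases hl' : l = f
        · subst hl'
          rw [Equiv.swap_apply_right]
          omega
        · rw [Equiv.swap_apply_of_ne_of_ne hl hl']
          have := hu' l
          omega

end steps

/-! ### Right insertion of tilings is insertion on sequences. -/

theorem insertFrom_iff_of_minDroop {k i j i₁ j₁ : ℕ} {T T₁ E : Tiling}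
    (hmd : ∀ T' x y, MinDroop T i j T' x y ↔ x = i₁ ∧ y = j₁ ∧ T' = T₁) :
    InsertFrom k T i j E ↔
      (T₁ i₁ j₁ = Tile.jturn ∧ ∃ j₂, IsGreatest {c | c < j₁ ∧ T₁ i₁ c = Tile.rturn} j₂ ∧
        InsertFrom k T₁ i₁ j₂ E) ∨
      (T₁ i₁ j₁ = Tile.bump ∧ ∃ p q, Enters T₁ p Side.south i₁ j₁ ∧ Enters T₁ q Side.west i₁ j₁ ∧
        ((∃ c d, CrossAt T₁ p q c d ∧
          InsertFrom k (setTile (setTile T₁ i₁ j₁ Tile.cross) c d Tile.bump) c d E) ∨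
        ((∀ c d, ¬ CrossAt T₁ p q c d) ∧ ∃ r, ExitsRow T₁ p r ∧
          ((r + 1 ≤ k ∧ InsertFrom k T₁ i₁ j₁ E) ∨
            (k < r + 1 ∧ E = setTile T₁ i₁ j₁ Tile.cross))))) := by
  constructor
  · intro h
    cases h with
    | jturn _ T₂ _ _ _ x y j₂ hd ht hj h =>
      obtain ⟨rfl, rfl, rfl⟩ := (hmd _ _ _).1 hd
      exact Or.inl ⟨ht, j₂, hj, h⟩
    | swap _ T₂ _ _ _ x y p q c d hd ht hp hq hc h =>
      obtain ⟨rfl, rfl, rfl⟩ := (hmd _ _ _).1 hd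
      exact Or.inr ⟨ht, p, q, hp, hq, Or.inl ⟨c, d, hc, h⟩⟩
    | pass _ T₂ _ _ _ x y p q r hd ht hp hq hc hr hk h =>
      obtain ⟨rfl, rfl, rfl⟩ := (hmd _ _ _).1 hd
      exact Or.inr ⟨ht, p, q, hp, hq, Or.inr ⟨hc, r, hr, Or.inl ⟨hk, h⟩⟩⟩
    | terminate _ T₂ _ _ x y p q r hd ht hp hq hc hr hk =>
      obtain ⟨rfl, rfl, rfl⟩ := (hmd _ _ _).1 hd
      exact Or.inr ⟨ht, p, q, hp, hq, Or.inr ⟨hc, r, hr, Or.inr ⟨hk, rfl⟩⟩⟩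
  · have hd := (hmd T₁ i₁ j₁).2 ⟨rfl, rfl, rfl⟩
    rintro (⟨ht, j₂, hj, h⟩ | ⟨ht, p, q, hp, hq, ⟨c, d, hc, h⟩ | ⟨hc, r, hr, ⟨hk, h⟩ | ⟨hk, rfl⟩⟩⟩)
    · exact .jturn _ _ _ _ _ _ _ _ hd ht hj h
    · exact .swap _ _ _ _ _ _ _ _ _ _ _ hd ht hp hq hc h
    · exact .pass _ _ _ _ _ _ _ _ _ _ hd ht hp hq hc hr hk h
    · exact .terminate _ _ _ _ _ _ _ _ _ hd ht hp hq hc hr hk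

theorem insertFrom_iff_of_jturn {k i j i₁ j₁ j₂ : ℕ} {T T₁ E : Tiling}
    (hmd : ∀ T' x y, MinDroop T i j T' x y ↔ x = i₁ ∧ y = j₁ ∧ T' = T₁)
    (ht : T₁ i₁ j₁ = Tile.jturn) (hj : IsGreatest {c | c < j₁ ∧ T₁ i₁ c = Tile.rturn} j₂) :
    InsertFrom k T i j E ↔ InsertFrom k T₁ i₁ j₂ E := by
  rw [insertFrom_iff_of_minDroop hmd]
  constructor
  · rintro (⟨-, j₃, hj₃, h⟩ | ⟨hb, -⟩)
    · rwa [hj.unique hj₃]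
    · rw [ht] at hb
      exact absurd hb (by simp)
  · exact fun h => Or.inl ⟨ht, j₂, hj, h⟩

/-- Each edge is used by at most one pipe, and a pipe exits along only one row, so the choice among
the rules is determined by the labels `f` and `e`. -/
theorem insertFrom_iff_of_bump {k i j i₁ j₁ N e f : ℕ} {Z : ℕ → ℕ → ℕ} {T E : Tiling} (hZ : WSeq N Z)
    (hmd : ∀ T' x y, MinDroop T i j T' x y ↔ x = i₁ ∧ y = j₁ ∧ T' = tilingOf Z)
    (hf : Rt i₁ (Z i₁) (Z (i₁ + 1)) j₁ f) (he : Jt i₁ (Z i₁) (Z (i₁ + 1)) j₁ e) :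
    InsertFrom k T i j E ↔
      (∃ c d, CrossAt (tilingOf Z) (bottomCol N Z f) (bottomCol N Z e) c d ∧
        InsertFrom k (setTile (setTile (tilingOf Z) i₁ j₁ Tile.cross) c d Tile.bump) c d E) ∨
      ((∀ c d, ¬ CrossAt (tilingOf Z) (bottomCol N Z f) (bottomCol N Z e) c d) ∧
        ((f < k ∧ InsertFrom k (tilingOf Z) i₁ j₁ E) ∨
          (k ≤ f ∧ E = setTile (tilingOf Z) i₁ j₁ Tile.cross))) := by
  have ht : tilingOf Z i₁ j₁ = Tile.bump := (hZ.row i₁).rowTile_bump.2 ⟨f, e, hf, he⟩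
  have hp : Enters (tilingOf Z) (bottomCol N Z f) Side.south i₁ j₁ :=
    (enters_label_iff hZ).2 ⟨hf.1, hf.2.1⟩
  have hq : Enters (tilingOf Z) (bottomCol N Z e) Side.west i₁ j₁ :=
    (enters_label_iff hZ).2 ⟨he.1.le, he.2.1, Or.inr he.2.2.ge⟩
  rw [insertFrom_iff_of_minDroop hmd]
  constructor
  · rintro (⟨hb, -⟩ | ⟨-, p, q, hp', hq', h⟩)
    · rw [ht] at hb
      exact absurd hb (by simp)
    · obtain rfl := enters_unique hZ hp hp'
      obtain rfl := enters_unique hZ hq hq'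
      rcases h with h | ⟨hc, r, hr, h⟩
      · exact Or.inl h
      · obtain rfl := hZ.bottomCol_inj ((exitsRow_iff hZ).1 hr)
        exact Or.inr ⟨hc, h.imp_right fun h => ⟨by omega, h.2⟩⟩
  · rintro (h | ⟨hc, h⟩)
    · exact Or.inr ⟨ht, _, _, hp, hq, Or.inl h⟩
    · exact Or.inr ⟨ht, _, _, hp, hq, Or.inr ⟨hc, f, (exitsRow_iff hZ).2 rfl,
        h.imp_right fun h => ⟨by omega, h.2⟩⟩⟩

section ins
variable {k a : ℕ} {A : ℕ → ℕ → ℕ} (hA : Valid A) (hk : KIncAll k A) (ha : a < k)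
include hA hk ha

theorem insSeq_wrow (s : ℕ) : WRow s (insSeq k a A s) (insSeq k a A (s + 1)) :=
  (insSeq_row hA hk ha s).wrow

theorem splice_insSeq_wseq {n i : ℕ} (hn : Bdd n A) (hi : WRow i (insSeq k a A i) (A (i + 1))) :
    WSeq (max n (i + 1)) (splice i (insSeq k a A) A) :=
  splice_wseq hA hn (fun s _ => insSeq_wrow hA hk ha s) hi

theorem insState_none_le {h e : ℕ} (hh : a < h) (hσ : insState k a A h = (e, none)) :
    e < h ∧ e < k ∧ ∀ l, l < h → A h l ≠ A h e + 1 := by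
  have := ins_inv hA hk ha hh
  rw [hσ] at this
  exact this

theorem insState_turn {i e : ℕ} (hai : a ≤ i) (hσ : insState k a A (i + 1) = (e, none)) :
    e ≤ i ∧ (e = i ∨ A (i + 1) e < insSeq k a A i e) := by
  rcases hai.lt_or_eq with h | rfl
  · have hst := ins_step hA hk ha h
    rw [hσ] at hst
    have h1 := insStep_turn (hA.row i) (ins_inv hA hk ha h) hst
    refine ⟨h1.1, ?_⟩
    rcases h1.1.lt_or_eq with h2 | h2
    · rw [insSeq_apply h h2]; exact h1.2
    · exact Or.inl h2
  · rw [insState_start] at hσ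
    obtain rfl : a = e := congrArg Prod.fst hσ
    exact ⟨le_rfl, Or.inl rfl⟩

/-- As long as the tiles below are crossings, the pipe that is moved runs straight. -/
theorem insState_of_cross {i e i₁ : ℕ} (hai : a ≤ i) (hσ : insState k a A (i + 1) = (e, none))
    (hT : ∀ s, i < s → s < i₁ → rowTile s (A s) (A (s + 1)) (A (i + 1) e) = Tile.cross) (h : ℕ)
    (hi : i < h) (hh : h ≤ i₁) : insState k a A h = (e, none) ∧ A h e = A (i + 1) e := by
  induction h, hi using Nat.le_induction with
  | base => exact ⟨hσ, rfl⟩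
  | succ s hs ih =>
    obtain ⟨hσs, hse⟩ := ih (by omega)
    obtain ⟨l, m, hl, hm⟩ := (hA.row s).wrow.rowTile_cross.1 (hT s hs (by omega))
    have hinv := insState_none_le hA hk ha (by omega) hσs
    obtain rfl : m = e := (hA.row s).wrow.inj_top hm.1 hinv.1 (hm.2.2.trans hse.symm)
    refine ⟨?_, hm.2.1⟩
    have hst := ins_step hA hk ha (h := s) (by omega)
    rw [hσs] at hst
    refine hst.unique (hA.row s) (.stay m fun f hf hvf => ?_)
    have h1 := (hA.row s).pair l f hl.1 hf
    have h2 := (hA.row s).1 f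
    have h3 := hinv.2.2 f
    unfold Thru at hl
    by_cases hlf : l = f
    · subst hlf
      omega
    · omega

omit hk ha in
-- Far down, the only horizontal run is that of the new pipe, to the right of the diagonal.
theorem exists_not_cross (i c : ℕ) : ∃ s, i < s ∧ rowTile s (A s) (A (s + 1)) c ≠ Tile.cross := by
  obtain ⟨n, hn⟩ := hA.bdd
  refine ⟨n + i + c + 1, by omega, ?_⟩
  rw [Ne, (hA.row _).wrow.rowTile_cross]
  rintro ⟨l, m, ⟨hl1, hl2, hl3⟩, -⟩
  rcases hl1.lt_or_eq with h | rfl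
  · have := hn.const (h := n + i + c + 1 + 1) (h' := n + i + c + 1) (l := l) (by omega) (by omega)
      (by omega) (by omega)
    omega
  · have := (hn (n + i + c + 1 + 1) (n + i + c + 1) (by omega)).2.1 (by omega)
    omega

theorem insSeq_wrow_none {i e : ℕ} (hai : a < i) (hσ : insState k a A i = (e, none))
    (hnc : ∀ m, Thru i (A i) (A (i + 1)) (A i e) m → A (i + 1) e ≠ A i e) :
    WRow i (insSeq k a A i) (A (i + 1)) := by
  have hst := ins_step hA hk ha hai
  have hin := ins_inv hA hk ha hai
  rw [hσ] at hst hin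
  exact (insStep_wrow_none (hA.row i) hin hst hnc).congr_top fun l hl => by
    rw [insSeq_apply hai hl, hσ]

/-- The droop is one column wide because no pipe comes up in the column to the right of `e`, and it
reaches down to the first row `i₁` with no crossing in the column of `e`. In between, `e` is
straight and the state does not change. -/
theorem minDroop_splice {i e : ℕ} (hai : a ≤ i) (hσ : insState k a A (i + 1) = (e, none))
    (hw : WRow i (insSeq k a A i) (A (i + 1))) :
    ∃ i₁, i < i₁ ∧ insState k a A i₁ = (e, none) ∧ A i₁ e = A (i + 1) e ∧
      (∀ m, Thru i₁ (A i₁) (A (i₁ + 1)) (A i₁ e) m → A (i₁ + 1) e ≠ A i₁ e) ∧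
      ∀ T x y, MinDroop (tilingOf (splice i (insSeq k a A) A)) i (A (i + 1) e) T x y ↔
        x = i₁ ∧ y = A (i + 1) e + 1 ∧ T = tilingOf (splice i₁ (insSeq k a A) A) := by
  classical
  have hex := exists_not_cross hA i (A (i + 1) e)
  obtain ⟨i₁, ⟨hi₁, hnc⟩, hmin⟩ : ∃ i₁, (i < i₁ ∧ rowTile i₁ (A i₁) (A (i₁ + 1)) (A (i + 1) e) ≠ Tile.cross) ∧
      ∀ s, i < s → s < i₁ → rowTile s (A s) (A (s + 1)) (A (i + 1) e) = Tile.cross :=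
    ⟨Nat.find hex, Nat.find_spec hex, fun s hs hs' => by
      have := Nat.find_min hex hs'
      simpa [hs] using this⟩
  have hstate := insState_of_cross hA hk ha hai hσ hmin
  obtain ⟨hσ₁, he₁⟩ := hstate i₁ hi₁ le_rfl
  obtain ⟨hei₁, hek, hno₁⟩ := insState_none_le hA hk ha (by omega) hσ₁
  have hturn := insState_turn hA hk ha hai hσ
  have hnc' : ∀ m, Thru i₁ (A i₁) (A (i₁ + 1)) (A i₁ e) m → A (i₁ + 1) e ≠ A i₁ e := by
    intro m hm hv
    rw [he₁] at hm hv
    exact hnc ((hA.row i₁).wrow.rowTile_cross.2 ⟨m, e, hm, hei₁, hv, he₁⟩)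
  refine ⟨i₁, hi₁, hσ₁, he₁, hnc', ?_⟩
  have hw₁ := insSeq_wrow_none hA hk ha (by omega) hσ₁ hnc'
  have hdroop : droop (tilingOf (splice i (insSeq k a A) A)) i (A (i + 1) e) i₁ (A (i + 1) e + 1) =
      tilingOf (splice i₁ (insSeq k a A) A) := by
    refine droop_splice hA.row (fun s _ => insSeq_row hA hk ha s) hw hw₁ hi₁ hturn.1 hturn.2
      (fun h h1 h2 => (hstate h h1 h2).2) (fun h h1 h2 => ?_) (fun h l h1 h2 hl hle => ?_)
      (fun h l h1 h2 hl => ?_) (fun s h1 h2 => ?_) (by rwa [he₁] at hnc')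
    · rw [insSeq_apply (by omega) (by omega), (hstate h h1 h2).1, insApp, if_pos rfl, (hstate h h1 h2).2]
    · rw [insSeq_apply (by omega) hl, (hstate h h1 h2).1, insApp, if_neg hle]
    · rw [← (hstate h h1 h2).2]
      exact (insState_none_le hA hk ha (by omega) (hstate h h1 h2).1).2.2 l hl
    · obtain ⟨l, m, hl, hm⟩ := (hA.row s).wrow.rowTile_cross.1 (hmin s h1 h2)
      exact ⟨l, hl⟩
  have hL1 : IsLeast {x | i < x ∧ tilingOf (splice i (insSeq k a A) A) x (A (i + 1) e) ≠ Tile.cross} i₁ := by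
    refine ⟨⟨hi₁, by rwa [tilingOf_splice_of_gt hi₁]⟩, fun x ⟨hx1, hx2⟩ => ?_⟩
    by_contra! hlt
    rw [tilingOf_splice_of_gt hx1] at hx2
    exact hx2 (hmin x hx1 hlt)
  have hL2 : IsLeast {y | A (i + 1) e < y ∧ tilingOf (splice i (insSeq k a A) A) i y ≠ Tile.cross}
      (A (i + 1) e + 1) := by
    refine ⟨⟨Nat.lt_succ_self _, ?_⟩, fun y hy => hy.1⟩
    rw [tilingOf_splice_self, Ne, hw.rowTile_cross]
    rintro ⟨l, m, -, hm⟩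
    exact (insState_none_le hA hk ha (by omega) hσ).2.2 m (by have := hm.1; omega) hm.2.1
  have hstart : tilingOf (splice i (insSeq k a A) A) i (A (i + 1) e) = Tile.rturn ∨
      tilingOf (splice i (insSeq k a A) A) i (A (i + 1) e) = Tile.bump := by
    rw [tilingOf_splice_self]
    have hR : Rt i (insSeq k a A i) (A (i + 1)) (A (i + 1) e) e := ⟨hturn.1, rfl, hturn.2⟩
    by_cases hJ : ∃ m, Jt i (insSeq k a A i) (A (i + 1)) (A (i + 1) e) m
    · obtain ⟨m, hm⟩ := hJ
      exact Or.inr (hw.rowTile_bump.2 ⟨e, m, hR, hm⟩)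
    · exact Or.inl (hw.rowTile_rturn.2 ⟨⟨e, hR⟩, fun m hm => hJ ⟨m, hm⟩⟩)
  intro T x y
  constructor
  · rintro ⟨-, h1, h2, h3⟩
    obtain rfl := h1.unique hL1
    obtain rfl := h2.unique hL2
    exact ⟨rfl, rfl, h3.trans hdroop⟩
  · rintro ⟨rfl, rfl, rfl⟩
    exact ⟨hstart, hL1, hL2, hdroop.symm⟩

theorem insSeq_wrow_back {i e f : ℕ} (hai : a < i) (hσ : insState k a A i = (e, some f))
    (hv : A (i + 1) f < A (i + 1) e) : WRow i (insSeq k a A i) (A (i + 1)) := by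
  have hin := ins_inv hA hk ha hai
  rw [hσ] at hin
  exact (insStep_wrow_back (hA.row i) hin hv).congr_top fun l hl => by
    rw [insSeq_apply hai hl, hσ]

/-- While two labels are swapped, tilings agree except at the first and the last row. -/
theorem tilingOf_hit {i e f : ℕ} (hai : a < i) (hσ : insState k a A i = (e, none))
    (hσ' : insState k a A (i + 1) = (e, some f)) (hf : A (i + 1) f = A i e + 1) (c : ℕ) :
    rowTile i (insSeq k a A i) (insSeq k a A (i + 1)) c =
      if c = A i e + 1 then Tile.cross else rowTile i (insSeq k a A i) (A (i + 1)) c := by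
  have hin := ins_inv hA hk ha hai
  rw [hσ] at hin
  have hin' := ins_inv hA hk ha (h := i + 1) (by omega)
  rw [hσ'] at hin'
  have he : e < i := hin.1
  have hfi : f ≤ i := Nat.lt_succ_iff.1 hin'.2.2.2.1
  refine rowTile_hit c (insSeq_wrow hA hk ha i) he hfi ((hA.row i).1 e he) hf ?_ ?_ (fun l hl hle => ?_) ?_ ?_
    (fun l hl hle hlf => ?_)
  · rcases hfi.lt_or_eq with h | h
    · have h1 := (hA.row i).1 f h
      have h2 : A i f ≠ A i e + 1 := hin.2.2 f h
      omega
    · exact Or.inl h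
  · rw [insSeq_apply hai he, hσ, insApp, if_pos rfl]
  · rw [insSeq_apply hai hl, hσ, insApp, if_neg hle]
  · rw [insSeq_apply (by omega) (by omega), hσ', insApp, if_pos rfl]
  · rw [insSeq_apply (by omega) (by omega), hσ', insApp, if_pos rfl, if_neg]
    rintro rfl
    exact absurd hin'.2.2.2.2.1 (lt_irrefl _)
  · rw [insSeq_apply (by omega) (by omega), hσ', insApp, if_neg hle, if_neg hlf]

theorem tilingOf_swapped {i e f : ℕ} (hai : a < i) (hσ : insState k a A i = (e, some f))
    (hσ' : insState k a A (i + 1) = (e, some f)) (c : ℕ) :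
    rowTile i (insSeq k a A i) (insSeq k a A (i + 1)) c = rowTile i (A i) (A (i + 1)) c := by
  have hin := ins_inv hA hk ha hai
  rw [hσ] at hin
  have he : e < i := hin.1
  have hf : f < i := hin.2.2.2.1
  have hef : f ≠ e := by
    rintro rfl
    exact absurd hin.2.2.2.2.1 (lt_irrefl _)
  refine rowTile_swap c he hf ?_ ?_ (fun l hl hle hlf => ?_) ?_ ?_ (fun l hl hle hlf => ?_)
  · rw [insSeq_apply hai he, hσ, insApp, if_pos rfl]
  · rw [insSeq_apply hai hf, hσ, insApp, if_neg hef, if_pos rfl]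
  · rw [insSeq_apply hai hl, hσ, insApp, if_neg hle, if_neg hlf]
  · rw [insSeq_apply (by omega) (by omega), hσ', insApp, if_pos rfl]
  · rw [insSeq_apply (by omega) (by omega), hσ', insApp, if_neg hef, if_pos rfl]
  · rw [insSeq_apply (by omega) (by omega), hσ', insApp, if_neg hle, if_neg hlf]

theorem back_top {i e f : ℕ} (hai : a < i) (hσ : insState k a A i = (e, some f))
    (hv : A (i + 1) f < A (i + 1) e) : e < i ∧ f < i ∧ e < f ∧ A (i + 1) e = A i e ∧ A i e < A i f := by
  have hin := ins_inv hA hk ha hai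
  rw [hσ] at hin
  obtain ⟨he, hek, hkf, hf, huf, -⟩ := hin
  have he : e < i := he
  have hf : f < i := hf
  have h1 := (hA.row i).2 e f (by omega) hf.le
  have h2 := (hA.row i).1 e he
  exact ⟨he, hf, by omega, by omega, huf⟩

theorem tilingOf_back {i e f : ℕ} (hai : a < i) (hσ : insState k a A i = (e, some f))
    (hv : A (i + 1) f < A (i + 1) e) (c : ℕ) :
    rowTile i (insSeq k a A i) (A (i + 1)) c =
      if c = A (i + 1) e then Tile.bump else rowTile i (A i) (A (i + 1)) c := by
  obtain ⟨he, hf, hef, hve, huf⟩ := back_top hA hk ha hai hσ hv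
  refine rowTile_back c (insSeq_wrow_back hA hk ha hai hσ hv) he hf hve huf hv ?_ ?_
    (fun l hl hle hlf => ?_)
  · rw [insSeq_apply hai he, hσ, insApp, if_pos rfl]
  · rw [insSeq_apply hai hf, hσ, insApp, if_neg hef.ne', if_pos rfl]
  · rw [insSeq_apply hai hl, hσ, insApp, if_neg hle, if_neg hlf]

end ins

section ins
variable {k a : ℕ} {A : ℕ → ℕ → ℕ} (hA : Valid A) (hk : KIncAll k A) (ha : a < k)
include hA hk ha

theorem insSeq_none_self {i e : ℕ} (hai : a < i) (hσ : insState k a A i = (e, none)) :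
    insSeq k a A i e = A i e + 1 := by
  rw [insSeq_apply hai (insState_none_le hA hk ha hai hσ).1, hσ, insApp, if_pos rfl]

omit hA hk ha in
theorem insSeq_none_of_ne {i e l : ℕ} (hai : a < i) (hσ : insState k a A i = (e, none)) (hl : l < i)
    (hle : l ≠ e) : insSeq k a A i l = A i l := by
  rw [insSeq_apply hai hl, hσ, insApp, if_neg hle]

theorem turns_of_hit {i e f : ℕ} (hai : a < i) (hσ : insState k a A i = (e, none)) (hf : f ≤ i)
    (hvf : A (i + 1) f = A i e + 1) :
    f ≠ e ∧ (f = i ∨ A i e + 1 < A i f) ∧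
      Rt i (insSeq k a A i) (A (i + 1)) (A i e + 1) f ∧ Jt i (insSeq k a A i) (A (i + 1)) (A i e + 1) e := by
  obtain ⟨he, hek, hno⟩ := insState_none_le hA hk ha hai hσ
  have h1 := (hA.row i).1 e he
  have hfe : f ≠ e := by
    rintro rfl
    omega
  have hfu : f = i ∨ A i e + 1 < A i f := by
    rcases hf.lt_or_eq with h | h
    · have h2 := (hA.row i).1 f h
      have h3 := hno f h
      omega
    · exact Or.inl h
  refine ⟨hfe, hfu, ⟨hf, hvf, ?_⟩, he, by omega, insSeq_none_self hA hk ha hai hσ⟩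
  rcases hf.lt_or_eq with h | h
  · rw [insSeq_none_of_ne hai hσ h hfe]
    omega
  · exact Or.inl h

/-- Labels below `k` never cross. If `k ≤ f`, a crossing above row `i` would leave `f` to the left
of `e` on all later lines, while they are in the opposite order where they bump. So only their
crossing in the old part, below row `i`, is possible. -/
theorem crossAt_splice {n i e f c d : ℕ} (hn : Bdd n A) (hai : a < i)
    (hσ : insState k a A i = (e, none)) (hw : WRow i (insSeq k a A i) (A (i + 1)))
    (hf : f ≤ i) (hvf : A (i + 1) f = A i e + 1) :
    CrossAt (tilingOf (splice i (insSeq k a A) A))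
      (bottomCol (max n (i + 1)) (splice i (insSeq k a A) A) f)
      (bottomCol (max n (i + 1)) (splice i (insSeq k a A) A) e) c d ↔
    i < c ∧ k ≤ f ∧ Vt c (A c) (A (c + 1)) d e ∧ Thru c (A c) (A (c + 1)) d f := by
  obtain ⟨he, hek, hno⟩ := insState_none_le hA hk ha hai hσ
  obtain ⟨hfe, hfu, hR, hJ⟩ := turns_of_hit hA hk ha hai hσ hf hvf
  rw [crossAt_label_iff (splice_insSeq_wseq hA hk ha hn hw)]
  rcases lt_trichotomy c i with hc | rfl | hc
  · rw [splice_of_le hc.le, splice_of_le hc]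
    refine iff_of_false ?_ (fun h => by omega)
    have hr := insSeq_row hA hk ha c
    have hkc := (insSeq_kinc hA hk ha).le c
    rintro (⟨h1, h2⟩ | ⟨h1, h2⟩)
    · exact hkc.not_cross hr hek h1 h2
    · rcases Nat.lt_or_ge f k with hfk | hfk
      · exact hkc.not_cross hr hfk h1 h2
      · have h3 := hr.lt_of_cross h1 h2
        have h4 := h2.1
        have h5 := inversion_persists (A := insSeq k a A) (h := c + 1) (h' := i)
          (fun s _ _ => insSeq_row hA hk ha s) h3.1 (by omega) (by omega) h3.2
        rw [insSeq_none_self hA hk ha hai hσ, insSeq_none_of_ne hai hσ (by omega) hfe] at h5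
        omega
  · rw [splice_of_le le_rfl, splice_of_lt (by omega)]
    refine iff_of_false ?_ (fun h => by omega)
    unfold Rt at hR
    unfold Jt at hJ
    unfold Vt Thru
    omega
  · rw [splice_of_lt hc, splice_of_lt (by omega)]
    constructor
    · rintro (⟨h1, h2⟩ | ⟨h1, h2⟩)
      · exact absurd h2 fun h2 => (hk.le c).not_cross (hA.row c) hek h1 h2
      · refine ⟨hc, ?_, h1, h2⟩
        by_contra! hfk
        exact (hk.le c).not_cross (hA.row c) hfk h1 h2
    · exact fun h => Or.inr h.2.2

/-- Each rule of the algorithm matches one step of the transducer: a turn matches `stay`, passing on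
matches `pass`, a bump with a larger label matches `hit`. The row where `back` occurs decides
between swapping and terminating. -/
theorem insertFrom_splice {n : ℕ} (hn : Bdd n A) (E : Tiling) : ∀ (d i e : ℕ), max n k + 1 ≤ i + d →
    a ≤ i → insState k a A (i + 1) = (e, none) → WRow i (insSeq k a A i) (A (i + 1)) →
    (InsertFrom k (tilingOf (splice i (insSeq k a A) A)) i (A (i + 1) e) E ↔
      E = tilingOf (insSeq k a A)) := by
  classical
  intro d
  induction d with
  -- The fuel `d` is never exhausted: from line `max n k + 1` on, the state is an exchange, so there
  -- is nothing left to droop.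
  | zero =>
    intro i e hd hai hσ hw
    obtain ⟨-, e', f, h1, -⟩ := ins_state_large hA hk ha hn (i + 1) (by omega)
    rw [hσ] at h1
    simp at h1
  | succ d ih =>
  intro i e hd hai hσ hw
  obtain ⟨i₁, hi₁, hσ₁, he₁, hnc, hmd⟩ := minDroop_splice hA hk ha hai hσ hw
  rw [← he₁] at hmd ⊢
  have hai₁ : a < i₁ := by omega
  obtain ⟨he, hek, hno⟩ := insState_none_le hA hk ha hai₁ hσ₁
  have hw₁ := insSeq_wrow_none hA hk ha hai₁ hσ₁ hnc
  have hZ := splice_insSeq_wseq hA hk ha hn hw₁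
  have hve := (hA.row i₁).1 e he
  have hBe := insSeq_none_self hA hk ha hai₁ hσ₁
  have hst := ins_step hA hk ha hai₁
  rw [hσ₁] at hst
  generalize hσ₂ : insState k a A (i₁ + 1) = σ₂ at hst
  have hbump : ∀ f, f ≤ i₁ → A (i₁ + 1) f = A i₁ e + 1 → _ := fun f hf hv =>
    insertFrom_iff_of_bump (k := k) (f := f) (e := e) (E := E) hZ hmd
      (by rw [splice_of_le le_rfl, splice_of_lt (by omega)]; exact (turns_of_hit hA hk ha hai₁ hσ₁ hf hv).2.2.1)
      (by rw [splice_of_le le_rfl, splice_of_lt (by omega)]; exact (turns_of_hit hA hk ha hai₁ hσ₁ hf hv).2.2.2)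
  cases hst with
  | stay _ hv =>
    have hJ : Jt i₁ (insSeq k a A i₁) (A (i₁ + 1)) (A i₁ e + 1) e := ⟨he, by omega, hBe⟩
    rw [insertFrom_iff_of_jturn hmd (j₂ := A (i₁ + 1) e)]
    · exact ih i₁ e (by omega) (by omega) hσ₂ hw₁
    · rw [tilingOf_splice_self, hw₁.rowTile_jturn]
      exact ⟨⟨e, hJ⟩, fun m hm => hv m hm.1 hm.2.1⟩
    · simp only [tilingOf_splice_self, hw₁.rowTile_rturn]
      refine ⟨⟨by omega, ⟨e, he.le, rfl, by omega⟩, ?_⟩, ?_⟩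
      · rintro m ⟨hm1, hm2, hm3⟩
        have hme : m ≠ e := by
          rintro rfl
          omega
        rw [insSeq_none_of_ne hai₁ hσ₁ hm1 hme] at hm3
        have := (hA.row i₁).pair m e hm1.le he.le
        omega
      · rintro c ⟨hc, ⟨l, hl1, hl2, hl3⟩, -⟩
        by_cases hle : l = e
        · rw [← hl2, hle]
        · have := hw₁.pair l e hl1 he.le
          have := hw₁.1 e he
          omega
  | pass _ f hf hv hkf =>
    rw [hbump f hf hv]
    simp only [crossAt_splice hA hk ha hn hai₁ hσ₁ hw₁ hf hv]
    rw [← hv, ih i₁ f (by omega) (by omega) hσ₂ hw₁]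
    constructor
    · rintro (⟨c, d, h, -⟩ | ⟨-, h | h⟩)
      · omega
      · exact h.2
      · omega
    · exact fun h => Or.inr ⟨fun c d h => by omega, Or.inl ⟨hkf, h⟩⟩
  | hit _ f hf hv hkf =>
    rw [hbump f hf hv]
    simp only [crossAt_splice hA hk ha hn hai₁ hσ₁ hw₁ hf hv]
    -- The exchange of `e` and `f` ends in the row of their old crossing, if there is one below.
    -- Then this is a cross-bump-swap, otherwise the algorithm stops.
    by_cases hback : ∃ c, i₁ < c ∧ insState k a A (c + 1) ≠ (e, some f)
    · obtain ⟨c, ⟨hc, hcs⟩, hmin⟩ : ∃ c, (i₁ < c ∧ insState k a A (c + 1) ≠ (e, some f)) ∧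
          ∀ x, i₁ < x → x < c → insState k a A (x + 1) = (e, some f) :=
        ⟨Nat.find hback, Nat.find_spec hback, fun x hx hx' => by
          have := Nat.find_min hback hx'
          simpa [hx] using this⟩
      have hall : ∀ x, i₁ < x → x ≤ c → insState k a A x = (e, some f) := by
        intro x hx hxc
        rcases Nat.lt_or_ge (i₁ + 1) x with h | h
        · obtain ⟨y, rfl⟩ : ∃ y, x = y + 1 := ⟨x - 1, by omega⟩
          exact hmin y (by omega) (by omega)
        · rwa [show x = i₁ + 1 by omega]
      have hσc := hall c hc le_rfl
      have hstc := ins_step hA hk ha (h := c) (by omega)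
      rw [hσc] at hstc
      generalize hσc' : insState k a A (c + 1) = σ₃ at hstc hcs
      cases hstc with
      | keep _ _ _ => exact absurd rfl hcs
      | back _ _ hvc =>
        obtain ⟨hec, hfc, hef, hvec, huf⟩ := back_top hA hk ha (by omega) hσc hvc
        have hcr : Vt c (A c) (A (c + 1)) (A (c + 1) e) e ∧ Thru c (A c) (A (c + 1)) (A (c + 1) e) f :=
          ⟨⟨hec, rfl, hvec.symm⟩, hfc.le, hvc, Or.inr (by omega)⟩
        -- Between the two changed tiles `e` and `f` have only traded names, so the cross-bump-swap
        -- is already the next splice.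
        have hset : setTile (setTile (tilingOf (splice i₁ (insSeq k a A) A)) i₁ (A i₁ e + 1) Tile.cross)
            c (A (c + 1) e) Tile.bump = tilingOf (splice c (insSeq k a A) A) := by
          funext s t
          unfold setTile
          rcases lt_trichotomy s i₁ with hs | rfl | hs
          · rw [if_neg (by omega), if_neg (by omega), tilingOf_splice_of_lt hs, tilingOf_splice_of_lt (by omega)]
          · rw [if_neg (by omega), tilingOf_splice_of_lt hc, tilingOf_splice_self,
              tilingOf_hit hA hk ha hai₁ hσ₁ hσ₂ hv]
            simp only [true_and]
          · rw [tilingOf_splice_of_gt hs]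
            rcases lt_trichotomy s c with hs' | rfl | hs'
            · rw [if_neg (by omega), if_neg (by omega), tilingOf_splice_of_lt hs',
                tilingOf_swapped hA hk ha (by omega) (hall s hs hs'.le) (hall (s + 1) (by omega) hs')]
            · rw [tilingOf_splice_self, tilingOf_back hA hk ha (by omega) hσc hvc]
              simp only [true_and]
              rw [if_neg (by omega : ¬ (s = i₁ ∧ _))]
            · rw [if_neg (by omega), if_neg (by omega), tilingOf_splice_of_gt hs']
        have hih := ih c e (by omega) (by omega) hσc' (insSeq_wrow_back hA hk ha (by omega) hσc hvc)
        constructor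
        · rintro (⟨c', d', ⟨-, -, h1⟩, h⟩ | ⟨h, -⟩)
          · obtain ⟨rfl, rfl⟩ := hA.cross_unique hcr h1
            rw [hset] at h
            exact hih.1 h
          · exact absurd ⟨hc, hkf, hcr⟩ (h c _)
        · intro h
          refine Or.inl ⟨c, _, ⟨hc, hkf, hcr⟩, ?_⟩
          rw [hset]
          exact hih.2 h
    · push Not at hback
      have hall : ∀ x, i₁ < x → insState k a A x = (e, some f) := by
        intro x hx
        rcases Nat.lt_or_ge (i₁ + 1) x with h | h
        · obtain ⟨y, rfl⟩ : ∃ y, x = y + 1 := ⟨x - 1, by omega⟩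
          exact hback y (by omega)
        · rwa [show x = i₁ + 1 by omega]
      have hnocross : ∀ c d, ¬ (i₁ < c ∧ k ≤ f ∧ Vt c (A c) (A (c + 1)) d e ∧
          Thru c (A c) (A (c + 1)) d f) := by
        rintro c d ⟨hc, -, h1, h2⟩
        have hstc := ins_step hA hk ha (h := c) (by omega)
        rw [hall c hc, hall (c + 1) (by omega)] at hstc
        cases hstc with
        | keep _ _ h3 =>
          unfold Vt at h1
          unfold Thru at h2
          omega
      have hset : setTile (tilingOf (splice i₁ (insSeq k a A) A)) i₁ (A i₁ e + 1) Tile.cross =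
          tilingOf (insSeq k a A) := by
        funext s t
        unfold setTile
        rcases lt_trichotomy s i₁ with hs | rfl | hs
        · rw [if_neg (by omega), tilingOf_splice_of_lt hs, tilingOf]
        · rw [tilingOf_splice_self, tilingOf, tilingOf_hit hA hk ha hai₁ hσ₁ hσ₂ hv]
          simp only [true_and]
        · rw [if_neg (by omega), tilingOf_splice_of_gt hs, tilingOf,
            tilingOf_swapped hA hk ha (by omega) (hall s hs) (hall (s + 1) (by omega))]
      rw [hset]
      constructor
      · rintro (⟨c, d, h, -⟩ | ⟨-, h | h⟩)
        · exact absurd h (hnocross c d)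
        · omega
        · exact h.2
      · exact fun h => Or.inr ⟨hnocross, Or.inr ⟨hkf, h⟩⟩

theorem rightInsert_iff (E : Tiling) :
    RightInsert (tilingOf A) (a + 1) k E ↔ E = tilingOf (insSeq k a A) := by
  obtain ⟨n, hn⟩ := hA.bdd
  have hr := hA.row a
  -- The rightmost turn in row `a` belongs to the pipe exiting along that row.
  have hg : IsGreatest {j | tilingOf A a j = Tile.rturn} (A (a + 1) a) := by
    refine ⟨hr.wrow.rowTile_rturn.2 ⟨⟨a, le_rfl, rfl, Or.inl rfl⟩, ?_⟩, ?_⟩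
    · rintro m ⟨hm1, hm2, hm3⟩
      have := hr.pair m a hm1.le le_rfl
      omega
    · intro j hj
      obtain ⟨⟨l, hl1, hl2, hl3⟩, -⟩ := hr.wrow.rowTile_rturn.1 hj
      rcases hl1.lt_or_eq with h | rfl
      · have := hr.pair l a hl1 le_rfl
        omega
      · exact hl2.ge
  have h0 : tilingOf A = tilingOf (splice a (insSeq k a A) A) := by
    congr 1
    funext h
    rcases Nat.lt_or_ge a h with hh | hh
    · rw [splice_of_lt hh]
    · rw [splice_of_le hh, insSeq_of_le hA hh]
  have key := insertFrom_splice hA hk ha hn E (max n k + 1) a a (by omega) le_rfl (insState_start k a A)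
    (by rw [insSeq_of_le hA le_rfl]; exact hr.wrow)
  rw [← h0] at key
  rw [← key, RightInsert, Nat.add_sub_cancel]
  constructor
  · rintro ⟨j, hj, h⟩
    rwa [← hj.unique hg]
  · exact fun h => ⟨_, hg, h⟩

end ins

/-! ### Insertion of words. -/

/-- The sequences obtained by successively inserting the biletters of a word. -/
noncomputable def insWord : (ℕ → ℕ → ℕ) → Biword → ℕ → ℕ → ℕ
  | A, [] => A
  | A, x :: w => insWord (insSeq x.2 (x.1 - 1) A) w

/-- The plactic condition enters here: an insertion with bottom letter `k` keeps the labels below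
`k` in order, and later bottom letters are not larger. -/
theorem insWord_spec (w : Biword) (hw : IsPlactic w) (A : ℕ → ℕ → ℕ) (hA : Valid A)
    (hk : ∀ x ∈ w, KIncAll x.2 A) : Valid (insWord A w) ∧
    ∀ E, InsertWord (tilingOf A) w E ↔ E = tilingOf (insWord A w) := by
  induction w generalizing A with
  | nil =>
    refine ⟨hA, fun E => ⟨fun h => ?_, fun h => ?_⟩⟩
    · cases h
      rfl
    · rw [h]
      exact .nil _
  | cons x w ih =>
    obtain ⟨b, k⟩ := x
    have hx := hw.1 (b, k) (by simp)
    have hkA : KIncAll k A := hk (b, k) (by simp)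
    have hbk : b - 1 < k := by
      simp only at hx
      omega
    have hp := List.pairwise_cons.1 hw.2
    obtain ⟨h1, h2⟩ := ih ⟨fun y hy => hw.1 y (by simp [hy]), hp.2⟩ _ (insSeq_valid hA hkA hbk)
      fun y hy => (insSeq_kinc hA hkA hbk).mono (hp.1 y hy)
    refine ⟨h1, fun E => ?_⟩
    rw [insWord, ← h2]
    have hri := rightInsert_iff hA hkA hbk
    rw [show b - 1 + 1 = b by simp only at hx; omega] at hri
    constructor
    · intro h
      cases h with
      | cons _ D₁ _ _ _ _ h₁ h =>
        rwa [← (hri _).1 h₁]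
    · exact fun h => .cons _ _ _ _ _ _ ((hri _).2 rfl) h

/-! ### An undroop, tile by tile. -/

section rows
variable {s : ℕ} {u v u' v' : ℕ → ℕ} {p y : ℕ}

theorem rowTile_topPair (hw : WRow s u v) (hw' : WRow s u v') (hp : p ≤ s) (hv : v p = y + 1)
    (hpu : p = s ∨ y + 1 ≤ u p) (hb : rowTile s u v y = Tile.blank) (hv'p : v' p = y)
    (hv' : ∀ l, l ≤ s → l ≠ p → v' l = v l) :
    topPair (rowTile s u v y) (rowTile s u v (y + 1)) = (rowTile s u v' y, rowTile s u v' (y + 1)) := by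
  rw [hb]
  have hb := hw.rowTile_blank.1 hb
  have hinj : ∀ l, l ≤ s → l ≠ p → v l ≠ y + 1 := fun l hl hlp h => hlp (hw.inj hl hp (h.trans hv.symm))
  have e1 : rowTile s u v' y = Tile.rturn := by
    refine (IsTile.rturn p ⟨hp, hv'p, by omega⟩ ?_).eq hw'
    rintro m ⟨h1, h2, h3⟩
    have hmp : m ≠ p := by
      rintro rfl
      omega
    have := hb m h1.le
    have := hv' m h1.le hmp
    omega
  by_cases hJ : p < s ∧ u p = y + 1
  · have e2 : rowTile s u v (y + 1) = Tile.vert := by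
      refine (IsTile.vert p ⟨hJ.1, hv, hJ.2⟩ ?_).eq hw
      rintro m ⟨h1, h2, h3⟩
      have := hb m h1
      omega
    have e3 : rowTile s u v' (y + 1) = Tile.jturn := by
      refine (IsTile.jturn p ⟨hJ.1, by omega, hJ.2⟩ ?_).eq hw'
      rintro m ⟨h1, h2, h3⟩
      have hmp : m ≠ p := by
        rintro rfl
        omega
      have := hinj m h1 hmp
      have := hv' m h1 hmp
      omega
    rw [e1, e2, e3]
    rfl
  · have e2 : rowTile s u v (y + 1) = Tile.rturn := by
      refine (IsTile.rturn p ⟨hp, hv, by omega⟩ ?_).eq hw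
      rintro m ⟨h1, h2, h3⟩
      have := hb m h1.le
      omega
    have e3 : rowTile s u v' (y + 1) = Tile.horiz := by
      refine (IsTile.horiz p ⟨hp, by omega, by omega⟩ ?_).eq hw'
      rintro m ⟨h1, h2, h3⟩
      have hmp : m ≠ p := by
        rintro rfl
        omega
      have := hinj m h1.le hmp
      have := hv' m h1.le hmp
      omega
    rw [e1, e2, e3]
    rfl

theorem rowTile_undroop_top_of_ne {c : ℕ} (hc : c ≠ y) (hc' : c ≠ y + 1) (hv : v p = y + 1)
    (hv'p : v' p = y) (hv' : ∀ l, l ≤ s → l ≠ p → v' l = v l) :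
    rowTile s u v' c = rowTile s u v c := by
  refine rowTile_eq_of_kinds id (fun _ => rfl) fun l => ?_
  unfold Thru Rt Jt Vt id
  by_cases hl : l = p
  · subst hl
    omega
  · have := hv' l
    omega

theorem jdtApp_cases {x : ℕ → ℕ} (hx : x p = y + 1) (l : ℕ) :
    (l = p ∧ x l = y + 1 ∧ jdtApp x p l = y) ∨ (l ≠ p ∧ x l = y ∧ jdtApp x p l = y + 1) ∨
      (l ≠ p ∧ x l ≠ y ∧ jdtApp x p l = x l) := by
  unfold jdtApp
  split_ifs with h1 h2
  · subst h1
    omega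
  · omega
  · omega

section mid
variable (hw : RowOK s u v) (hw' : WRow s u' v') (hp : p < s) (hu : u p = y + 1) (hv : v p = y + 1)
  (hu' : ∀ l, l < s → u' l = jdtApp u p l) (hv' : ∀ l, l ≤ s → v' l = jdtApp v p l)

include hw hp hu hv hu' hv'

theorem jdt_mid_cases (l : ℕ) (hl : l ≤ s) :
    ((l = p ∧ v l = y + 1 ∧ v' l = y) ∨ (l ≠ p ∧ v l = y ∧ v' l = y + 1) ∨
      (l ≠ p ∧ v l ≠ y ∧ v l ≠ y + 1 ∧ v' l = v l)) ∧
    (l = s ∨ (l = p ∧ u l = y + 1 ∧ u' l = y) ∨ (l ≠ p ∧ u l = y ∧ u' l = y + 1) ∨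
      (l ≠ p ∧ u l ≠ y ∧ u l ≠ y + 1 ∧ u' l = u l)) ∧ (l = s ∨ v l ≤ u l) := by
  have h1 := jdtApp_cases hv l
  have h2 := hv' l hl
  have h3 : l ≠ p → v l ≠ y + 1 := fun h h' => h (hw.wrow.inj hl hp.le (h'.trans hv.symm))
  refine ⟨by omega, ?_⟩
  rcases hl.lt_or_eq with hls | hls
  · have h4 := jdtApp_cases hu l
    have h5 := hu' l hls
    have h6 : l ≠ p → u l ≠ y + 1 := fun h h' => h (hw.wrow.inj_top hls hp (h'.trans hu.symm))
    have h7 := hw.1 l hls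
    omega
  · omega

include hw'

/-- Besides being one case of the sliding rule, this describes the row in which pipes `y` and `y +
1` are uncrossed: there the crossing pipe also turns in column `y`. -/
theorem rowTile_slide_rturn {m : ℕ} (hm : m ≤ s) (hvm : v m = y) (hum : m = s ∨ y + 1 < u m) :
    rowTile s u v y = Tile.rturn ∧ rowTile s u v (y + 1) = Tile.cross ∧
      rowTile s u' v' y = Tile.vert ∧ rowTile s u' v' (y + 1) = Tile.rturn := by
  have key := jdt_mid_cases hw hp hu hv hu' hv'
  have hkm := key m hm
  have hkp := key p hp.le
  refine ⟨(IsTile.rturn m ⟨hm, hvm, by omega⟩ ?_).eq hw.wrow,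
    (IsTile.cross m p ⟨hm, by omega, hum⟩ ⟨hp, hv, hu⟩).eq hw.wrow,
    (IsTile.vert p ⟨hp, by omega, by omega⟩ ?_).eq hw',
    (IsTile.rturn m ⟨hm, by omega, by omega⟩ ?_).eq hw'⟩
  · rintro l ⟨h1, h2, h3⟩
    have := hw.wrow.pair l m h1.le hm
    have := hw.pair l m h1.le hm
    omega
  · rintro l ⟨h1, h2, h3⟩
    have := hw.wrow.pair l m h1 hm
    have := hw.pair l m h1 hm
    have := key l h1
    omega
  · rintro l ⟨h1, h2, h3⟩
    have := hw.wrow.pair l m h1.le hm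
    have := hw.pair l m h1.le hm
    have := key l h1.le
    omega

theorem rowTile_slidePair :
    slidePair (rowTile s u v y) (rowTile s u v (y + 1)) = (rowTile s u' v' y, rowTile s u' v' (y + 1)) := by
  have key := jdt_mid_cases hw hp hu hv hu' hv'
  have hkp := key p hp.le
  have hP : Vt s u v (y + 1) p := ⟨hp, hv, hu⟩
  have hP' : Vt s u' v' y p := ⟨hp, by omega, by omega⟩
  by_cases hT : ∃ m, Thru s u v (y + 1) m
  · obtain ⟨m, hm⟩ := hT
    have ⟨hm1, hm2, hm3⟩ := hm
    have hkm := key m hm1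
    by_cases hvm : v m = y
    · obtain ⟨e1, e2, e3, e4⟩ := rowTile_slide_rturn hw hw' hp hu hv hu' hv' hm1 hvm hm3
      rw [e1, e2, e3, e4]
      rfl
    · have e2 : rowTile s u v (y + 1) = Tile.cross := (IsTile.cross m p hm hP).eq hw.wrow
      have hmy : Thru s u v y m := ⟨hm1, by omega, by omega⟩
      have e3 : rowTile s u' v' y = Tile.cross :=
        (IsTile.cross m p ⟨hm1, by omega, by omega⟩ hP').eq hw'
      have hm' : Thru s u' v' (y + 1) m := ⟨hm1, by omega, by omega⟩
      by_cases hV : ∃ q, Vt s u v y q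
      · obtain ⟨q, hq⟩ := hV
        have e1 : rowTile s u v y = Tile.cross := (IsTile.cross m q hmy hq).eq hw.wrow
        obtain ⟨h1, h2, h3⟩ := hq
        have := key q h1.le
        have e4 : rowTile s u' v' (y + 1) = Tile.cross :=
          (IsTile.cross m q hm' ⟨h1, by omega, by omega⟩).eq hw'
        rw [e1, e2, e3, e4]
        rfl
      · have e1 : rowTile s u v y = Tile.horiz :=
          (IsTile.horiz m hmy fun q hq => hV ⟨q, hq⟩).eq hw.wrow
        have e4 : rowTile s u' v' (y + 1) = Tile.horiz := by
          refine (IsTile.horiz m hm' ?_).eq hw'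
          rintro q ⟨h1, h2, h3⟩
          have := key q h1.le
          exact hV ⟨q, h1, by omega, by omega⟩
        rw [e1, e2, e3, e4]
        rfl
  · have hT' : ∀ m, ¬ Thru s u v (y + 1) m := fun m hm => hT ⟨m, hm⟩
    have e2 : rowTile s u v (y + 1) = Tile.vert := (IsTile.vert p hP hT').eq hw.wrow
    unfold Thru at hT'
    by_cases hq : ∃ q, q < s ∧ u q = y
    · obtain ⟨q, hqs, huq⟩ := hq
      have hkq := key q hqs.le
      have hqu : ∀ l, l < s → u l = y → l = q ∧ v l = v q := fun l hl h => by
        obtain rfl := hw.wrow.inj_top hl hqs (h.trans huq.symm)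
        exact ⟨rfl, rfl⟩
      by_cases hvq : v q = y
      · have e1 : rowTile s u v y = Tile.vert := by
          refine (IsTile.vert q ⟨hqs, hvq, huq⟩ ?_).eq hw.wrow
          rintro l ⟨h1, h2, h3⟩
          have := key l h1
          have := hT' l
          omega
        have e3 : rowTile s u' v' y = Tile.vert := by
          refine (IsTile.vert p hP' ?_).eq hw'
          rintro l ⟨h1, h2, h3⟩
          have := key l h1
          have := hT' l
          have := hqu l
          omega
        have e4 : rowTile s u' v' (y + 1) = Tile.vert := by
          refine (IsTile.vert q ⟨hqs, by omega, by omega⟩ ?_).eq hw'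
          rintro l ⟨h1, h2, h3⟩
          have := key l h1
          have := hT' l
          omega
        rw [e1, e2, e3, e4]
        rfl
      · have e1 : rowTile s u v y = Tile.jturn := by
          refine (IsTile.jturn q ⟨hqs, by omega, huq⟩ ?_).eq hw.wrow
          rintro l ⟨h1, h2, h3⟩
          have := key l h1
          have := hT' l
          omega
        have e3 : rowTile s u' v' y = Tile.cross :=
          (IsTile.cross q p ⟨hqs.le, by omega, by omega⟩ hP').eq hw'
        have e4 : rowTile s u' v' (y + 1) = Tile.jturn := by
          refine (IsTile.jturn q ⟨hqs, by omega, by omega⟩ ?_).eq hw'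
          rintro l ⟨h1, h2, h3⟩
          have := key l h1
          have := hT' l
          omega
        rw [e1, e2, e3, e4]
        rfl
    · have hq' : ∀ l, l < s → u l ≠ y := fun l hl h => hq ⟨l, hl, h⟩
      have e1 : rowTile s u v y = Tile.blank := by
        refine (IsTile.blank ?_).eq hw.wrow
        rintro l h1 ⟨h2, h3⟩
        have := key l h1
        have := hT' l
        have := hq' l
        omega
      have e3 : rowTile s u' v' y = Tile.vert := by
        refine (IsTile.vert p hP' ?_).eq hw'
        rintro l ⟨h1, h2, h3⟩
        have := key l h1
        have := hT' l
        have := hq' l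
        omega
      have e4 : rowTile s u' v' (y + 1) = Tile.blank := by
        refine (IsTile.blank ?_).eq hw'
        rintro l h1 ⟨h2, h3⟩
        have := key l h1
        have := hT' l
        have := hq' l
        omega
      rw [e1, e2, e3, e4]
      rfl

omit hw' in
theorem rowTile_slide_of_ne {c : ℕ} (hc : c ≠ y) (hc' : c ≠ y + 1) :
    rowTile s u' v' c = rowTile s u v c := by
  refine rowTile_eq_of_kinds id (fun _ => rfl) fun l => ?_
  unfold Thru Rt Jt Vt id
  by_cases hl : l ≤ s
  · have := jdt_mid_cases hw hp hu hv hu' hv' l hl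
    omega
  · omega

end mid

section bottom
variable (hw : RowOK s u v) (hw' : WRow s u' v) (hp : p < s) (hu : u p = y + 1) (hv : v p < y + 1)
  (hno : ∀ l, l < s → u l ≠ y) (hu'p : u' p = y) (hu' : ∀ l, l < s → l ≠ p → u' l = u l)
include hw hw' hp hu hv hno hu'p hu'

theorem rowTile_undroopSW : rowTile s u' v y = undroopSW (rowTile s u v y) := by
  by_cases hvp : v p = y
  · rw [hw.wrow.rowTile_rturn.2 ⟨⟨p, hp.le, hvp, by omega⟩, fun m hm => hno m hm.1 hm.2.2⟩]
    refine (IsTile.vert p ⟨hp, hvp, hu'p⟩ ?_).eq hw'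
    rintro l ⟨h1, h2, h3⟩
    have := hw.wrow.pair l p h1 hp.le
    have := hw.pair l p h1 hp.le
    have := hu' l
    omega
  · rw [(IsTile.horiz p ⟨hp.le, by omega, by omega⟩ fun m hm => hno m hm.1 hm.2.2).eq hw.wrow]
    refine (IsTile.jturn p ⟨hp, by omega, hu'p⟩ ?_).eq hw'
    rintro l ⟨h1, h2, h3⟩
    have := hw.wrow.pair l p h1 hp.le
    have := hw.pair l p h1 hp.le
    have := hu' l
    omega

omit hno in
theorem rowTile_undroopSE : rowTile s u' v (y + 1) = undroopSE (rowTile s u v (y + 1)) := by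
  rw [(IsTile.jturn p ⟨hp, hv, hu⟩ ?_).eq hw.wrow]
  · refine (IsTile.blank ?_).eq hw'
    rintro l h1 ⟨h2, h3⟩
    by_cases hlp : l = p
    · subst hlp
      omega
    · have := hw.pair l p h1 hp.le
      have := hu' l
      omega
  · rintro l ⟨h1, h2, h3⟩
    have := hw.wrow.pair l p h1 hp.le
    have := hw.pair l p h1 hp.le
    omega

omit hw hw' hno in
theorem rowTile_undroop_bot_of_ne {c : ℕ} (hc : c ≠ y) (hc' : c ≠ y + 1) :
    rowTile s u' v c = rowTile s u v c := by
  refine rowTile_eq_of_kinds id (fun _ => rfl) fun l => ?_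
  unfold Thru Rt Jt Vt id
  by_cases hl : l = p
  · subst hl
    omega
  · have := hu' l
    omega

end bottom

end rows

section undroop
variable {x p y : ℕ} {A C : ℕ → ℕ → ℕ} (hA : ∀ s, RowOK s (A s) (A (s + 1)))
  (hC : ∀ s, RowOK s (C s) (C (s + 1))) (hw : WRow x (C x) (A (x + 1))) (hpx : p ≤ x)
  (hpu : p = x ∨ y + 1 ≤ C x p) (hb : rowTile x (C x) (A (x + 1)) y = Tile.blank)
include hA hC hw hpx hpu hb

omit hA in
theorem jdt_top_row (hp : A (x + 1) p = y + 1) (hCx : ∀ l, l ≤ x → C (x + 1) l = jdtApp (A (x + 1)) p l) :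
    topPair (rowTile x (C x) (A (x + 1)) y) (rowTile x (C x) (A (x + 1)) (y + 1)) =
      (rowTile x (C x) (C (x + 1)) y, rowTile x (C x) (C (x + 1)) (y + 1)) ∧
    ∀ c, c ≠ y → c ≠ y + 1 → rowTile x (C x) (C (x + 1)) c = rowTile x (C x) (A (x + 1)) c := by
  have h1 : C (x + 1) p = y := by
    rw [hCx p hpx, jdtApp, if_pos rfl, hp, Nat.add_sub_cancel]
  have h2 : ∀ l, l ≤ x → l ≠ p → C (x + 1) l = A (x + 1) l := by
    intro l hl hlp
    rw [hCx l hl, jdtApp, if_neg hlp, if_neg]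
    intro h
    have h3 := hw.rowTile_blank.1 hb l hl
    have h4 := hw.1 l
    omega
  exact ⟨rowTile_topPair hw (hC x).wrow hpx hp hpu hb h1 h2,
    fun c hc hc' => rowTile_undroop_top_of_ne hc hc' hp h1 h2⟩

/-- The label `p` stays in column `y + 1` until it turns in row `x'`, so each row in between slides
by the transducer. No pipe enters row `x'` from above in column `y`, hence its bottom corner changes
only by the turn of `p`. -/
theorem undroop_splice {x' : ℕ} (hxx : x < x') (hw' : WRow x' (C x') (A (x' + 1)))
    (hτ : ∀ h, x < h → h ≤ x' → A h p = y + 1 ∧ ∀ l, l < h → C h l = jdtApp (A h) p l)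
    (hturn : A (x' + 1) p < y + 1) (hno : ∀ l, l < x' → A x' l ≠ y) :
    undroop (tilingOf (splice x C A)) x x' y = tilingOf (splice x' C A) := by
  have htop := jdt_top_row hC hw hpx hpu hb (hτ (x + 1) (by omega) (by omega)).1
    fun l hl => (hτ (x + 1) (by omega) (by omega)).2 l (by omega)
  funext s t
  unfold undroop
  rcases lt_trichotomy s x with hs | rfl | hs
  · rw [tilingOf_splice_of_lt (hs.trans hxx), if_neg (by omega), if_neg (by omega), if_neg (by omega),
      if_neg (by omega), if_neg (by omega), if_neg (by omega), tilingOf_splice_of_lt hs]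
  · simp only [tilingOf_splice_self, tilingOf_splice_of_lt hxx, htop.1, true_and, lt_irrefl, false_and,
      if_false, hxx.ne]
    split_ifs with h1 h2
    · rw [h1]
    · rw [h2]
    · rw [htop.2 t h1 h2]
  · simp only [hs.ne', false_and, if_false, hs, true_and]
    rcases lt_trichotomy s x' with hs' | rfl | hs'
    · simp only [hs'.ne, false_and, if_false, hs', true_and, tilingOf_splice_of_gt hs,
        tilingOf_splice_of_lt hs']
      have h1 := hτ s hs hs'.le
      have h2 := hτ (s + 1) (by omega) hs'
      rw [rowTile_slidePair (hA s) (hC s).wrow (by omega) h1.1 h2.1 h1.2 (fun l hl => h2.2 l (by omega))]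
      split_ifs with h3 h4
      · rw [h3]
      · rw [h4]
      · exact (rowTile_slide_of_ne (hA s) (by omega) h1.1 h2.1 h1.2 (fun l hl => h2.2 l (by omega))
          h3 h4).symm
    · simp only [true_and, lt_irrefl, false_and, if_false, tilingOf_splice_of_gt hs, tilingOf_splice_self]
      obtain ⟨h1, h2⟩ := hτ s hs le_rfl
      have h3 : C s p = y := by
        rw [h2 p (by omega), jdtApp, if_pos rfl, h1, Nat.add_sub_cancel]
      have h4 : ∀ l, l < s → l ≠ p → C s l = A s l := by
        intro l hl hlp
        have := hno l hl
        rw [h2 l hl, jdtApp, if_neg hlp, if_neg (by omega)]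
      split_ifs with h5 h6
      · rw [h5, rowTile_undroopSW (hA s) hw' (by omega) h1 hturn hno h3 h4]
      · rw [h6, rowTile_undroopSE (hA s) hw' (by omega) h1 hturn h3 h4]
      · exact (rowTile_undroop_bot_of_ne (by omega) h1 hturn h3 h4 h5 h6).symm
    · simp only [hs'.ne', false_and, if_false, hs'.not_gt, tilingOf_splice_of_gt hs,
        tilingOf_splice_of_gt hs']

/-- Below row `x'` the labels `p` and `q` occupy columns `y + 1` and `y` for good. There jeu de
taquin only trades their names, and the tiles stay as they are. -/
theorem uncross_splice {x' q : ℕ} (hxx : x < x')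
    (hτ : ∀ h, x < h → A h p = y + 1 ∧ ∀ l, l < h → C h l = jdtApp (A h) p l)
    (hq : ∀ h, x' < h → q < h ∧ A h q = y) (hqx : q = x' ∨ y + 1 < A x' q) :
    undroop (setTile (tilingOf (splice x C A)) x' (y + 1) Tile.bump) x x' y = tilingOf C := by
  have htop := jdt_top_row hC hw hpx hpu hb (hτ (x + 1) (by omega)).1
    fun l hl => (hτ (x + 1) (by omega)).2 l (by omega)
  have hset : ∀ s c, s ≠ x' ∨ c ≠ y + 1 →
      setTile (tilingOf (splice x C A)) x' (y + 1) Tile.bump s c = tilingOf (splice x C A) s c :=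
    fun s c h => if_neg (by omega)
  have hset' : setTile (tilingOf (splice x C A)) x' (y + 1) Tile.bump x' (y + 1) = Tile.bump :=
    if_pos ⟨rfl, rfl⟩
  funext s t
  unfold undroop
  rcases lt_trichotomy s x with hs | rfl | hs
  · rw [if_neg (by omega), if_neg (by omega), if_neg (by omega), if_neg (by omega), if_neg (by omega),
      if_neg (by omega), hset s t (by omega), tilingOf_splice_of_lt hs, tilingOf]
  · change _ = rowTile s (C s) (C (s + 1)) t
    rw [hset s y (by omega), hset s (y + 1) (by omega), hset s t (by omega)]
    simp only [tilingOf_splice_self, htop.1, true_and, lt_irrefl, false_and, if_false, hxx.ne]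
    split_ifs with h1 h2
    · rw [h1]
    · rw [h2]
    · rw [htop.2 t h1 h2]
  · simp only [hs.ne', false_and, if_false, hs, true_and]
    have h1 := hτ s hs
    have h2 := hτ (s + 1) (by omega)
    have hr : ∀ c, tilingOf C s c = rowTile s (C s) (C (s + 1)) c := fun c => rfl
    have hne : ∀ c, c ≠ y → c ≠ y + 1 → tilingOf C s c = rowTile s (A s) (A (s + 1)) c := fun c h3 h4 =>
      rowTile_slide_of_ne (hA s) (by omega) h1.1 h2.1 h1.2 (fun l hl => h2.2 l (by omega)) h3 h4
    rcases lt_trichotomy s x' with hs' | rfl | hs'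
    · rw [hset s y (by omega), hset s (y + 1) (by omega), hset s t (by omega)]
      simp only [hs'.ne, false_and, if_false, hs', true_and, tilingOf_splice_of_gt hs]
      rw [rowTile_slidePair (hA s) (hC s).wrow (by omega) h1.1 h2.1 h1.2 (fun l hl => h2.2 l (by omega))]
      split_ifs with h3 h4
      · rw [h3, hr]
      · rw [h4, hr]
      · exact (hne t h3 h4).symm
    · have hqs := hq (s + 1) (by omega)
      obtain ⟨e1, -, e3, e4⟩ := rowTile_slide_rturn (hA s) (hC s).wrow (by omega) h1.1 h2.1 h1.2
        (fun l hl => h2.2 l (by omega)) (show q ≤ s by omega) hqs.2 hqx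
      simp only [true_and, lt_irrefl, false_and, if_false]
      split_ifs with h3 h4
      · rw [h3, hset s y (by omega), tilingOf_splice_of_gt hs, e1, hr, e3]
        rfl
      · rw [h4, hset', hr, e4]
        rfl
      · rw [hset s t (by omega), tilingOf_splice_of_gt hs]
        exact (hne t h3 h4).symm
    · simp only [hs'.ne', false_and, if_false, hs'.not_gt]
      rw [hset s t (by omega), tilingOf_splice_of_gt hs, hr]
      have h3 := hq s hs'
      have h4 := hq (s + 1) (by omega)
      have hpq : q ≠ p := by
        rintro rfl
        omega
      have hCs : ∀ h, x < h → x' < h → C h p = A h q ∧ C h q = A h p ∧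
          ∀ l, l < h → l ≠ p → l ≠ q → C h l = A h l := by
        intro h hh hh'
        obtain ⟨g1, g2⟩ := hτ h hh
        obtain ⟨g3, g4⟩ := hq h hh'
        refine ⟨?_, ?_, fun l hl hlp hlq => ?_⟩
        · rw [g2 p (by omega), jdtApp, if_pos rfl, g1, g4, Nat.add_sub_cancel]
        · rw [g2 q g3, jdtApp, if_neg hpq, if_pos (by rw [g1, g4])]
        · rw [g2 l hl, jdtApp, if_neg hlp, if_neg]
          intro h5
          refine hlq ?_
          obtain ⟨h', rfl⟩ : ∃ h', h = h' + 1 := ⟨h - 1, by omega⟩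
          exact (hA h').wrow.inj (by omega) (by omega) (by omega)
      obtain ⟨c1, c2, c3⟩ := hCs s hs hs'
      obtain ⟨d1, d2, d3⟩ := hCs (s + 1) (by omega) (by omega)
      exact (rowTile_swap t (by omega) h3.1 c1 c2 c3 d1 d2 fun l hl => d3 l (by omega)).symm

end undroop

/-! ### Jeu de taquin of tilings is jeu de taquin on sequences. -/

section jdt
variable {b : ℕ} {A : ℕ → ℕ → ℕ} (hA : Valid A) (hb : FirstRow b A)
include hA hb

theorem jdtSeq_splice_wseq {n i : ℕ} (hn : Bdd n A) (hi : WRow i (jdtSeq b A i) (A (i + 1))) :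
    WSeq (max n (i + 1)) (splice i (jdtSeq b A) A) :=
  splice_wseq hA hn (fun s _ => (jdtSeq_row hA hb s).wrow) hi

/-- The mark may stand in row `i` between column `lo` and the column to the left of the pipe `p`. -/
structure MarkRow (b : ℕ) (A : ℕ → ℕ → ℕ) (i p lo : ℕ) : Prop where
  state : jdtState b A (i + 1) = p
  le : b ≤ i
  row : WRow i (jdtSeq b A i) (A (i + 1))
  label : p ≤ i
  lt : lo < A (i + 1) p
  top : p = i ∨ A (i + 1) p ≤ jdtSeq b A i p
  blank : ∀ c, lo ≤ c → c < A (i + 1) p → rowTile i (jdtSeq b A i) (A (i + 1)) c = Tile.blank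

theorem markRow_start : MarkRow b A b b b := by
  have hid : ∀ l, l < b → A b l = l := fun l hl => hb.1 b l le_rfl hl
  have hr := (hA.row b).wrow
  refine ⟨jdtState_start b A, le_rfl, ?_, le_rfl, hb.2, Or.inl rfl, fun c h1 h2 => ?_⟩
  · rwa [jdtSeq_of_le hA le_rfl]
  · rw [jdtSeq_of_le hA le_rfl, hr.rowTile_blank]
    rintro l hl ⟨h3, h4⟩
    rcases hl.lt_or_eq with h | rfl
    · have := hid l h
      omega
    · omega

/-- A pipe leaving upwards just to the left of the turning pipe `p` would cross its run vertically,
so its label would be smaller, against the invariant. After the turn is removed, minimality in the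
definition of the next label makes all tiles from the vacated one up to the next pipe empty. -/
theorem markRow_turn {i : ℕ} (hi : b < i) (hturn : A (i + 1) (jdtState b A i) ≠ A i (jdtState b A i)) :
    MarkRow b A i (jdtState b A (i + 1)) (A i (jdtState b A i)) ∧ ∀ l, l < i → A i l + 1 ≠ A i (jdtState b A i) := by
  have hr := hA.row i
  have hst := jdt_step hA hb hi
  obtain ⟨hp, hp1, hq⟩ := jdt_inv hA hb hi
  have hp' := (jdt_inv hA hb (h := i + 1) (by omega)).1
  have hCi : ∀ l, l < i → jdtSeq b A i l = jdtApp (A i) (jdtState b A i) l := fun l hl => jdtSeq_apply hi hl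
  generalize jdtState b A i = p at *
  generalize hpe : jdtState b A (i + 1) = p' at hst hp' ⊢
  have hp : p < i := hp
  have hq : ∀ l, l < i → l < p → A i l + 1 ≠ A i p := hq
  have hvp := hr.1 p hp
  have hno : ∀ l, l < i → A i l + 1 ≠ A i p := by
    intro l hl h
    have h1 := hr.pair l p hl.le hp.le
    have h2 := hq l hl
    have h3 := hr.1 l hl
    by_cases hlp : l = p
    · subst hlp
      omega
    · omega
  have hC : ∀ l, l < i → (l = p ∧ A i l = A i p ∧ jdtSeq b A i l + 1 = A i p ∧ A (i + 1) l = A (i + 1) p) ∨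
      (l ≠ p ∧ jdtSeq b A i l = A i l) := by
    intro l hl
    have := hno l hl
    rw [hCi l hl, jdtApp]
    split_ifs with h1
    · subst h1
      omega
    · omega
  clear hCi
  cases hst with
  | stay h => exact absurd h hturn
  | turn _ _ hle hv hmin =>
  have hw : WRow i (jdtSeq b A i) (A (i + 1)) := by
    refine ⟨fun l hl => ?_, fun l m hl hm => ?_⟩
    · have := hC l hl
      have := hr.1 l hl
      omega
    · have h1 := hC l (by omega)
      have h2 := hr.2 l m hl hm
      have h3 := hr.1 l (by omega)
      rcases hm.lt_or_eq with h | h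
      · have h4 := hC m h
        have h5 := hr.1 m h
        have h6 := hno l (by omega)
        have h7 := hno m h
        omega
      · omega
  have htop : p' = i ∨ A (i + 1) p' ≤ jdtSeq b A i p' := by
    rcases hle.lt_or_eq with h | h
    · have := hC p' h
      have := hr.1 p' h
      omega
    · exact Or.inl h
  refine ⟨⟨hpe, hi.le, hw, hle, hv, htop, fun c h1 h2 => ?_⟩, hno⟩
  rw [hw.rowTile_blank]
  rintro l hl ⟨h3, h4⟩
  have h5 := hmin l hl
  have h6 := hr.pair l p hl hp.le
  rcases hl.lt_or_eq with h | h
  · have h7 := hC l h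
    omega
  · omega

end jdt

section jdt
variable {b : ℕ} {A : ℕ → ℕ → ℕ} (hA : Valid A) (hb : FirstRow b A)
include hA hb

theorem jdtState_of_straight {i x' : ℕ} (hbi : b ≤ i)
    (hst : ∀ s, i < s → s < x' → A (s + 1) (jdtState b A s) = A s (jdtState b A s)) (h : ℕ)
    (hi : i < h) (hh : h ≤ x') : jdtState b A h = jdtState b A (i + 1) ∧
      A h (jdtState b A (i + 1)) = A (i + 1) (jdtState b A (i + 1)) := by
  induction h, hi using Nat.le_induction with
  | base => exact ⟨rfl, rfl⟩
  | succ s hs ih =>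
    obtain ⟨h1, h2⟩ := ih (by omega)
    have h3 := hst s hs (by omega)
    have h4 := (jdt_step hA hb (h := s) (by omega)).unique (hA.row s) (.stay _ h3)
    rw [h1] at h3 h4
    exact ⟨h4, h3.trans h2⟩

omit hA hb in
theorem jdtFrom_move {T E : Tiling} {i c y : ℕ} (hcy : c ≤ y)
    (hT : ∀ x, c ≤ x → x ≤ y → T i x = Tile.blank) : JdtFrom T i c E ↔ JdtFrom T i y E := by
  induction y, hcy using Nat.le_induction with
  | base => rfl
  | succ y hy ih =>
    rw [ih fun x h1 h2 => hT x h1 (by omega)]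
    have h0 := hT y hy (by omega)
    have h1 := hT (y + 1) (by omega) le_rfl
    constructor
    · intro h
      cases h with
      | move _ _ _ _ _ _ h => exact h
      | undroop _ _ _ _ _ _ _ hne => exact absurd h1 hne
      | uncross _ _ _ _ _ hne => exact absurd h1 hne
    · exact fun h => .move _ _ _ _ h0 h1 h

/-- If the current pipe still turns further down, the first such turn gives the undroop and the row
of the next mark. Otherwise it goes straight down, so it is pipe `y + 1`, and the final uncrossing
takes place. -/
theorem jdtFrom_splice {n : ℕ} (hn : Bdd n A) (E : Tiling) : ∀ (d i p lo : ℕ), n ≤ i + d →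
    MarkRow b A i p lo → ∀ c, lo ≤ c → c < A (i + 1) p →
    (JdtFrom (tilingOf (splice i (jdtSeq b A) A)) i c E ↔ E = tilingOf (jdtSeq b A)) := by
  classical
  intro d
  induction d using Nat.strong_induction_on with
  | _ d ih =>
  intro i p lo hd hm c hc1 hc2
  obtain ⟨hσ, hbi, hw, hpi, hlt, htop, hblank⟩ := hm
  obtain ⟨y, hy⟩ : ∃ y, A (i + 1) p = y + 1 := ⟨A (i + 1) p - 1, by omega⟩
  rw [hy] at hlt htop hblank hc2
  have hT : ∀ x, tilingOf (splice i (jdtSeq b A) A) i x = rowTile i (jdtSeq b A i) (A (i + 1)) x :=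
    fun x => tilingOf_splice_self x
  rw [jdtFrom_move (y := y) (by omega) fun x h1 h2 => by
    rw [hT]
    exact hblank x (by omega) (by omega)]
  have hZ := jdtSeq_splice_wseq hA hb hn hw
  have h0 : tilingOf (splice i (jdtSeq b A) A) i y = Tile.blank := by
    rw [hT]
    exact hblank y (by omega) (by omega)
  have h1 : tilingOf (splice i (jdtSeq b A) A) i (y + 1) ≠ Tile.blank := by
    rw [hT, Ne, hw.rowTile_blank]
    exact fun h => h p hpi ⟨hy.le, htop⟩
  have hE : Enters (tilingOf (splice i (jdtSeq b A) A))
      (bottomCol (max n (i + 1)) (splice i (jdtSeq b A) A) p) Side.south i (y + 1) :=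
    (enters_label_iff hZ).2 ⟨hpi, by rw [splice_of_lt (by omega)]; exact hy⟩
  have hC : ∀ h, i < h → jdtState b A h = p → ∀ l, l < h → jdtSeq b A h l = jdtApp (A h) p l :=
    fun h hh hs l hl => by rw [jdtSeq_apply (by omega) hl, hs]
  have hdecr : ∀ h h', i < h → h ≤ h' → A h' p ≤ A h p := by
    intro h h' hh hh'
    induction h', hh' using Nat.le_induction with
    | base => exact le_rfl
    | succ s hs ih => exact ((hA.row s).1 p (by omega)).trans ih
  have hbot : ∀ l h, l < h → n + i < h → bottomCol (max n (i + 1)) (splice i (jdtSeq b A) A) l = A h l := by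
    intro l h hl hh
    rw [← hZ.eq_bottomCol hl (by omega), splice_of_lt (by omega)]
  by_cases hturn : ∃ x, i < x ∧ A (x + 1) (jdtState b A x) ≠ A x (jdtState b A x)
  · obtain ⟨x', ⟨hx1, hx2⟩, hmin⟩ : ∃ x, (i < x ∧ A (x + 1) (jdtState b A x) ≠ A x (jdtState b A x)) ∧
        ∀ s, i < s → s < x → A (s + 1) (jdtState b A s) = A s (jdtState b A s) :=
      ⟨Nat.find hturn, Nat.find_spec hturn, fun s hs hs' => by
        have := Nat.find_min hturn hs'
        simpa [hs] using this⟩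
    have hall := jdtState_of_straight hA hb hbi hmin
    rw [hσ, hy] at hall
    obtain ⟨hm', hno⟩ := markRow_turn hA hb (by omega) hx2
    obtain ⟨hσ', hAp⟩ := hall x' hx1 le_rfl
    rw [hσ'] at hm' hno hx2
    rw [hAp] at hm' hno hx2
    have hx3 : A (x' + 1) p < y + 1 := by
      have := (hA.row x').1 p (by omega)
      omega
    have hxn : x' < n := by
      by_contra! hle
      have := hn.const (h := x' + 1) (h' := x') (l := p) (by omega) hle (by omega) (by omega)
      omega
    -- A pipe that turns comes from strictly further left, so it is not pipe `y + 1`.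
    have hbp : bottomCol (max n (i + 1)) (splice i (jdtSeq b A) A) p < y + 1 := by
      rw [hbot p (n + i + x' + 1) (by omega) (by omega)]
      exact (hdecr (x' + 1) _ (by omega) (by omega)).trans_lt hx3
    have hun := undroop_splice hA.row (jdtSeq_row hA hb) hw hpi htop (hblank y (by omega) (by omega)) hx1 hm'.row
      (fun h g1 g2 => ⟨(hall h g1 g2).2, hC h g1 (hall h g1 g2).1⟩) hx3 fun l hl h => hno l hl (by rw [h])
    have hih := ih (n - x') (by omega) x' _ _ (by omega) hm' (y + 1) le_rfl hm'.lt
    constructor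
    · intro h
      cases h with
      | move _ _ _ _ _ h2 => exact absurd h2 h1
      | undroop _ _ _ _ p₀ x₀ _ _ hp hne hx hj hpj h =>
        obtain rfl := enters_unique hZ hE hp
        have h3 := (enters_label_iff hZ).1 hpj
        obtain ⟨h4, h5, h6⟩ := h3
        rw [splice_of_lt (by omega)] at h5
        rw [splice_of_lt hx] at h6
        obtain rfl : x₀ = x' := by
          rcases lt_trichotomy x₀ x' with g | g | g
          · have := (hall (x₀ + 1) (by omega) (by omega)).2
            omega
          · exact g
          · have := hdecr (x' + 1) x₀ (by omega) (by omega)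
            omega
        rw [hun] at h
        exact hih.1 h
      | uncross _ _ _ x₀ _ _ hp =>
        have := enters_unique hZ hE hp
        omega
    · intro h
      refine .undroop _ _ _ _ _ x' h0 h1 hE hbp.ne hx1 ?_
        ((enters_label_iff hZ).2 ⟨by omega, by rwa [splice_of_lt (by omega)], Or.inr ?_⟩) ?_
      · rw [tilingOf_splice_of_gt hx1, (hA.row x').wrow.rowTile_jturn]
        refine ⟨⟨p, by omega, hx3, hAp⟩, ?_⟩
        rintro l ⟨g1, g2, g3⟩
        have := (hA.row x').wrow.pair l p g1 (by omega)
        have := (hA.row x').pair l p g1 (by omega)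
        omega
      · rw [splice_of_lt hx1, hAp]
      · rw [hun]
        exact hih.2 h
  · push Not at hturn
    have hall : ∀ h, i < h → jdtState b A h = p ∧ A h p = y + 1 := by
      intro h hh
      have := jdtState_of_straight hA hb hbi (x' := h) (fun s hs _ => hturn s hs) h hh le_rfl
      rwa [hσ, hy] at this
    have hbp : bottomCol (max n (i + 1)) (splice i (jdtSeq b A) A) p = y + 1 := by
      rw [hbot p (n + i + 1) (by omega) (by omega), (hall _ (by omega)).2]
    rw [hbp] at hE
    obtain ⟨q, hqlt, hq⟩ := hA.surj hn (h := n + i + y + 1) (c := y) (by omega) (by omega)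
    have hbq : bottomCol (max n (i + 1)) (splice i (jdtSeq b A) A) q = y := by
      rw [hbot q _ hqlt (by omega), hq]
    have hex : ∃ h, i < h ∧ ∀ h', h ≤ h' → q < h' ∧ A h' q = y := by
      refine ⟨n + i + y + 1, by omega, fun h' hh' => ⟨by omega, ?_⟩⟩
      rw [hn.const (h := h') (h' := n + i + y + 1) (by omega) (by omega) (by omega) hqlt, hq]
    -- `H` is the first line below row `i` from which pipe `y` remains in column `y`; the row above
    -- it contains its crossing with pipe `y + 1`.
    obtain ⟨H, ⟨hH1, hH2⟩, hHmin⟩ : ∃ h, (i < h ∧ ∀ h', h ≤ h' → q < h' ∧ A h' q = y) ∧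
        ∀ s, s < h → ¬ (i < s ∧ ∀ h', s ≤ h' → q < h' ∧ A h' q = y) :=
      ⟨Nat.find hex, Nat.find_spec hex, fun s hs => Nat.find_min hex hs⟩
    obtain ⟨s, rfl⟩ : ∃ s, H = s + 1 := ⟨H - 1, by omega⟩
    obtain ⟨hqs, hAq⟩ := hH2 (s + 1) le_rfl
    -- The tile left of the current pipe in row `i` is empty, so pipe `y` cannot already come up
    -- there.
    have his : i < s := by
      by_contra! hle
      obtain rfl : s = i := by omega
      refine hw.rowTile_blank.1 (hblank y (by omega) (by omega)) q (by omega) ⟨hAq.le, ?_⟩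
      have := hw.1 q
      omega
    have hAs := (hall s his).2
    have hAs' := (hall (s + 1) (by omega)).2
    have hqp : q ≠ p := by
      rintro rfl
      omega
    have hqu : q = s ∨ y + 1 < A s q := by
      by_contra! hcon
      refine hHmin s (Nat.lt_succ_self s) ⟨his, fun h' hh' => ?_⟩
      rcases hh'.lt_or_eq with g | rfl
      · exact hH2 h' g
      · have g1 := (hA.row s).1 q (by omega)
        have g2 : A s q ≠ A s p := fun h => hqp ((hA.row s).wrow.inj_top (by omega) (by omega) h)
        exact ⟨by omega, by omega⟩
    have hcr : Vt s (A s) (A (s + 1)) (y + 1) p ∧ Thru s (A s) (A (s + 1)) (y + 1) q :=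
      ⟨⟨by omega, hAs', hAs⟩, by omega, by omega, hqu⟩
    have hcrT : ∀ x c, i < x → (CrossAt (tilingOf (splice i (jdtSeq b A) A)) y (y + 1) x c ↔
        (Vt x (A x) (A (x + 1)) c p ∧ Thru x (A x) (A (x + 1)) c q) ∨
          (Vt x (A x) (A (x + 1)) c q ∧ Thru x (A x) (A (x + 1)) c p)) := by
      intro x c hx
      have := crossAt_label_iff hZ (l := q) (m := p) (i := x) (j := c)
      rw [hbp, hbq, splice_of_lt hx, splice_of_lt (by omega)] at this
      rw [this, or_comm]
    have hun := uncross_splice hA.row (jdtSeq_row hA hb) hw hpi htop (hblank y (by omega) (by omega)) his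
      (fun h g => ⟨(hall h g).2, hC h g (hall h g).1⟩) (fun h g => hH2 h g) hqu
    constructor
    · intro h
      cases h with
      | move _ _ _ _ _ h2 => exact absurd h2 h1
      | undroop _ _ _ _ p₀ x₀ _ _ hp hne hx hj hpj h =>
        exact absurd (enters_unique hZ hE hp).symm hne
      | uncross _ _ _ x₀ _ _ hp hx hc =>
        rcases (hcrT _ _ hx).1 hc with g | g
        · obtain ⟨rfl, -⟩ := hA.cross_unique hcr g
          exact hun
        · have g1 := (hall x₀ hx).2
          have g2 := (hall (x₀ + 1) (by omega)).2
          unfold Vt Thru at g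
          omega
    · rintro rfl
      rw [← hun]
      exact .uncross _ _ _ _ h0 h1 hE his ((hcrT _ _ his).2 (Or.inl hcr))

end jdt

/-! ### Rectification as iterated jeu de taquin. -/

section rect
variable {b : ℕ} {A : ℕ → ℕ → ℕ} (hA : Valid A) (hid : ∀ h l, h ≤ b → l < h → A h l = l)
include hA hid

theorem blank_firstRow_iff (c : ℕ) :
    tilingOf A b c = Tile.blank ↔ b ≤ c ∧ c < A (b + 1) b := by
  have hr := hA.row b
  have h1 := (hr.id_top fun l hl => hid b l le_rfl hl).1
  rw [tilingOf, hr.wrow.rowTile_blank]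
  constructor
  · intro h
    have h2 := h b le_rfl
    refine ⟨?_, by omega⟩
    by_contra! hc
    exact h c hc.le ⟨(h1 c hc).le, Or.inr (hid b c le_rfl hc).ge⟩
  · rintro ⟨h2, h3⟩ l hl ⟨h4, h5⟩
    rcases hl.lt_or_eq with h | rfl
    · have := hid b l le_rfl h
      omega
    · omega

theorem isFirstBlankRow (hb : b < A (b + 1) b) : IsFirstBlankRow (tilingOf A) b := by
  refine ⟨⟨b, (blank_firstRow_iff hA hid b).2 ⟨le_rfl, hb⟩⟩, ?_⟩
  rintro i ⟨c, hc⟩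
  by_contra! hi
  have h1 := hid (i + 1) i (by omega) (by omega)
  have h2 := (blank_firstRow_iff (b := i) hA (fun h l hh hl => hid h l (by omega) hl) c).1 hc
  omega

theorem jdt_iff (hb : b < A (b + 1) b) (r : ℕ) (E : Tiling) :
    Jdt (tilingOf A) b r E ↔ r + 1 = A (b + 1) b ∧ E = tilingOf (jdtSeq b A) := by
  obtain ⟨n, hn⟩ := hA.bdd
  have hF : FirstRow b A := ⟨hid, hb⟩
  have h0 : tilingOf A = tilingOf (splice b (jdtSeq b A) A) := by
    congr 1
    funext h
    rcases Nat.lt_or_ge b h with hh | hh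
    · rw [splice_of_lt hh]
    · rw [splice_of_le hh, jdtSeq_of_le hA hh]
  have hJ := jdtFrom_splice hA hF hn E n b b b (by omega) (markRow_start hA hF)
  rw [← h0] at hJ
  have hg : IsGreatest {j | tilingOf A b j = Tile.blank} r ↔ r + 1 = A (b + 1) b := by
    constructor
    · intro h
      have h1 := (blank_firstRow_iff hA hid r).1 h.1
      have h2 := h.2 ((blank_firstRow_iff hA hid (A (b + 1) b - 1)).2 ⟨by omega, by omega⟩)
      omega
    · intro h
      refine ⟨(blank_firstRow_iff hA hid r).2 ⟨by omega, by omega⟩, fun c hc => ?_⟩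
      have := (blank_firstRow_iff hA hid c).1 hc
      omega
  rw [Jdt, hg]
  constructor
  · rintro ⟨-, h1, h2⟩
    exact ⟨h1, (hJ r (by omega) (by omega)).1 h2⟩
  · rintro ⟨h1, h2⟩
    exact ⟨isFirstBlankRow hA hid hb, h1, (hJ r (by omega) (by omega)).2 h2⟩

omit hA hid in
theorem jdtSeq_first (hb : b < A (b + 1) b) : jdtSeq b A (b + 1) b + 1 = A (b + 1) b := by
  rw [jdtSeq_apply (by omega) (by omega), jdtState_start, jdtApp, if_pos rfl]
  omega

/-- Row `b` has the empty tiles `b, …, b + m - 1`. Each round moves pipe `b` one column left and so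
removes just the rightmost of them, in agreement with the list. -/
theorem jdtSeq_list_iff (m : ℕ) (hm : A (b + 1) b = b + m) (cols : List ℕ)
    (hp : cols.Pairwise fun c c' => c' < c) (hc : ∀ c, c ∈ cols ↔ b ≤ c ∧ c < b + m) (E : Tiling) :
    JdtSeq b cols (tilingOf A) E ↔ E = tilingOf ((jdtSeq b)^[m] A) := by
  induction m generalizing A cols with
  | zero =>
    obtain rfl : cols = [] := List.eq_nil_iff_forall_not_mem.2 fun c h => by
      have := (hc c).1 h
      omega
    constructor
    · intro h
      cases h
      rfl
    · rintro rfl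
      exact .nil _
  | succ m ih =>
    have hlt : b < A (b + 1) b := by omega
    have hF : FirstRow b A := ⟨hid, hlt⟩
    obtain _ | ⟨r, rs⟩ := cols
    · exact absurd ((hc b).2 (by omega)) (by simp)
    obtain ⟨hp1, hp2⟩ := List.pairwise_cons.1 hp
    have hr : r = b + m := by
      have h1 := (hc r).1 (by simp)
      rcases List.mem_cons.1 ((hc (b + m)).2 (by omega)) with h2 | h2
      · exact h2.symm
      · have := hp1 _ h2
        omega
    have hfirst := jdtSeq_first hlt
    have ih' := ih (jdtSeq_valid hA hF) (fun h l hh hl => by rw [jdtSeq_of_le hA hh]; exact hid h l hh hl)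
      (by omega) rs hp2 (fun c => by
        constructor
        · intro h
          have h1 := hp1 c h
          have h2 := (hc c).1 (by simp [h])
          omega
        · intro h
          rcases List.mem_cons.1 ((hc c).2 (by omega)) with h2 | h2
          · omega
          · exact h2)
    rw [Function.iterate_succ_apply, ← ih']
    constructor
    · intro h
      cases h with
      | cons _ _ _ D₁ _ h₁ h =>
        rwa [← ((jdt_iff hA hid hlt _ _).1 h₁).2]
    · exact fun h => .cons _ _ _ _ _ ((jdt_iff hA hid hlt _ _).2 ⟨by omega, rfl⟩) h

theorem rect_iff {m : ℕ} (hm : A (b + 1) b = b + m) (hpos : 0 < m) (E : Tiling) :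
    Rect (tilingOf A) E ↔ E = tilingOf ((jdtSeq b)^[m] A) := by
  have hfb := isFirstBlankRow hA hid (by omega)
  constructor
  · rintro ⟨b', cols, h1, h2, h3, h4⟩
    obtain rfl := h1.unique hfb
    refine (jdtSeq_list_iff hA hid m hm cols h2 (fun c => ?_) E).1 h4
    rw [h3, blank_firstRow_iff hA hid, hm]
  · intro h
    have hp : ((List.range' b m).reverse).Pairwise fun c c' => c' < c :=
      List.pairwise_reverse.2 List.pairwise_lt_range'
    have hc : ∀ c, c ∈ (List.range' b m).reverse ↔ b ≤ c ∧ c < b + m := fun c => by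
      simp [List.mem_range']
      constructor
      · rintro ⟨i, h1, rfl⟩
        omega
      · intro h1
        exact ⟨c - b, by omega, by omega⟩
    refine ⟨b, _, hfb, hp, fun c => ?_, (jdtSeq_list_iff hA hid m hm _ hp hc E).2 h⟩
    rw [hc, blank_firstRow_iff hA hid, hm]

theorem iterate_jdt_ins_comm {k a : ℕ} (hk : KIncAll k A) (ha : a < k) (hba : b ≤ a) (m : ℕ)
    (hm : A (b + 1) b = b + m) :
    (jdtSeq b)^[m] (insSeq k a A) = insSeq k a ((jdtSeq b)^[m] A) := by
  induction m generalizing A with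
  | zero => rfl
  | succ m ih =>
    have hlt : b < A (b + 1) b := by omega
    have hF : FirstRow b A := ⟨hid, hlt⟩
    have hfirst := jdtSeq_first hlt
    rw [Function.iterate_succ_apply, Function.iterate_succ_apply, jdt_ins_comm hA hk ha hF hba]
    exact ih (jdtSeq_valid hA hF) (fun h l hh hl => by rw [jdtSeq_of_le hA hh]; exact hid h l hh hl)
      (jdtSeq_kinc hA hF hk) (by omega)

end rect

/-! ### The theorem for words. -/

theorem insWord_append (A : ℕ → ℕ → ℕ) (w : Biword) (x : ℕ × ℕ) :
    insWord A (w ++ [x]) = insSeq x.2 (x.1 - 1) (insWord A w) := by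
  induction w generalizing A with
  | nil => rfl
  | cons y w ih => exact ih _

/-- Only an insertion starting in row `b` affects line `b + 1`, and it moves label `b` by one; so
the empty tiles of the first row count the minimal letters. -/
theorem insWord_props {b : ℕ} (w : Biword) (hw : IsPlactic w) (hb : ∀ x ∈ w, b + 1 ≤ x.1) :
    Valid (insWord idSeq w) ∧ (∀ k, (∀ x ∈ w, k ≤ x.2) → KIncAll k (insWord idSeq w)) ∧
    (∀ h l, h ≤ b → l < h → insWord idSeq w h l = l) ∧
    insWord idSeq w (b + 1) b = b + w.countP (fun x => decide (x.1 = b + 1)) := by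
  induction w using List.reverseRecOn with
  | nil =>
    refine ⟨idSeq_valid, fun k _ => idSeq_kinc k, fun h l _ hl => ?_, ?_⟩ <;> simp [insWord, idSeq]
    omega
  | append_singleton w x ih =>
    have hp := List.pairwise_append.1 hw.2
    obtain ⟨hV, hK, hid, hc⟩ := ih ⟨fun y hy => hw.1 y (by simp [hy]), hp.1⟩ fun y hy => hb y (by simp [hy])
    have hKx := hK x.2 fun y hy => hp.2.2 y hy x (by simp)
    have hx := hw.1 x (by simp)
    have hbx := hb x (by simp)
    have hax : x.1 - 1 < x.2 := by omega
    rw [insWord_append]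
    refine ⟨insSeq_valid hV hKx hax, fun k hk => (insSeq_kinc hV hKx hax).mono (hk x (by simp)),
      fun h l hh hl => ?_, ?_⟩
    · rw [insSeq_of_le hV (by omega)]
      exact hid h l hh hl
    · rw [List.countP_append, List.countP_singleton]
      by_cases hxb : x.1 = b + 1
      · rw [if_pos (by simpa using hxb), show x.1 - 1 = b by omega, insSeq_apply (by omega) (by omega),
          insState_start, insApp, if_pos rfl, hc, add_assoc]
      · rw [if_neg (by simpa using hxb), insSeq_of_le hV (by omega), hc]
        rfl

/-- Induction on the last biletter: earlier rounds of jeu de taquin commute past its insertion, and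
a minimal letter brings one extra round, which cancels it. -/
theorem iterate_jdtSeq_insWord {b : ℕ} (w : Biword) (hw : IsPlactic w) (hb : ∀ x ∈ w, b + 1 ≤ x.1) :
    (jdtSeq b)^[w.countP (fun x => decide (x.1 = b + 1))] (insWord idSeq w) =
      insWord idSeq (w.filter fun x => decide (x.1 ≠ b + 1)) := by
  induction w using List.reverseRecOn with
  | nil => rfl
  | append_singleton w x ih =>
    have hp := List.pairwise_append.1 hw.2
    have hw₁ : IsPlactic w := ⟨fun y hy => hw.1 y (by simp [hy]), hp.1⟩
    have hb₁ : ∀ y ∈ w, b + 1 ≤ y.1 := fun y hy => hb y (by simp [hy])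
    have ih := ih hw₁ hb₁
    obtain ⟨hV, hK, hid, hc⟩ := insWord_props w hw₁ hb₁
    have hKx := hK x.2 fun y hy => hp.2.2 y hy x (by simp)
    have hx := hw.1 x (by simp)
    have hbx := hb x (by simp)
    have hax : x.1 - 1 < x.2 := by omega
    have hcomm := iterate_jdt_ins_comm hV hid hKx hax (by omega) _ hc
    rw [ih] at hcomm
    rw [insWord_append, List.countP_append, List.countP_singleton, List.filter_append]
    by_cases hxb : x.1 = b + 1
    · have hf : [x].filter (fun x => decide (x.1 ≠ b + 1)) = [] := by simp [hxb]
      rw [if_pos (by simpa using hxb), hf, List.append_nil, Nat.add_comm, Function.iterate_add_apply, hcomm,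
        Function.iterate_one, show x.1 - 1 = b by omega]
      have hw' : IsPlactic (w.filter fun x => decide (x.1 ≠ b + 1)) :=
        ⟨fun y hy => hw₁.1 y (List.mem_of_mem_filter hy), hw₁.2.filter _⟩
      obtain ⟨hV', hK', hid', hc'⟩ := insWord_props (b := b) _ hw' fun y hy => hb₁ y (List.mem_of_mem_filter hy)
      have hcount : (w.filter fun x => decide (x.1 ≠ b + 1)).countP (fun x => decide (x.1 = b + 1)) = 0 := by
        rw [List.countP_eq_zero]
        intro y hy
        simpa using (List.mem_filter.1 hy).2
      refine jdt_ins_cancel hV' (hK' x.2 fun y hy => hp.2.2 y (List.mem_of_mem_filter hy) x (by simp)) (by omega) ?_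
      -- Cancellation needs the identity also on line `b + 1`. It holds because no minimal letter is
      -- left.
      intro h l hh hl
      rcases hh.lt_or_eq with g | rfl
      · exact hid' h l (by omega) hl
      · rcases (Nat.lt_succ_iff.1 hl).lt_or_eq with g | rfl
        · exact ((hV'.row b).id_top fun l hl => hid' b l le_rfl hl).1 l g
        · rw [hc', hcount]
          rfl
    · have hf : [x].filter (fun x => decide (x.1 ≠ b + 1)) = [x] := by simp [hxb]
      rw [if_neg (by simpa using hxb), hf, insWord_append, ← hcomm]
      rfl

theorem mainTheorem1 (w : Biword) (hw : IsPlactic w) (b : ℕ)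
    (hb : IsLeast {a : ℕ | ∃ k : ℕ, (a, k) ∈ w} b) :
    ∃ D D' : Tiling, IsBPD D ∧ IsBPD D' ∧
      (∀ E : Tiling, IsInsertionBPD w E ↔ E = D) ∧
      (∀ E : Tiling, IsInsertionBPD (w.filter (fun x => decide (x.1 ≠ b))) E ↔ E = D') ∧
      (∀ E : Tiling, Rect D E ↔ E = D') := by
  obtain ⟨k, hbk⟩ := hb.1
  -- The row with number `b` has index `c = b - 1`.
  obtain ⟨c, rfl⟩ : ∃ c, b = c + 1 := ⟨b - 1, by have : 1 ≤ b := (hw.1 _ hbk).1; omega⟩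
  have hmin : ∀ x ∈ w, c + 1 ≤ x.1 := fun x hx => hb.2 ⟨x.2, hx⟩
  have hw' : IsPlactic (w.filter fun x => decide (x.1 ≠ c + 1)) :=
    ⟨fun y hy => hw.1 y (List.mem_of_mem_filter hy), hw.2.filter _⟩
  obtain ⟨hV, hE⟩ := insWord_spec w hw idSeq idSeq_valid fun x _ => idSeq_kinc x.2
  obtain ⟨hV', hE'⟩ := insWord_spec _ hw' idSeq idSeq_valid fun x _ => idSeq_kinc x.2
  rw [tilingOf_idSeq] at hE hE'
  obtain ⟨-, -, hid, hc⟩ := insWord_props w hw hmin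
  refine ⟨_, _, hV.isBPD, hV'.isBPD, hE, hE', fun E => ?_⟩
  rw [rect_iff hV hid hc (List.countP_pos_iff.2 ⟨_, hbk, by simp⟩), iterate_jdtSeq_insWord w hw hmin]
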